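/- **Setting.** Let $g_0:\overline{\mathbb C}\to\overline{\mathbb C}$ be a quadratic rational map with distinct critical points $c_1$ (periodic) and $c_2$, and critical values $v_1=g_0(c_1)$, $v_2=g_0(c_2)$. Let $G=G(g_0)\subset\overline{\mathbb C}$ be a connected finite topological graph with finite vertex set $X$ such that $g_0(X)\subset X$; $G\subset g_0^{-1}(G)$; the closure of every component $U$ of $\overline{\mathbb C}\setminus G$ is a closed topological disc with $U$ as its open disc; $v_1,v_2$ lie in different components of $\overline{\mathbb C}\setminus G$; and $v_2\in g_0^{-r}(G)\setminus G$ for some $r\ge 1$. Call a homeomorphism of $\overline{\mathbb C}$ *isotopic to the identity* if it is the end of an ambient isotopy starting at the identity. *Realizations.* A realization is a branched covering $g=\alpha\circ g_0\circ\beta$, with $\alpha,\beta$ homeomorphisms of $\overline{\mathbb C}$ isotopic to the identity, together with a homeomorphism $\psi$ isotopic to the identity such that $\psi\circ g_0=g\circ\psi$ on $G$, $\psi(g_0^i(v_1))=g^i(\psi(v_1))$ for all $i\ge 0$, and $\psi(v_k)=\alpha(v_k)$ for $k=1,2$. Write $v_2(g)=\psi(v_2)$, $G_0(g)=\psi(G)$,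 $G_n(g)=g^{-n}(G_0(g))$. The vertices of $G_0(g)$ are the points of $\psi(X)$; the vertices of $G_{n+1}(g)$ are the $g$-preimages of the vertices of $G_n(g)$, together with any critical point of $g$ on $G_{n+1}(g)$. Edges of $G_n(g)$ are closures of the components (the open edges) of the complement in $G_n(g)$ of its vertex set; a subgraph is a union of vertices and edges. Let $Q_i(g)$ be $\{v_2(g)\}$ if $v_2(g)$ is a vertex of $G_i(g)$; the edge of $G_i(g)$ whose open edge contains $v_2(g)$ if $v_2(g)$ is a non-vertex point of $G_i(g)$; and otherwise the closure of the component of $\overline{\mathbb C}\setminus G_i(g)$ containing $v_2(g)$. *Admissible sequences.* $\mathcal Q_n$ is the set of sequences $(Q_0(g),\dots,Q_n(g))$, for all realizations $g$, up to the following equivalence: $g$ and $h$, with markings $\psi_g$ and $\psi_h$, give equivalent sequences if there is a homeomorphism $\varphi$ isotopic to the identity with $\varphi\circ\psi_g=\psi_h$ on $G$, $\varphi(G_n(g))=G_n(h)$, $\varphi\circ g=h\circ\varphi$ on $G_n(g)$, and $\varphi(Q_i(g))=Q_i(h)$ for $0\le i\le n$. For $\underline Q\in\mathcal Q_n$ let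 $V(\underline Q)$ be the set of realizations $g$ whose sequence represents $\underline Q$; the graph $G(Q_0,\dots,Q_{j-1})$, $j\le n$, is $G_j(g)$ for $g\in V(\underline Q)$. **Proposition 3.3.** For every $n\ge 0$ and $\underline Q=(Q_0,\dots,Q_n)\in\mathcal Q_n$ there is $\underline Q'=(Q_0,Q_1',\dots,Q_n')\in\mathcal Q_n$ such that: 1. for every $h\in V(\underline Q')$ and $0\le i\le n$, $Q_i(h)$ is a topological disc: it is the closure of the component of $\overline{\mathbb C}\setminus G_i(h)$ containing $v_2(h)$, and it is a closed topological disc with that component as its open disc; 2. for all $g\in V(\underline Q)$ and $h\in V(\underline Q')$ there are a homeomorphism $\varphi$ isotopic to the identity, with $\varphi\circ\psi_g=\psi_h$ on $G$, and subgraphs $G_j'(g)$ of $G_j(g)$ and $G_j'(h)$ of $G_j(h)$ for $0\le j\le n$, such that * $\varphi(Q_0(g))=Q_0(h)$ and $\varphi(Q_i(g))\subset Q_i(h)$ for $0\le i\le n$; * $\varphi(G_j'(g))=G_j'(h)$ for every $0\le j\le n$, and $G_j'(g)\subset G_k'(g)$, $G_j'(h)\subset G_k'(h)$ for $0\le j\le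 k\le n$ (so the subgraphs are isotopic and the isotopies at lower levels extend to level $n$); * $Q_i(g)\subset G_n'(g)$ for every $0\le i\le n$ with $\varphi(Q_i(g))\ne Q_i(h)$; * $G_j'(g)$ contains every edge of $G_j(g)$ that contains no point mapped to a critical point of $g$ by an iterate $g^k$, $k\ge 0$. -/

import Mathlib

open Set Topology Polynomial

/-- The Riemann sphere, with its topology as the one-point compactification of the plane. -/
abbrev Sph : Type := OnePoint ℂ

/-- The self-map of the Riemann sphere given by the rational function `p / q`
(intended for coprime `p` and `q`; its degree is then the larger of the two degrees). -/
noncomputable def ratMap (p q : ℂ[X]) (x : Sph) : Sph :=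
  x.elim
    (if q.coeff (max p.natDegree q.natDegree) = 0 then OnePoint.infty
      else ((p.coeff (max p.natDegree q.natDegree) / q.coeff (max p.natDegree q.natDegree) : ℂ)
        : Sph))
    (fun z => if q.eval z = 0 then OnePoint.infty else ((p.eval z / q.eval z : ℂ) : Sph))

/-- `f` is a quadratic rational map. -/
def IsQuadraticRational (f : Sph → Sph) : Prop :=
  ∃ p q : ℂ[X], IsCoprime p q ∧ max p.natDegree q.natDegree = 2 ∧ f = ratMap p q

/-- `x` is a critical point of `f`: the map `f` is not locally injective at `x`. -/
def IsCritPt (f : Sph → Sph) (x : Sph) : Prop :=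
  ¬ ∃ U ∈ 𝓝 x, InjOn f U

/-- `U` is an open topological disc whose closure is a closed topological disc with interior part
`U`: some homeomorphism of the closed unit disc onto `closure U` takes the open unit disc
onto `U`. -/
def IsDiscDomain (U : Set Sph) : Prop :=
  ∃ f : ℂ → Sph, ContinuousOn f (Metric.closedBall 0 1) ∧ InjOn f (Metric.closedBall 0 1) ∧
    f '' Metric.ball 0 1 = U ∧ f '' Metric.closedBall 0 1 = closure U

/-- `G` is a finite topological graph in the sphere with vertex set `X`: off the finite set `X` it
consists of finitely many pairwise disjoint open arcs, both ends of which are in `X`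
(loops and multiple edges are allowed). -/
def IsFiniteGraph (G X : Set Sph) : Prop :=
  X.Finite ∧ ∃ (m : ℕ) (γ : Fin m → unitInterval → Sph),
    (∀ k, Continuous (γ k)) ∧ (∀ k, γ k 0 ∈ X ∧ γ k 1 ∈ X) ∧
    (∀ k, InjOn (γ k) (Ioo 0 1)) ∧
    (∀ k, Disjoint (γ k '' Ioo 0 1) X) ∧
    (∀ k l, k ≠ l → Disjoint (γ k '' Ioo 0 1) (γ l '' Ioo 0 1)) ∧
    G = X ∪ ⋃ k, γ k '' Ioo 0 1

/-- The closed edge through `x` of the graph `G` with vertex set `X`, for `x ∈ G \ X`. -/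
def edgeAt (G X : Set Sph) (x : Sph) : Set Sph :=
  closure (connectedComponentIn (G \ X) x)

/-- `A` is a subgraph of the graph `G` with vertex set `X`: a closed subset which contains
every open edge that it meets, in other words a union of vertices and closed edges. -/
def IsSubgraph (A G X : Set Sph) : Prop :=
  A ⊆ G ∧ IsClosed A ∧ ∀ x ∈ A, x ∉ X → connectedComponentIn (G \ X) x ⊆ A

/-- The homeomorphism `f` is the end of an ambient isotopy of the sphere starting at the
identity. (This holds exactly for the orientation-preserving homeomorphisms.) -/
def IsotopicToId (f : Sph ≃ₜ Sph) : Prop :=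
  ∃ Φ : unitInterval → (Sph ≃ₜ Sph),
    Continuous (fun p : unitInterval × Sph => Φ p.1 p.2) ∧
    Φ 0 = Homeomorph.refl Sph ∧ Φ 1 = f

theorem IsotopicToId.refl : IsotopicToId (Homeomorph.refl Sph) :=
  ⟨fun _ => Homeomorph.refl Sph, by simpa using continuous_snd, rfl, rfl⟩

theorem IsotopicToId.symm {f : Sph ≃ₜ Sph} (hf : IsotopicToId f) : IsotopicToId f.symm := by
  obtain ⟨Φ, hc, h0, h1⟩ := hf
  refine ⟨fun t => f.symm.trans (Φ (unitInterval.symm t)), ?_, ?_, ?_⟩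
  · have : Continuous (fun p : unitInterval × Sph => (unitInterval.symm p.1, f.symm p.2)) := by
      fun_prop
    exact hc.comp this
  · ext x; simp [h1]
  · ext x; simp [h0]

theorem IsotopicToId.trans {f g : Sph ≃ₜ Sph} (hf : IsotopicToId f) (hg : IsotopicToId g) :
    IsotopicToId (f.trans g) := by
  obtain ⟨Φ, hc, h0, h1⟩ := hf
  obtain ⟨Ψ, kc, k0, k1⟩ := hg
  refine ⟨fun t => (Φ t).trans (Ψ t), ?_, ?_, ?_⟩
  · exact kc.comp (continuous_fst.prodMk hc)
  · ext x; simp [h0, k0]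
  · ext x; simp [h1, k1]

/-- The base map `g₀` with its numbered critical points and its invariant graph. -/
structure BaseMap where
  /-- the map `g₀` -/
  g₀ : Sph → Sph
  quadratic : IsQuadraticRational g₀
  /-- the critical point which is periodic -/
  c₁ : Sph
  /-- the free critical point -/
  c₂ : Sph
  crit₁ : IsCritPt g₀ c₁
  crit₂ : IsCritPt g₀ c₂
  crit_ne : c₁ ≠ c₂
  periodic : c₁ ∈ Function.periodicPts g₀
  /-- the graph `G(g₀)` -/
  G : Set Sph
  /-- the vertex set of `G(g₀)` -/
  X : Set Sph
  graph : IsFiniteGraph G X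
  connected : IsConnected G
  vertex_invariant : MapsTo g₀ X X
  invariant : MapsTo g₀ G G
  /-- the closures of the complementary components of `G(g₀)` are closed topological discs -/
  faces : ∀ x, x ∉ G → IsDiscDomain (connectedComponentIn Gᶜ x)
  /-- `G(g₀)` separates the two critical values -/
  value₁ : g₀ c₁ ∉ G
  value₂ : g₀ c₂ ∉ G
  separates : connectedComponentIn Gᶜ (g₀ c₁) ≠ connectedComponentIn Gᶜ (g₀ c₂)
  /-- the free critical value is eventually mapped into `G(g₀)` -/
  lands : ∃ r, 1 ≤ r ∧ g₀^[r] (g₀ c₂) ∈ G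

namespace BaseMap

/-- A quadratic branched covering `g` of the sphere with the same graph dynamics as `g₀`:
`ψ` is an orientation-preserving homeomorphism which takes `G(g₀)` to `G(g) = ψ(G(g₀))`,
conjugates the dynamics on these graphs, and matches the orbit of the first critical value, and
the second critical value. The orientation-preserving branched coverings of degree two with
numbered critical values are the maps `α ∘ g₀ ∘ β` with `α`, `β` orientation-preserving
homeomorphisms; the critical values of `α ∘ g₀ ∘ β` are the images under `α` of those of `g₀`.
(For quadratic rational maps one can take Moebius transformations for `α` and `β`.) -/
structure Realization (S : BaseMap) where
  /-- the map -/
  g : Sph → Sph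
  /-- the marking -/
  ψ : Sph ≃ₜ Sph
  marking : IsotopicToId ψ
  branched : ∃ α β : Sph ≃ₜ Sph, IsotopicToId α ∧ IsotopicToId β ∧
    (∀ x, g x = α (S.g₀ (β x))) ∧
    ψ (S.g₀ S.c₁) = α (S.g₀ S.c₁) ∧ ψ (S.g₀ S.c₂) = α (S.g₀ S.c₂)
  conj : ∀ x ∈ S.G, ψ (S.g₀ x) = g (ψ x)
  orbit : ∀ i : ℕ, ψ (S.g₀^[i] (S.g₀ S.c₁)) = g^[i] (ψ (S.g₀ S.c₁))

namespace Realization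

variable {S : BaseMap}

/-- The free critical value `v₂(g)`. -/
noncomputable def v₂ (R : S.Realization) : Sph := R.ψ (S.g₀ S.c₂)

/-- The graph `Gₙ(g)`, the preimage of `G(g)` under the `n`-th iterate of `g`. -/
def graph (R : S.Realization) (n : ℕ) : Set Sph := R.g^[n] ⁻¹' (R.ψ '' S.G)

/-- The vertex set of `Gₙ(g)`: the vertices of `Gₙ₊₁(g)` are the preimages of the vertices of
`Gₙ(g)`, and the critical point if it lies on `Gₙ₊₁(g)` (it is then a branch point). -/
def vert (R : S.Realization) : ℕ → Set Sph
  | 0 => R.ψ '' S.X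
  | n + 1 => {x | R.g x ∈ vert R n} ∪ {x | x ∈ R.graph (n + 1) ∧ IsCritPt R.g x}

open Classical in
/-- The set `Qᵢ(g)`: the vertex of `Gᵢ(g)`, or the closed edge of `Gᵢ(g)`, or the closure of the
component of the complement of `Gᵢ(g)`, which has `v₂(g)` as that vertex, or in the
open edge, or in the component. -/
noncomputable def Q (R : S.Realization) (i : ℕ) : Set Sph :=
  if R.v₂ ∈ R.vert i then {R.v₂}
  else if R.v₂ ∈ R.graph i then edgeAt (R.graph i) (R.vert i) R.v₂
  else closure (connectedComponentIn (R.graph i)ᶜ R.v₂)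

/-- `Qᵢ(g)` is a topological disc: it is the closure of a component of the complement
of `Gᵢ(g)`, and this closure is a closed topological disc. -/
def QIsDisc (R : S.Realization) (i : ℕ) : Prop :=
  R.v₂ ∉ R.graph i ∧ R.Q i = closure (connectedComponentIn (R.graph i)ᶜ R.v₂) ∧
    IsDiscDomain (connectedComponentIn (R.graph i)ᶜ R.v₂)

/-- The sequences `(Q₀(g), …, Qₙ(g))` and `(Q₀(h), …, Qₙ(h))` are equivalent: an
orientation-preserving homeomorphism of the sphere is compatible with the markings of `G(g)`
and `G(h)`, conjugates the dynamical systems `(Gₙ(g), g)` and `(Gₙ(h), h)`, and takes `Qᵢ(g)` to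
`Qᵢ(h)`. -/
def Equivalent (n : ℕ) (R T : S.Realization) : Prop :=
  ∃ φ : Sph ≃ₜ Sph, IsotopicToId φ ∧ (∀ x ∈ S.G, φ (R.ψ x) = T.ψ x) ∧
    φ '' R.graph n = T.graph n ∧ (∀ x ∈ R.graph n, φ (R.g x) = T.g (φ x)) ∧
    ∀ i ≤ n, φ '' R.Q i = T.Q i

theorem Equivalent.equivalence (n : ℕ) :
    Equivalence (Equivalent n : S.Realization → S.Realization → Prop) where
  refl R := ⟨Homeomorph.refl Sph, IsotopicToId.refl, by simp, by simp, by simp, by simp⟩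
  symm := by
    rintro R T ⟨φ, h1, h2, h3, h4, h5⟩
    refine ⟨φ.symm, h1.symm, ?_, ?_, ?_, ?_⟩
    · intro x hx
      rw [← h2 x hx]; simp
    · rw [← h3, ← image_comp]; simp
    · intro y hy
      rw [← h3] at hy
      obtain ⟨x, hx, rfl⟩ := hy
      rw [← h4 x hx]; simp
    · intro i hi
      rw [← h5 i hi, ← image_comp]; simp
  trans := by
    rintro R T W ⟨φ, h1, h2, h3, h4, h5⟩ ⟨χ, k1, k2, k3, k4, k5⟩
    refine ⟨φ.trans χ, h1.trans k1, ?_, ?_, ?_, ?_⟩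
    · intro x hx
      simp [h2 x hx, k2 x hx]
    · rw [← k3, ← h3, ← image_comp]; rfl
    · intro x hx
      have hx' : φ x ∈ T.graph n := h3 ▸ mem_image_of_mem φ hx
      simp [h4 x hx, k4 _ hx']
    · intro i hi
      rw [← k5 i hi, ← h5 i hi, ← image_comp]; rfl

/-- The equivalence of sequences of length `n + 1` as a setoid. -/
def seqSetoid (S : BaseMap) (n : ℕ) : Setoid S.Realization :=
  ⟨Equivalent n, Equivalent.equivalence n⟩

end Realization

/-- The set of admissible sequences `(Q₀, …, Qₙ)`, up to equivalence. -/
def AdmSeq (S : BaseMap) (n : ℕ) : Type := Quotient (Realization.seqSetoid S n)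

/-- The maps `g` for which `(Q₀(g), …, Qₙ(g))` is equivalent to the given sequence. -/
def AdmSeq.V {S : BaseMap} {n : ℕ} (q : S.AdmSeq n) : Set S.Realization :=
  {R | Quotient.mk (Realization.seqSetoid S n) R = q}

end BaseMap

/-! If `v₂` is off `Gₙ(g)`, nothing has to be changed: every `Qᵢ(g)` is the closure of a face, and
all faces are discs. Otherwise let `k + 1` be the first level whose graph contains `v₂`. The
critical value is pushed off `Gₙ(g)` by replacing `g` with `τ ∘ g`, where `τ` is isotopic to the
identity and supported in a small closed neighbourhood `D` of `v₂` (`exists_isotopicToId_move`,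
`perturb`, `exists_perturbation`).

The set `D` lies in the face of `Gₖ(g)` around `v₂`, so levels up to `k` keep their graphs and the
sets `Qᵢ`. It avoids the finite orbit of `v₁`, so `τ ∘ g` is again a realization. It also avoids the
first `n` forward images of `freePart n`, the union of the cells without precritical points; this is
possible because an orbit can reach `v₂` only through a critical point. On the open set `N` of
points whose first `n` images miss `D`, the graphs of `g` and `τ ∘ g` coincide, and `N` contains the
free part. This part is the common subgraph, and between these two maps the required homeomorphism
is the identity.

For `i > k` the cell `Qᵢ(g)` is free, because `v₂ ∉ Gₖ` leaves no critical point on `Gₖ₊₁`. The new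
value `w` is chosen in a component of `N \ Gₙ(g)` that has `v₂` in its closure. A component that
touches an open edge at one point has the whole edge in its closure (`edge_subset_closure`), so
`Qᵢ(g)` lies in the closure of the new face around `w`.

The topological input is that all `Gₙ(g)` are finite graphs whose faces are closed discs
(`isFiniteGraph`, `hasDiscFaces`). Both go by induction through the normal form `g = a ∘ sqMap ∘ b`:
arcs and discs lift through squaring because `v₁` is never on a graph and no closed face contains
both critical values.

Arbitrary representatives of the two classes are reached by composing with the conjugacies that
define equivalence, which carry graphs, vertices, critical points and free cells along
(`IsConjugacy`). -/

/-- The hypotheses make `C ∩ A` clopen in `C`. Components of graphs and of their complements are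
identified below by this criterion. -/
theorem IsPreconnected.subset_of_isClosed_of_nhdsWithin {X : Type*} [TopologicalSpace X]
    {C A : Set X} (hC : IsPreconnected C) (hA : IsClosed A) (hne : (C ∩ A).Nonempty)
    (h : ∀ p ∈ C ∩ A, A ∈ 𝓝[C] p) : C ⊆ A := by
  by_contra hcon
  obtain ⟨x, hxC, hxA⟩ := not_subset.1 hcon
  have hV : IsOpen (⋃₀ {O : Set X | IsOpen O ∧ O ∩ C ⊆ A}) := isOpen_sUnion fun O hO => hO.1
  obtain ⟨y, hy, hy1, O, hO, hyO⟩ := hC Aᶜ _ hA.isOpen_compl hV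
    (fun y hy => by
      by_cases hyA : y ∈ A
      · obtain ⟨O, hO, hyO, hOC⟩ := mem_nhdsWithin.1 (h y ⟨hy, hyA⟩)
        exact Or.inr ⟨O, ⟨hO, hOC⟩, hyO⟩
      · exact Or.inl hyA)
    ⟨x, hxC, hxA⟩
    (by
      obtain ⟨y, hy, hyA⟩ := hne
      obtain ⟨O, hO, hyO, hOC⟩ := mem_nhdsWithin.1 (h y ⟨hy, hyA⟩)
      exact ⟨y, hy, O, ⟨hO, hOC⟩, hyO⟩)
  exact hy1 (hO.2 ⟨hyO, hy⟩)

/-! ### Squaring, negation and inversion on the sphere. -/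

/-- The squaring map of the Riemann sphere. -/
noncomputable def sqMap : Sph → Sph := OnePoint.map (fun z : ℂ => z ^ 2)

@[simp] theorem sqMap_infty : sqMap OnePoint.infty = OnePoint.infty := rfl

@[simp] theorem sqMap_coe (z : ℂ) : sqMap (z : Sph) = ((z ^ 2 : ℂ) : Sph) := rfl

theorem continuous_sqMap : Continuous sqMap := by
  refine OnePoint.continuous_map (by fun_prop) ?_
  rw [Filter.coclosedCompact_eq_cocompact]
  refine Filter.tendsto_cocompact_cocompact_of_norm ?_
  intro ε
  refine ⟨max ε 1, fun x hx => ?_⟩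
  rw [norm_pow]
  have h1 : 1 < ‖x‖ := lt_of_le_of_lt (le_max_right _ _) hx
  have h2 : ε < ‖x‖ := lt_of_le_of_lt (le_max_left _ _) hx
  nlinarith

/-- Negation on the Riemann sphere. -/
noncomputable def negSph : Sph ≃ₜ Sph := (Homeomorph.neg ℂ).onePointCongr

@[simp] theorem negSph_infty : negSph OnePoint.infty = OnePoint.infty := rfl

@[simp] theorem negSph_coe (z : ℂ) : negSph (z : Sph) = ((-z : ℂ) : Sph) := rfl

@[simp] theorem negSph_negSph (x : Sph) : negSph (negSph x) = x := by
  induction x using OnePoint.rec <;> simp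

theorem sqMap_negSph (x : Sph) : sqMap (negSph x) = sqMap x := by
  induction x using OnePoint.rec <;> simp

theorem negSph_eq_self {x : Sph} : negSph x = x ↔ x = ((0 : ℂ) : Sph) ∨ x = OnePoint.infty := by
  induction x using OnePoint.rec <;> simp [neg_eq_self]

theorem sqMap_eq_sqMap {x y : Sph} : sqMap x = sqMap y ↔ x = y ∨ x = negSph y := by
  induction x using OnePoint.rec <;> induction y using OnePoint.rec <;>
    simp [sq_eq_sq_iff_eq_or_eq_neg]

@[simp] theorem sqMap_eq_zero {x : Sph} :
    sqMap x = ((0 : ℂ) : Sph) ↔ x = ((0 : ℂ) : Sph) := by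
  induction x using OnePoint.rec <;> simp

@[simp] theorem sqMap_eq_infty {x : Sph} : sqMap x = OnePoint.infty ↔ x = OnePoint.infty := by
  induction x using OnePoint.rec <;> simp

theorem surjective_sqMap : Function.Surjective sqMap := by
  intro x
  induction x using OnePoint.rec with
  | infty => exact ⟨OnePoint.infty, rfl⟩
  | coe z =>
    obtain ⟨w, hw⟩ := IsAlgClosed.exists_pow_nat_eq z two_pos
    exact ⟨(w : Sph), by rw [sqMap_coe, hw]⟩

/-- Inversion on the Riemann sphere, as a function. -/
noncomputable def invFun (x : Sph) : Sph :=
  x.elim ((0 : ℂ) : Sph) (fun z => if z = 0 then OnePoint.infty else ((z⁻¹ : ℂ) : Sph))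

@[simp] theorem invFun_infty : invFun OnePoint.infty = ((0 : ℂ) : Sph) := rfl

@[simp] theorem invFun_zero : invFun ((0 : ℂ) : Sph) = OnePoint.infty := by
  simp [invFun]

theorem invFun_coe {z : ℂ} (hz : z ≠ 0) : invFun (z : Sph) = ((z⁻¹ : ℂ) : Sph) := by
  simp [invFun, hz]

theorem invFun_invFun (x : Sph) : invFun (invFun x) = x := by
  induction x using OnePoint.rec with
  | infty => simp
  | coe z =>
    by_cases hz : z = 0
    · subst hz; simp
    · rw [invFun_coe hz, invFun_coe (inv_ne_zero hz), inv_inv]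

theorem continuous_invFun : Continuous invFun := by
  rw [continuous_iff_continuousAt]
  intro x
  induction x using OnePoint.rec with
  | infty =>
    rw [OnePoint.continuousAt_infty', Filter.coclosedCompact_eq_cocompact, invFun_infty]
    have h : Filter.Tendsto (fun z : ℂ => ((z⁻¹ : ℂ) : Sph)) (Filter.cocompact ℂ)
        (𝓝 ((0 : ℂ) : Sph)) :=
      (OnePoint.continuous_coe.tendsto _).comp
        (by simpa [Metric.cobounded_eq_cocompact] using
          (Filter.tendsto_inv₀_cobounded (α := ℂ)))
    refine h.congr' ?_
    have : ({0}ᶜ : Set ℂ) ∈ Filter.cocompact ℂ := isCompact_singleton.compl_mem_cocompact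
    filter_upwards [this] with z hz
    exact (invFun_coe hz).symm
  | coe z =>
    rw [OnePoint.continuousAt_coe]
    by_cases hz : z = 0
    · subst hz
      rw [← continuousWithinAt_compl_self]
      rw [ContinuousWithinAt]
      simp only [Function.comp, invFun_zero]
      have h : Filter.Tendsto (fun z : ℂ => ((z⁻¹ : ℂ) : Sph)) (𝓝[≠] 0)
          (𝓝 (OnePoint.infty : Sph)) := by
        have h2 := (OnePoint.tendsto_coe_infty (X := ℂ))
        rw [Filter.coclosedCompact_eq_cocompact, ← Metric.cobounded_eq_cocompact] at h2
        exact h2.comp Filter.tendsto_inv₀_nhdsNE_zero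
      refine h.congr' ?_
      filter_upwards [self_mem_nhdsWithin] with z hz
      exact (invFun_coe hz).symm
    · have h : ContinuousAt (fun z : ℂ => ((z⁻¹ : ℂ) : Sph)) z :=
        OnePoint.continuous_coe.continuousAt.comp (continuousAt_inv₀ hz)
      refine h.congr ?_
      filter_upwards [isOpen_ne.mem_nhds hz] with w hw
      exact (invFun_coe hw).symm

/-- Inversion on the Riemann sphere. -/
noncomputable def invSph : Sph ≃ₜ Sph where
  toFun := invFun
  invFun := invFun
  left_inv := invFun_invFun
  right_inv := invFun_invFun
  continuous_toFun := continuous_invFun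
  continuous_invFun := continuous_invFun

@[simp] theorem invSph_infty : invSph OnePoint.infty = ((0 : ℂ) : Sph) := rfl

@[simp] theorem invSph_zero : invSph ((0 : ℂ) : Sph) = OnePoint.infty := invFun_zero

theorem invSph_coe {z : ℂ} (hz : z ≠ 0) : invSph (z : Sph) = ((z⁻¹ : ℂ) : Sph) := invFun_coe hz

@[simp] theorem invSph_invSph (x : Sph) : invSph (invSph x) = x := invFun_invFun x

theorem sqMap_invSph (x : Sph) : sqMap (invSph x) = invSph (sqMap x) := by
  induction x using OnePoint.rec with
  | infty => simp
  | coe z =>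
    by_cases hz : z = 0
    · subst hz; simp
    · rw [invSph_coe hz, sqMap_coe, sqMap_coe, invSph_coe (pow_ne_zero 2 hz), inv_pow]

/-- Homogeneity of the sphere: local statements need only be proved at `0`. -/
theorem exists_homeomorph_zero (p : Sph) : ∃ κ : Sph ≃ₜ Sph, κ ((0 : ℂ) : Sph) = p := by
  induction p using OnePoint.rec with
  | infty => exact ⟨invSph, invSph_zero⟩
  | coe z =>
    refine ⟨(Homeomorph.addRight z).onePointCongr, ?_⟩
    change (((0 : ℂ) + z : ℂ) : Sph) = _
    rw [zero_add]

instance : LocallyConnectedSpace Sph := by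
  have hz : ∀ U ∈ 𝓝 ((0 : ℂ) : Sph), ∃ V ∈ 𝓝 ((0 : ℂ) : Sph), IsPreconnected V ∧ V ⊆ U := by
    intro U hU
    rw [OnePoint.nhds_coe_eq] at hU ⊢
    obtain ⟨r, hr, hU⟩ := Metric.mem_nhds_iff.1 (Filter.mem_map.1 hU)
    refine ⟨(fun z : ℂ => (z : Sph)) '' Metric.ball 0 r,
      Filter.image_mem_map (Metric.ball_mem_nhds _ hr),
      (convex_ball _ _).isPreconnected.image _ OnePoint.continuous_coe.continuousOn, ?_⟩
    rintro _ ⟨z, hz, rfl⟩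
    exact hU hz
  rw [locallyConnectedSpace_iff_connected_subsets]
  intro p U hU
  obtain ⟨κ, rfl⟩ := exists_homeomorph_zero p
  obtain ⟨V, hV, hc, hVU⟩ := hz (κ ⁻¹' U) (κ.continuous.continuousAt hU)
  refine ⟨κ '' V, κ.isOpenMap.image_mem_nhds hV, hc.image _ κ.continuous.continuousOn, ?_⟩
  rintro _ ⟨z, hz, rfl⟩
  exact hVU hz

/-! ### Lifting maps through the squaring map. -/

/-- Uniqueness of lifts: `s = t` and `s = -t` define closed sets that cover `K`, and they are
disjoint because `t` avoids the fixed points of negation. -/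
theorem eqOn_of_sqMap_eqOn {X : Type*} [TopologicalSpace X] {K : Set X} (hK : IsPreconnected K)
    {s t : X → Sph} (hs : ContinuousOn s K) (ht : ContinuousOn t K)
    (hst : ∀ x ∈ K, sqMap (s x) = sqMap (t x))
    (h0 : ∀ x ∈ K, t x ≠ ((0 : ℂ) : Sph) ∧ t x ≠ OnePoint.infty)
    {x₀ : X} (hx₀ : x₀ ∈ K) (he : s x₀ = t x₀) : EqOn s t K := by
  by_contra hcon
  simp only [EqOn, not_forall] at hcon
  obtain ⟨x₁, hx₁, hne⟩ := hcon
  have hn : ContinuousOn (fun x => negSph (t x)) K := negSph.continuous.comp_continuousOn ht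
  obtain ⟨u, hu, hu'⟩ := (continuousOn_iff_isClosed.1 (hs.prodMk ht)) _ isClosed_diagonal
  obtain ⟨v, hv, hv'⟩ := (continuousOn_iff_isClosed.1 (hs.prodMk hn)) _ isClosed_diagonal
  have key1 : ∀ x ∈ K, (x ∈ u ↔ s x = t x) := fun x hx => by
    have := congrArg (x ∈ ·) hu'
    simp only [mem_inter_iff, hx, and_true, mem_preimage, mem_diagonal_iff, eq_iff_iff] at this
    exact this.symm
  have key2 : ∀ x ∈ K, (x ∈ v ↔ s x = negSph (t x)) := fun x hx => by
    have := congrArg (x ∈ ·) hv'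
    simp only [mem_inter_iff, hx, and_true, mem_preimage, mem_diagonal_iff, eq_iff_iff] at this
    exact this.symm
  have hcov : K ⊆ u ∪ v := fun x hx => by
    rcases sqMap_eq_sqMap.1 (hst x hx) with h | h
    · exact Or.inl ((key1 x hx).2 h)
    · exact Or.inr ((key2 x hx).2 h)
  obtain ⟨x, hx, hxu, hxv⟩ := (isPreconnected_closed_iff.1 hK) u v hu hv hcov
    ⟨x₀, hx₀, (key1 _ hx₀).2 he⟩
    ⟨x₁, hx₁, (key2 _ hx₁).2 ((sqMap_eq_sqMap.1 (hst _ hx₁)).resolve_left hne)⟩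
  have := ((key2 x hx).1 hxv).symm.trans ((key1 x hx).1 hxu)
  rcases negSph_eq_self.1 this with h | h
  · exact (h0 x hx).1 h
  · exact (h0 x hx).2 h

/-- A convex set is contractible and locally path connected, so `f` lifts through the covering
`exp`; half of the logarithm gives the root. -/
theorem Convex.exists_sqrt {E : Type*} [NormedAddCommGroup E] [NormedSpace ℝ E] {K : Set E}
    (hK : Convex ℝ K) {f : E → ℂ} (hf : ContinuousOn f K) (h0 : ∀ x ∈ K, f x ≠ 0) :
    ∃ s : E → ℂ, ContinuousOn s K ∧ ∀ x ∈ K, s x ^ 2 = f x := by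
  classical
  rcases K.eq_empty_or_nonempty with rfl | hne
  · exact ⟨0, by simp, by simp⟩
  have := hK.contractibleSpace hne
  have := hK.locallyPathConnectedSpace
  obtain ⟨x₀, hx₀⟩ := hne
  obtain ⟨F, ⟨-, hF⟩, -⟩ := Complex.isCoveringMapOn_exp.existsUnique_continuousMap_lifts
    ⟨K.domRestrict f, continuousOn_iff_continuous_domRestrict.mp hf⟩ (a₀ := ⟨x₀, hx₀⟩)
    (Complex.exp_log (h0 x₀ hx₀)) (fun x ↦ h0 x x.2)
  refine ⟨fun z => if hz : z ∈ K then Complex.exp (F ⟨z, hz⟩ / 2) else 0, ?_, fun x hx => ?_⟩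
  · rw [continuousOn_iff_continuous_domRestrict]
    have : Continuous fun z : K => Complex.exp (F z / 2) := by fun_prop
    convert this using 1
    ext z
    simp
  · have : Complex.exp (F ⟨x, hx⟩) = f x := congr($hF ⟨x, hx⟩)
    simp only [hx, dif_pos]
    rw [← Complex.exp_nat_mul, ← this]
    congr 1
    push_cast
    ring

/-- Squaring is a closed map, so a point alone in its fibre depends continuously on its image. This
gives continuity of lifts at branch values. -/
theorem comap_sqMap_nhds_le {p : Sph} (hp : ∀ y, sqMap y = sqMap p → y = p) :
    Filter.comap sqMap (𝓝 (sqMap p)) ≤ 𝓝 p := by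
  intro U hU
  obtain ⟨V, hVU, hV, hpV⟩ := mem_nhds_iff.1 hU
  have hcl : IsClosed (sqMap '' Vᶜ) :=
    (hV.isClosed_compl.isCompact.image continuous_sqMap).isClosed
  refine Filter.mem_comap.2 ⟨(sqMap '' Vᶜ)ᶜ, hcl.isOpen_compl.mem_nhds ?_, ?_⟩
  · rintro ⟨y, hy, hyp⟩
    exact hy (hp y hyp ▸ hpV)
  · intro y hy
    by_contra hyU
    exact hy ⟨y, fun h => hyU (hVU h), rfl⟩

/-- Only the part of `K` over the unbranched values has to be convex. A root exists there, and at
the other points `comap_sqMap_nhds_le` gives continuity whatever signs were chosen nearby. -/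
theorem Convex.exists_sqMap_lift {E : Type*} [NormedAddCommGroup E] [NormedSpace ℝ E] {K : Set E}
    {f : E → Sph} (hf : ContinuousOn f K)
    (hK : Convex ℝ {x ∈ K | f x ≠ ((0 : ℂ) : Sph) ∧ f x ≠ OnePoint.infty}) :
    ∃ s : E → Sph, ContinuousOn s K ∧ ∀ x ∈ K, sqMap (s x) = f x := by
  classical
  set K' := {x ∈ K | f x ≠ ((0 : ℂ) : Sph) ∧ f x ≠ OnePoint.infty} with hK'
  have hfc : ∀ x ∈ K', ∃ z : ℂ, z ≠ 0 ∧ (z : Sph) = f x := by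
    intro x hx
    obtain ⟨z, hz⟩ := OnePoint.ne_infty_iff_exists.1 hx.2.2
    refine ⟨z, ?_, hz⟩
    rintro rfl
    exact hx.2.1 hz.symm
  choose! F hF0 hF using hfc
  have hFc : ContinuousOn F K' := by
    rw [OnePoint.isOpenEmbedding_coe.isEmbedding.continuousOn_iff]
    exact (hf.mono (fun x hx => hx.1)).congr (fun x hx => hF x hx)
  obtain ⟨σ, hσ, hσF⟩ := hK.exists_sqrt hFc hF0
  -- Outside `K'` the value of `f` is `0` or `∞`, which is its own square root.
  refine ⟨fun x => if x ∈ K' then (σ x : Sph) else f x, ?_, ?_⟩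
  · intro x hx
    by_cases hxK : x ∈ K'
    · have h1 : ContinuousWithinAt (fun x => if x ∈ K' then (σ x : Sph) else f x) K' x := by
        have h2 : ContinuousWithinAt (fun x => (σ x : Sph)) K' x :=
          OnePoint.continuous_coe.continuousAt.comp_continuousWithinAt (hσ x hxK)
        exact h2.congr (fun y hy => by simp [hy]) (by simp [hxK])
      refine h1.mono_of_mem_nhdsWithin ?_
      have h3 : {y : Sph | y ≠ ((0 : ℂ) : Sph) ∧ y ≠ OnePoint.infty} ∈ 𝓝 (f x) :=
        (isOpen_ne.inter isOpen_ne).mem_nhds hxK.2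
      filter_upwards [self_mem_nhdsWithin, hf x hx h3] with y hy hy'
      exact ⟨hy, hy'⟩
    · have hfx : f x = ((0 : ℂ) : Sph) ∨ f x = OnePoint.infty := by
        by_contra hcon
        push Not at hcon
        exact hxK ⟨hx, hcon⟩
      have hsq : sqMap (f x) = f x := by
        rcases hfx with h | h <;> rw [h] <;> simp
      rw [ContinuousWithinAt, if_neg hxK]
      refine Filter.Tendsto.mono_right (Filter.tendsto_comap_iff.2 ?_) (comap_sqMap_nhds_le ?_)
      · rw [hsq]
        refine (hf x hx).congr' ?_
        filter_upwards [self_mem_nhdsWithin] with y hy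
        by_cases hyK : y ∈ K'
        · simp [hyK, hσF, hF]
        · have hfy : f y = ((0 : ℂ) : Sph) ∨ f y = OnePoint.infty := by
            by_contra hcon
            push Not at hcon
            exact hyK ⟨hy, hcon⟩
          rcases hfy with h | h <;> simp [hyK, h]
      · intro y hy
        rcases hfx with h | h <;> rw [h] at hy ⊢
        · simpa using hy
        · simpa using hy
  · intro x hx
    by_cases hxK : x ∈ K'
    · simp [hxK, hσF, hF]
    · have hfx : f x = ((0 : ℂ) : Sph) ∨ f x = OnePoint.infty := by
        by_contra hcon
        push Not at hcon
        exact hxK ⟨hx, hcon⟩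
      rcases hfx with h | h <;> simp [hxK, h]

/-! ### Moebius maps and the normal form of quadratic rational maps. -/

/-- The point of the Riemann sphere with homogeneous coordinates `(x : y)`. -/
noncomputable def homog (x y : ℂ) : Sph :=
  if y = 0 then OnePoint.infty else ((x / y : ℂ) : Sph)

theorem homog_one (z : ℂ) : homog z 1 = (z : Sph) := by simp [homog]

theorem homog_zero (x : ℂ) : homog x 0 = OnePoint.infty := by simp [homog]

theorem homog_mul {k : ℂ} (hk : k ≠ 0) (x y : ℂ) : homog (k * x) (k * y) = homog x y := by
  unfold homog
  by_cases hy : y = 0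
  · simp [hy]
  · simp [hy, hk, mul_div_mul_left]

theorem invSph_homog {x y : ℂ} (h : x ≠ 0 ∨ y ≠ 0) : invSph (homog x y) = homog y x := by
  unfold homog
  by_cases hy : y = 0
  · have hx : x ≠ 0 := h.resolve_right (by simpa using hy)
    simp [hy, hx]
  · by_cases hx : x = 0
    · simp [hx, hy]
    · rw [if_neg hy, if_neg hx, invSph_coe (div_ne_zero hx hy), inv_div]

theorem sqMap_homog (x y : ℂ) : sqMap (homog x y) = homog (x ^ 2) (y ^ 2) := by
  unfold homog
  by_cases hy : y = 0
  · simp [hy]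
  · simp [hy, div_pow]

theorem homog_eq_homog {x y z w : ℂ} (he : homog x y = homog z w) : x * w = z * y := by
  unfold homog at he
  by_cases hy : y = 0
  · by_cases hw : w = 0
    · simp [hy, hw]
    · simp [hy, hw] at he
  · by_cases hw : w = 0
    · simp [hy, hw] at he
    · rw [if_neg hy, if_neg hw, OnePoint.coe_eq_coe, div_eq_div_iff hy hw] at he
      exact he

theorem exists_homog (p : Sph) : ∃ x y : ℂ, (x ≠ 0 ∨ y ≠ 0) ∧ homog x y = p := by
  induction p using OnePoint.rec with
  | infty => exact ⟨1, 0, by simp, homog_zero _⟩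
  | coe z => exact ⟨z, 1, by simp, homog_one z⟩

theorem continuousAt_homog {v : ℂ × ℂ} (hv : v.1 ≠ 0 ∨ v.2 ≠ 0) :
    ContinuousAt (fun v : ℂ × ℂ => homog v.1 v.2) v := by
  have key : ∀ v : ℂ × ℂ, v.2 ≠ 0 → ContinuousAt (fun v : ℂ × ℂ => homog v.1 v.2) v := by
    intro v hv
    have h : ContinuousAt (fun v : ℂ × ℂ => ((v.1 / v.2 : ℂ) : Sph)) v :=
      OnePoint.continuous_coe.continuousAt.comp
        (continuousAt_fst.div continuousAt_snd hv)
    refine h.congr ?_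
    filter_upwards [(isOpen_ne_fun continuous_snd continuous_const).mem_nhds hv] with w hw
    exact (if_neg hw).symm
  by_cases h2 : v.2 = 0
  · have h1 : v.1 ≠ 0 := hv.resolve_right (by simpa using h2)
    have h : ContinuousAt (fun v : ℂ × ℂ => invSph (homog v.2 v.1)) v :=
      invSph.continuous.continuousAt.comp
        ((key v.swap h1).comp (f := fun v : ℂ × ℂ => v.swap) continuous_swap.continuousAt)
    refine h.congr ?_
    filter_upwards [(isOpen_ne_fun continuous_fst continuous_const).mem_nhds h1] with w hw
    exact invSph_homog (Or.inr hw)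
  · exact key v h2

/-- The Moebius map with the given coefficients. -/
noncomputable def moebius (a b c d : ℂ) (x : Sph) : Sph :=
  x.elim (homog a c) (fun z => homog (a * z + b) (c * z + d))

theorem det_injective {a b c d : ℂ} (h : a * d - b * c ≠ 0) {x y : ℂ} (hxy : x ≠ 0 ∨ y ≠ 0) :
    a * x + b * y ≠ 0 ∨ c * x + d * y ≠ 0 := by
  by_contra! hcon
  obtain ⟨h1, h2⟩ := hcon
  have hx : (a * d - b * c) * x = 0 := by linear_combination d * h1 - b * h2
  have hy : (a * d - b * c) * y = 0 := by linear_combination a * h2 - c * h1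
  rcases hxy with h' | h'
  · exact h' ((mul_eq_zero.1 hx).resolve_left h)
  · exact h' ((mul_eq_zero.1 hy).resolve_left h)

theorem moebius_homog (a b c d : ℂ) {x y : ℂ} (hxy : x ≠ 0 ∨ y ≠ 0) :
    moebius a b c d (homog x y) = homog (a * x + b * y) (c * x + d * y) := by
  by_cases hy : y = 0
  · have hx : x ≠ 0 := hxy.resolve_right (by simpa using hy)
    subst hy
    rw [homog_zero]
    simp only [moebius, OnePoint.elim_infty, mul_zero, add_zero]
    rw [mul_comm a, mul_comm c, homog_mul hx]
  · have : homog x y = ((x / y : ℂ) : Sph) := if_neg hy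
    rw [this]
    change homog (a * (x / y) + b) (c * (x / y) + d) = _
    rw [← homog_mul hy]
    congr 1 <;> field_simp

theorem continuous_moebius {a b c d : ℂ} (h : a * d - b * c ≠ 0) :
    Continuous (moebius a b c d) := by
  have hloc : ∀ u v z w : ℂ, u * w - v * z ≠ 0 → ∀ t : ℂ,
      ContinuousAt (fun t : ℂ => homog (u * t + v) (z * t + w)) t := by
    intro u v z w hdet t
    have h1 : u * t + v * 1 ≠ 0 ∨ z * t + w * 1 ≠ 0 := det_injective hdet (Or.inr one_ne_zero)
    simp only [mul_one] at h1
    exact ContinuousAt.comp (f := fun t : ℂ => (u * t + v, z * t + w))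
      (continuousAt_homog (v := (u * t + v, z * t + w)) h1)
      (by fun_prop)
  rw [continuous_iff_continuousAt]
  intro x
  induction x using OnePoint.rec with
  | coe z =>
    rw [OnePoint.continuousAt_coe]
    exact hloc a b c d h z
  | infty =>
    have h2 : ContinuousAt (fun x => moebius a b c d (invSph x)) ((0 : ℂ) : Sph) := by
      rw [OnePoint.continuousAt_coe]
      have h3 := hloc b a d c (by intro h'; apply h; linear_combination -h') 0
      refine h3.congr (Filter.Eventually.of_forall fun t => ?_)
      simp only [Function.comp]
      rw [← homog_one t, invSph_homog (Or.inr one_ne_zero), moebius_homog _ _ _ _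
        (Or.inl one_ne_zero)]
      congr 1 <;> ring
    have h4 : ContinuousAt (fun x => moebius a b c d (invSph (invSph x))) OnePoint.infty :=
      ContinuousAt.comp (f := invSph) (g := fun x => moebius a b c d (invSph x))
        (by rw [invSph_infty]; exact h2) invSph.continuous.continuousAt
    simpa using h4

/-- Moebius maps as homeomorphisms. -/
noncomputable def moebiusHomeomorph {a b c d : ℂ} (h : a * d - b * c ≠ 0) : Sph ≃ₜ Sph where
  toFun := moebius a b c d
  invFun := moebius d (-b) (-c) a
  left_inv x := by
    obtain ⟨u, v, huv, rfl⟩ := exists_homog x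
    rw [moebius_homog _ _ _ _ huv, moebius_homog _ _ _ _ (det_injective h huv), ← homog_mul h u v]
    congr 1 <;> ring
  right_inv x := by
    have h' : d * a - (-b) * (-c) ≠ 0 := by
      intro h'; apply h; linear_combination h'
    obtain ⟨u, v, huv, rfl⟩ := exists_homog x
    rw [moebius_homog _ _ _ _ huv, moebius_homog _ _ _ _ (det_injective h' huv),
      ← homog_mul h u v]
    congr 1 <;> ring
  continuous_toFun := continuous_moebius h
  continuous_invFun := continuous_moebius (by intro h'; apply h; linear_combination h')

theorem moebiusHomeomorph_homog {a b c d : ℂ} (h : a * d - b * c ≠ 0) {x y : ℂ}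
    (hxy : x ≠ 0 ∨ y ≠ 0) :
    moebiusHomeomorph h (homog x y) = homog (a * x + b * y) (c * x + d * y) :=
  moebius_homog a b c d hxy

/-- `f` is given in homogeneous coordinates by two binary quadratic forms without
common zeros. -/
def IsQuadraticForms (f : Sph → Sph) (p₂ p₁ p₀ q₂ q₁ q₀ : ℂ) : Prop :=
  ∀ x y : ℂ, (x ≠ 0 ∨ y ≠ 0) →
    (p₂ * x ^ 2 + p₁ * x * y + p₀ * y ^ 2 ≠ 0 ∨ q₂ * x ^ 2 + q₁ * x * y + q₀ * y ^ 2 ≠ 0) ∧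
    f (homog x y) =
      homog (p₂ * x ^ 2 + p₁ * x * y + p₀ * y ^ 2) (q₂ * x ^ 2 + q₁ * x * y + q₀ * y ^ 2)

theorem IsQuadraticRational.exists_forms {f : Sph → Sph} (hf : IsQuadraticRational f) :
    ∃ p₂ p₁ p₀ q₂ q₁ q₀ : ℂ, IsQuadraticForms f p₂ p₁ p₀ q₂ q₁ q₀ := by
  obtain ⟨p, q, hpq, hdeg, rfl⟩ := hf
  have hev : ∀ r : ℂ[X], r.natDegree ≤ 2 → ∀ z,
      r.eval z = r.coeff 2 * z ^ 2 + r.coeff 1 * z + r.coeff 0 := by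
    intro r hr z
    rw [Polynomial.eval_eq_sum_range' (n := 3) (by omega)]
    simp [Finset.sum_range_succ]
    ring
  have hp2 : p.natDegree ≤ 2 := by omega
  have hq2 : q.natDegree ≤ 2 := by omega
  refine ⟨p.coeff 2, p.coeff 1, p.coeff 0, q.coeff 2, q.coeff 1, q.coeff 0, ?_⟩
  intro x y hxy
  by_cases hy : y = 0
  · have hx : x ≠ 0 := hxy.resolve_right (by simpa using hy)
    subst hy
    have hne : p.coeff 2 ≠ 0 ∨ q.coeff 2 ≠ 0 := by
      rcases max_choice p.natDegree q.natDegree with h | h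
      · left
        have h2 : p.natDegree = 2 := by omega
        have : p ≠ 0 := by rintro rfl; simp at h2
        rw [← h2]
        simpa using this
      · right
        have h2 : q.natDegree = 2 := by omega
        have : q ≠ 0 := by rintro rfl; simp at h2
        rw [← h2]
        simpa using this
    refine ⟨by simpa [hx] using hne, ?_⟩
    rw [homog_zero]
    simp only [ratMap, OnePoint.elim_infty, hdeg, mul_zero, add_zero, ne_eq, OfNat.ofNat_ne_zero,
      not_false_eq_true, zero_pow]
    rw [mul_comm (p.coeff 2), mul_comm (q.coeff 2), homog_mul (pow_ne_zero 2 hx)]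
    rfl
  · have hz : homog x y = ((x / y : ℂ) : Sph) := if_neg hy
    have h1 : p.coeff 2 * x ^ 2 + p.coeff 1 * x * y + p.coeff 0 * y ^ 2
        = y ^ 2 * p.eval (x / y) := by
      rw [hev p hp2]; field_simp
    have h2 : q.coeff 2 * x ^ 2 + q.coeff 1 * x * y + q.coeff 0 * y ^ 2
        = y ^ 2 * q.eval (x / y) := by
      rw [hev q hq2]; field_simp
    rw [h1, h2]
    refine ⟨?_, ?_⟩
    · by_contra! hcon
      have hp : p.eval (x / y) = 0 := (mul_eq_zero.1 hcon.1).resolve_left (pow_ne_zero 2 hy)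
      have hq : q.eval (x / y) = 0 := (mul_eq_zero.1 hcon.2).resolve_left (pow_ne_zero 2 hy)
      obtain ⟨u, v, huv⟩ := hpq
      have := congrArg (Polynomial.eval (x / y)) huv
      simp [hp, hq] at this
    · rw [homog_mul (pow_ne_zero 2 hy), hz]
      rfl

theorem exists_zero_binary_quadratic (p₂ p₁ p₀ : ℂ) :
    ∃ x y : ℂ, (x ≠ 0 ∨ y ≠ 0) ∧ p₂ * x ^ 2 + p₁ * x * y + p₀ * y ^ 2 = 0 := by
  by_cases h : p₂ = 0
  · exact ⟨1, 0, by simp, by simp [h]⟩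
  · obtain ⟨s, hs⟩ := IsAlgClosed.exists_pow_nat_eq (discrim p₂ p₁ p₀) two_pos
    obtain ⟨x, hx⟩ := exists_quadratic_eq_zero h ⟨s, by rw [← hs, sq]⟩
    exact ⟨x, 1, by simp, by linear_combination hx⟩

theorem IsQuadraticForms.comp_moebius {f : Sph → Sph} {p₂ p₁ p₀ q₂ q₁ q₀ a b c d : ℂ}
    (hf : IsQuadraticForms f p₂ p₁ p₀ q₂ q₁ q₀) (h : a * d - b * c ≠ 0) :
    ∃ r₂ r₁ r₀ s₂ s₁ s₀ : ℂ,
      IsQuadraticForms (f ∘ moebiusHomeomorph h) r₂ r₁ r₀ s₂ s₁ s₀ := by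
  refine ⟨p₂ * a ^ 2 + p₁ * a * c + p₀ * c ^ 2,
    2 * p₂ * a * b + p₁ * (a * d + b * c) + 2 * p₀ * c * d,
    p₂ * b ^ 2 + p₁ * b * d + p₀ * d ^ 2,
    q₂ * a ^ 2 + q₁ * a * c + q₀ * c ^ 2,
    2 * q₂ * a * b + q₁ * (a * d + b * c) + 2 * q₀ * c * d,
    q₂ * b ^ 2 + q₁ * b * d + q₀ * d ^ 2, ?_⟩
  intro x y hxy
  have := hf _ _ (det_injective h hxy)
  rw [Function.comp, moebiusHomeomorph_homog h hxy]
  refine ⟨this.1.imp (fun h h' => h ?_) (fun h h' => h ?_), ?_⟩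
  · rw [this.2]
    congr 1 <;> ring
  · linear_combination h'
  · linear_combination h'

theorem IsQuadraticForms.comp_invSph {f : Sph → Sph} {p₂ p₁ p₀ q₂ q₁ q₀ : ℂ}
    (hf : IsQuadraticForms f p₂ p₁ p₀ q₂ q₁ q₀) :
    IsQuadraticForms (f ∘ invSph) p₀ p₁ p₂ q₀ q₁ q₂ := by
  intro x y hxy
  have := hf y x hxy.symm
  rw [Function.comp, invSph_homog hxy]
  refine ⟨this.1.imp (fun h h' => h ?_) (fun h h' => h ?_), ?_⟩
  · rw [this.2]
    congr 1 <;> ring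
  · linear_combination h'
  · linear_combination h'

theorem IsCritPt.comp_homeomorph {f : Sph → Sph} {x : Sph} (h : Sph ≃ₜ Sph)
    (hf : IsCritPt f (h x)) : IsCritPt (f ∘ h) x := by
  rintro ⟨U, hU, hinj⟩
  refine hf ⟨h '' U, h.isOpenMap.image_mem_nhds hU, ?_⟩
  rintro _ ⟨y, hy, rfl⟩ _ ⟨z, hz, rfl⟩ hyz
  rw [hinj hy hz hyz]

/-- The Wronskian vanishes at a critical point: `P(s)Q(t) - P(t)Q(s)` is `s - t` times a symmetric
polynomial whose value at the origin is `p₁q₀ - p₀q₁`. If this is nonzero, `f` is injective near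
`0`. -/
theorem IsQuadraticForms.coeff_eq_of_crit_zero {f : Sph → Sph} {p₂ p₁ p₀ q₂ q₁ q₀ : ℂ}
    (hf : IsQuadraticForms f p₂ p₁ p₀ q₂ q₁ q₀) (hc : IsCritPt f ((0 : ℂ) : Sph)) :
    p₁ * q₀ = p₀ * q₁ := by
  by_contra hne
  apply hc
  have hcont : Continuous fun v : ℂ × ℂ => (p₂ * q₁ - p₁ * q₂) * (v.1 * v.2)
      + (p₂ * q₀ - p₀ * q₂) * (v.1 + v.2) + (p₁ * q₀ - p₀ * q₁) := by fun_prop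
  have hopen := (isOpen_ne_fun hcont continuous_const).mem_nhds
    (show (fun v : ℂ × ℂ => (p₂ * q₁ - p₁ * q₂) * (v.1 * v.2)
      + (p₂ * q₀ - p₀ * q₂) * (v.1 + v.2) + (p₁ * q₀ - p₀ * q₁)) ((0 : ℂ), (0 : ℂ)) ≠ 0 by
        simpa [sub_eq_zero] using hne)
  rw [nhds_prod_eq] at hopen
  obtain ⟨U, hU, hUU⟩ := Filter.mem_prod_same_iff.1 hopen
  refine ⟨(fun z : ℂ => (z : Sph)) '' U, OnePoint.isOpenMap_coe.image_mem_nhds hU, ?_⟩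
  rintro _ ⟨s, hs, rfl⟩ _ ⟨t, ht, rfl⟩ hst
  have hst' := hUU (mk_mem_prod hs ht)
  simp only [mem_ofPred_eq] at hst'
  change f (s : Sph) = f (t : Sph) at hst
  rw [← homog_one s, ← homog_one t, (hf s 1 (by simp)).2, (hf t 1 (by simp)).2] at hst
  have := homog_eq_homog hst
  have h2 : (s - t) * ((p₂ * q₁ - p₁ * q₂) * (s * t)
      + (p₂ * q₀ - p₀ * q₂) * (s + t) + (p₁ * q₀ - p₀ * q₁)) = 0 := by
    linear_combination this
  have := sub_eq_zero.1 ((mul_eq_zero.1 h2).resolve_right hst')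
  simp [this]

theorem IsQuadraticForms.exists_normal_form {f : Sph → Sph} {p₂ p₁ p₀ q₂ q₁ q₀ : ℂ}
    (hf : IsQuadraticForms f p₂ p₁ p₀ q₂ q₁ q₀) (hc : IsCritPt f ((0 : ℂ) : Sph))
    (hc' : IsCritPt f OnePoint.infty) : ∃ M : Sph ≃ₜ Sph, ∀ x, f x = M (sqMap x) := by
  have h0 := hf.coeff_eq_of_crit_zero hc
  have h2 := hf.comp_invSph.coeff_eq_of_crit_zero
    (IsCritPt.comp_homeomorph invSph (by rw [invSph_zero]; exact hc'))
  obtain ⟨x, y, hxy, hP⟩ := exists_zero_binary_quadratic p₂ p₁ p₀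
  obtain ⟨z, w, hzw, hQ⟩ := exists_zero_binary_quadratic q₂ q₁ q₀
  -- The two Wronskian relations give `p₁Q = q₁P`. A nonzero `p₁` would make the zero of `P` a
  -- common zero, and a nonzero `q₁` is excluded in the same way. Without middle terms the map is a
  -- Moebius map in the square.
  have hp1 : p₁ = 0 := by
    by_contra hp1
    have h3 := (hf x y hxy).1
    rw [hP] at h3
    refine h3.elim (fun h => h rfl) (fun h => h ?_)
    have : p₁ * (q₂ * x ^ 2 + q₁ * x * y + q₀ * y ^ 2) = 0 := by
      linear_combination x ^ 2 * h2 + y ^ 2 * h0 + q₁ * hP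
    exact (mul_eq_zero.1 this).resolve_left hp1
  have hq1 : q₁ = 0 := by
    by_contra hq1
    have h3 := (hf z w hzw).1
    rw [hQ] at h3
    refine h3.elim (fun h => h ?_) (fun h => h rfl)
    have : q₁ * (p₂ * z ^ 2 + p₁ * z * w + p₀ * w ^ 2) = 0 := by
      linear_combination - z ^ 2 * h2 - w ^ 2 * h0 + p₁ * hQ
    exact (mul_eq_zero.1 this).resolve_left hq1
  subst hp1 hq1
  have hdet : p₂ * q₀ - p₀ * q₂ ≠ 0 := by
    intro hdet
    by_cases h : p₂ = 0 ∧ p₀ = 0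
    · have h3 := (hf z w hzw).1
      rw [hQ] at h3
      simp [h.1, h.2] at h3
    · have h3 := (hf x y hxy).1
      rw [hP] at h3
      refine h3.elim (fun h => h rfl) (fun h' => h' ?_)
      by_cases hp2 : p₂ = 0
      · have hp0 : p₀ ≠ 0 := fun h0 => h ⟨hp2, h0⟩
        have : p₀ * (q₂ * x ^ 2 + 0 * x * y + q₀ * y ^ 2) = 0 := by
          linear_combination -x ^ 2 * hdet + q₀ * hP
        exact (mul_eq_zero.1 this).resolve_left hp0
      · have : p₂ * (q₂ * x ^ 2 + 0 * x * y + q₀ * y ^ 2) = 0 := by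
          linear_combination y ^ 2 * hdet + q₂ * hP
        exact (mul_eq_zero.1 this).resolve_left hp2
  refine ⟨moebiusHomeomorph hdet, fun t => ?_⟩
  obtain ⟨u, v, huv, rfl⟩ := exists_homog t
  rw [(hf u v huv).2, sqMap_homog, moebiusHomeomorph_homog hdet
    (huv.imp (pow_ne_zero 2) (pow_ne_zero 2))]
  congr 1 <;> ring

/-- A quadratic rational map with two distinct critical points is the squaring map, up to
homeomorphic changes of coordinates. -/
theorem IsQuadraticRational.exists_normal_form {f : Sph → Sph} (hf : IsQuadraticRational f)
    {c₁ c₂ : Sph} (h₁ : IsCritPt f c₁) (h₂ : IsCritPt f c₂) (hne : c₁ ≠ c₂) :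
    ∃ M N : Sph ≃ₜ Sph, (∀ x, f x = M (sqMap (N x))) ∧ N c₁ = ((0 : ℂ) : Sph) ∧
      N c₂ = OnePoint.infty := by
  obtain ⟨p₂, p₁, p₀, q₂, q₁, q₀, hF⟩ := hf.exists_forms
  obtain ⟨u, v, huv, rfl⟩ := exists_homog c₁
  obtain ⟨z, w, hzw, rfl⟩ := exists_homog c₂
  -- The critical points are distinct, so the matrix with columns `(z, w)` and `(u, v)` is
  -- invertible; its Moebius map sends `∞` to `c₂` and `0` to `c₁`.
  have hdet : z * v - u * w ≠ 0 := by
    intro h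
    apply hne
    have h' : u * w = z * v := by linear_combination -h
    unfold homog
    by_cases hv : v = 0
    · have hu : u ≠ 0 := huv.resolve_right (by simpa using hv)
      have hw : w = 0 := by simpa [hv, hu] using h'
      simp [hv, hw]
    · by_cases hw : w = 0
      · have hz : z ≠ 0 := hzw.resolve_right (by simpa using hw)
        simp [hw, hv, hz] at h'
      · rw [if_neg hv, if_neg hw, (div_eq_div_iff hv hw).2 h']
  obtain ⟨r₂, r₁, r₀, s₂, s₁, s₀, hF'⟩ := hF.comp_moebius hdet
  have e1 : moebiusHomeomorph hdet ((0 : ℂ) : Sph) = homog u v := by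
    rw [← homog_one, moebiusHomeomorph_homog hdet (by simp)]; simp
  have e2 : moebiusHomeomorph hdet OnePoint.infty = homog z w := by
    rw [← homog_zero 1, moebiusHomeomorph_homog hdet (by simp)]; simp
  obtain ⟨M, hM⟩ := hF'.exists_normal_form
    (IsCritPt.comp_homeomorph _ (by rw [e1]; exact h₁))
    (IsCritPt.comp_homeomorph _ (by rw [e2]; exact h₂))
  refine ⟨M, (moebiusHomeomorph hdet).symm, fun x => ?_, ?_, ?_⟩
  · rw [← hM]; simp
  · rw [← e1]; simp
  · rw [← e2]; simp

theorem sqMap_not_crit {x : Sph} (h0 : x ≠ ((0 : ℂ) : Sph)) (hi : x ≠ OnePoint.infty) :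
    ¬ IsCritPt sqMap x := by
  intro hc
  apply hc
  have hne : x ≠ negSph x := fun h => by
    rcases negSph_eq_self.1 h.symm with h | h
    · exact h0 h
    · exact hi h
  have hopen : {v : Sph × Sph | v.1 ≠ negSph v.2} ∈ 𝓝 (x, x) :=
    (isOpen_ne_fun continuous_fst (negSph.continuous.comp continuous_snd)).mem_nhds hne
  rw [nhds_prod_eq] at hopen
  obtain ⟨U, hU, hUU⟩ := Filter.mem_prod_same_iff.1 hopen
  refine ⟨U, hU, fun y hy z hz hyz => ?_⟩
  exact (sqMap_eq_sqMap.1 hyz).resolve_right (hUU (mk_mem_prod hy hz))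

theorem IsCompact.exists_leftInverse_continuousOn {X Y : Type*} [TopologicalSpace X]
    [TopologicalSpace Y] [T2Space Y] [Nonempty X] {K : Set X} (hK : IsCompact K) {f : X → Y}
    (hf : ContinuousOn f K) (hinj : InjOn f K) :
    ∃ g : Y → X, ContinuousOn g (f '' K) ∧ ∀ x ∈ K, g (f x) = x := by
  have hg : ∀ x ∈ K, Function.invFunOn f K (f x) = x := fun x hx =>
    hinj.leftInvOn_invFunOn hx
  refine ⟨Function.invFunOn f K, ?_, hg⟩
  rw [continuousOn_iff_isClosed]
  intro C hC
  refine ⟨f '' (K ∩ C), ((hK.inter_right hC).image_of_continuousOn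
    (hf.mono inter_subset_left)).isClosed, ?_⟩
  ext y
  constructor
  · rintro ⟨hy, x, hx, rfl⟩
    refine ⟨⟨x, ⟨hx, ?_⟩, rfl⟩, x, hx, rfl⟩
    rwa [mem_preimage, hg x hx] at hy
  · rintro ⟨⟨x, hx, rfl⟩, -⟩
    refine ⟨?_, x, hx.1, rfl⟩
    rw [mem_preimage, hg x hx.1]
    exact hx.2

/-- One-dimensional Borsuk–Ulam: on a small circle in `U` the difference of `t` at antipodal points
changes sign, so it vanishes somewhere. -/
theorem not_injOn_of_isOpen_sphere {U : Set Sph} (hU : IsOpen U) (hne : U.Nonempty) {t : Sph → ℝ}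
    (ht : ContinuousOn t U) : ¬ InjOn t U := by
  intro hinj
  obtain ⟨z, hz⟩ : ∃ z : ℂ, (z : Sph) ∈ U := by
    have := (OnePoint.denseRange_coe (X := ℂ)).exists_mem_open hU hne
    exact this
  have hV : ((fun z : ℂ => (z : Sph)) ⁻¹' U) ∈ 𝓝 z :=
    (hU.preimage OnePoint.continuous_coe).mem_nhds hz
  obtain ⟨r, hr, hrU⟩ := Metric.nhds_basis_closedBall.mem_iff.1 hV
  have hc : ∀ θ : ℝ, ((circleMap z r θ : ℂ) : Sph) ∈ U := fun θ =>
    hrU (Metric.sphere_subset_closedBall (circleMap_mem_sphere z hr.le θ))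
  have hcc : Continuous fun θ : ℝ => t ((circleMap z r θ : ℂ) : Sph) :=
    ht.comp_continuous (OnePoint.continuous_coe.comp (continuous_circleMap z r)) hc
  set F : ℝ → ℝ := fun θ => t ((circleMap z r θ : ℂ) : Sph)
    - t ((circleMap z r (θ + Real.pi) : ℂ) : Sph) with hF
  have hFc : Continuous F := hcc.sub (hcc.comp (continuous_id.add continuous_const))
  have hanti : F Real.pi = - F 0 := by
    have : circleMap z r (Real.pi + Real.pi) = circleMap z r 0 := by
      rw [← two_mul]
      simpa using periodic_circleMap z r 0
    simp only [hF, this, zero_add]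
    ring
  obtain ⟨θ, hθ⟩ : ∃ θ, F θ = 0 := by
    rcases le_total (F 0) 0 with h | h
    · exact mem_range_of_exists_le_of_exists_ge hFc ⟨0, h⟩ ⟨Real.pi, by linarith⟩
    · exact mem_range_of_exists_le_of_exists_ge hFc ⟨Real.pi, by linarith⟩ ⟨0, h⟩
  have h1 := hinj (hc θ) (hc (θ + Real.pi)) (sub_eq_zero.1 hθ)
  rw [OnePoint.coe_eq_coe] at h1
  simp only [circleMap, Complex.ofReal_add, add_mul, Complex.exp_add, Complex.exp_pi_mul_I] at h1
  have h2 : (r : ℂ) * Complex.exp (θ * Complex.I) = 0 := by linear_combination h1 / 2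
  simp [hr.ne'] at h2

/-! ### Finite graphs as systems of arcs: subdivision, preimages, charts. -/

theorem unitInterval.mem_Ioo_or (u : unitInterval) : u ∈ Ioo 0 1 ∨ u = 0 ∨ u = 1 := by
  rcases eq_or_ne u 0 with h | h
  · exact Or.inr (Or.inl h)
  · rcases eq_or_ne u 1 with h' | h'
    · exact Or.inr (Or.inr h')
    · exact Or.inl ⟨unitInterval.pos_iff_ne_zero.2 h, unitInterval.lt_one_iff_ne_one.2 h'⟩

theorem unitInterval.exists_scale_left {s : unitInterval} (hs : s ∈ Ioo 0 1) :
    ∃ e : unitInterval → unitInterval, Continuous e ∧ Function.Injective e ∧ e 0 = 0 ∧ e 1 = s ∧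
      e '' Ioo 0 1 = Ioo 0 s := by
  have hs0 : (0 : ℝ) < s := hs.1
  have key : Function.Injective fun t : unitInterval => s * t := fun t u h => by
    have : (s : ℝ) * t = s * u := congrArg Subtype.val h
    exact Subtype.ext (mul_left_cancel₀ hs0.ne' this)
  refine ⟨fun t => s * t, by fun_prop, key, by simp, by simp, ?_⟩
  ext u
  constructor
  · rintro ⟨t, ht, rfl⟩
    have h0 : (0 : ℝ) < t := ht.1
    have h1 : (t : ℝ) < 1 := ht.2
    refine ⟨?_, ?_⟩
    · change (0 : ℝ) < s * t
      positivity
    · change (s : ℝ) * t < s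
      nlinarith
  · rintro ⟨h0, h1⟩
    have h0 : (0 : ℝ) < u := h0
    have h1 : (u : ℝ) < s := h1
    have h2 : (u : ℝ) / s < 1 := (div_lt_one hs0).2 h1
    have h3 : (0 : ℝ) < u / s := div_pos h0 hs0
    refine ⟨⟨u / s, h3.le, h2.le⟩, ⟨h3, h2⟩, ?_⟩
    refine Subtype.ext ?_
    change (s : ℝ) * (u / s) = u
    field_simp

theorem unitInterval.exists_scale_right {s : unitInterval} (hs : s ∈ Ioo 0 1) :
    ∃ e : unitInterval → unitInterval, Continuous e ∧ Function.Injective e ∧ e 0 = s ∧ e 1 = 1 ∧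
      e '' Ioo 0 1 = Ioo s 1 := by
  have hsymm : ∀ a b : unitInterval, unitInterval.symm a < unitInterval.symm b ↔ b < a := by
    intro a b
    rw [← Subtype.coe_lt_coe, ← Subtype.coe_lt_coe, unitInterval.coe_symm_eq,
      unitInterval.coe_symm_eq]
    constructor <;> intro h <;> linarith
  have himg : ∀ a b : unitInterval, unitInterval.symm '' Ioo a b =
      Ioo (unitInterval.symm b) (unitInterval.symm a) := by
    intro a b
    ext u
    constructor
    · rintro ⟨v, hv, rfl⟩
      exact ⟨(hsymm _ _).2 hv.2, (hsymm _ _).2 hv.1⟩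
    · rintro ⟨h1, h2⟩
      refine ⟨unitInterval.symm u, ⟨?_, ?_⟩, by simp⟩
      · rw [← unitInterval.symm_symm a, hsymm]; exact h2
      · rw [← unitInterval.symm_symm b, hsymm]; exact h1
  obtain ⟨e, hc, hi, h0, h1, him⟩ := unitInterval.exists_scale_left
    (s := unitInterval.symm s) ⟨by simpa using (hsymm 1 s).2 hs.2, by simpa using (hsymm s 0).2 hs.1⟩
  refine ⟨fun t => unitInterval.symm (e (unitInterval.symm t)), by fun_prop, ?_, ?_, ?_, ?_⟩
  · exact unitInterval.symm_bijective.injective.comp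
      (hi.comp unitInterval.symm_bijective.injective)
  · simp [h1]
  · simp [h0]
  · have : (fun t => unitInterval.symm (e (unitInterval.symm t))) '' Ioo 0 1 =
        unitInterval.symm '' (e '' (unitInterval.symm '' Ioo 0 1)) := by
      rw [← image_comp, ← image_comp]; rfl
    rw [this, himg, unitInterval.symm_one, unitInterval.symm_zero, him, himg]
    simp

/-- The arcs of a finite graph, indexed by an arbitrary type. -/
structure IsArcSystem {ι : Type*} (G X : Set Sph) (γ : ι → unitInterval → Sph) : Prop where
  cont : ∀ k, Continuous (γ k)
  ends : ∀ k, γ k 0 ∈ X ∧ γ k 1 ∈ X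
  inj : ∀ k, InjOn (γ k) (Ioo 0 1)
  disj : ∀ k, Disjoint (γ k '' Ioo 0 1) X
  pairwise : ∀ k l, k ≠ l → Disjoint (γ k '' Ioo 0 1) (γ l '' Ioo 0 1)
  union : G = X ∪ ⋃ k, γ k '' Ioo 0 1

theorem IsFiniteGraph.exists_arcs {G X : Set Sph} (h : IsFiniteGraph G X) :
    ∃ (m : ℕ) (γ : Fin m → unitInterval → Sph), IsArcSystem G X γ := by
  obtain ⟨-, m, γ, h1, h2, h3, h4, h5, h6⟩ := h
  exact ⟨m, γ, h1, h2, h3, h4, h5, h6⟩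

theorem IsArcSystem.isFiniteGraph {ι : Type*} [Finite ι] {G X : Set Sph}
    {γ : ι → unitInterval → Sph} (h : IsArcSystem G X γ) (hX : X.Finite) :
    IsFiniteGraph G X := by
  obtain ⟨m, ⟨e⟩⟩ := Finite.exists_equiv_fin ι
  refine ⟨hX, m, fun k => γ (e.symm k), fun k => h.cont _, fun k => h.ends _, fun k => h.inj _,
    fun k => h.disj _, fun k l hkl => h.pairwise _ _ (e.symm.injective.ne hkl), ?_⟩
  rw [h.union]
  congr 1
  exact (e.symm.surjective.iUnion_comp (fun k => γ k '' Ioo 0 1)).symm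

namespace IsArcSystem

variable {ι : Type*} {G X : Set Sph} {γ : ι → unitInterval → Sph}

theorem arc_subset (h : IsArcSystem G X γ) (k : ι) : γ k '' Ioo 0 1 ⊆ G \ X := by
  intro x hx
  refine ⟨?_, fun hX => (h.disj k).le_bot ⟨hx, hX⟩⟩
  rw [h.union]
  exact Or.inr (mem_iUnion.2 ⟨k, hx⟩)

theorem range_subset (h : IsArcSystem G X γ) (k : ι) : range (γ k) ⊆ γ k '' Ioo 0 1 ∪ X := by
  rintro _ ⟨u, rfl⟩
  rcases unitInterval.mem_Ioo_or u with hu | rfl | rfl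
  · exact Or.inl (mem_image_of_mem _ hu)
  · exact Or.inr (h.ends k).1
  · exact Or.inr (h.ends k).2

theorem isClosed_range (h : IsArcSystem G X γ) (k : ι) : IsClosed (range (γ k)) :=
  (isCompact_range (h.cont k)).isClosed

theorem exists_of_mem (h : IsArcSystem G X γ) {x : Sph} (hx : x ∈ G \ X) :
    ∃ k, x ∈ γ k '' Ioo 0 1 := by
  have h1 := hx.1
  rw [h.union] at h1
  exact mem_iUnion.1 (h1.resolve_left hx.2)

theorem isClosed_others (h : IsArcSystem G X γ) [Finite ι] (k : ι) :
    IsClosed (⋃ l : {l // l ≠ k}, range (γ l.1)) :=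
  isClosed_iUnion_of_finite fun l => h.isClosed_range l.1

theorem notMem_others (h : IsArcSystem G X γ) {k : ι} {x : Sph} (hx : x ∈ γ k '' Ioo 0 1) :
    x ∉ ⋃ l : {l // l ≠ k}, range (γ l.1) := by
  intro hcon
  obtain ⟨l, hl⟩ := mem_iUnion.1 hcon
  rcases h.range_subset l.1 hl with h' | h'
  · exact (h.pairwise _ _ l.2).le_bot ⟨h', hx⟩
  · exact (h.disj k).le_bot ⟨hx, h'⟩

/-- An open arc stays away from the closed union of the finitely many other arcs, so it is
relatively clopen off the vertices. -/
theorem connectedComponentIn_eq (h : IsArcSystem G X γ) [Finite ι] {k : ι} {x : Sph}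
    (hx : x ∈ γ k '' Ioo 0 1) : connectedComponentIn (G \ X) x = γ k '' Ioo 0 1 := by
  have hxGX := h.arc_subset k hx
  apply Subset.antisymm
  · have hsub : connectedComponentIn (G \ X) x ⊆ range (γ k) := by
      refine isPreconnected_connectedComponentIn.subset_of_isClosed_of_nhdsWithin
        (h.isClosed_range k) ⟨x, mem_connectedComponentIn hxGX, image_subset_range _ _ hx⟩ ?_
      rintro p ⟨hp, hpk⟩
      have hpGX := connectedComponentIn_subset _ _ hp
      have hp' : p ∈ γ k '' Ioo 0 1 := (h.range_subset k hpk).resolve_right hpGX.2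
      have := (h.isClosed_others k).isOpen_compl.mem_nhds (h.notMem_others hp')
      filter_upwards [self_mem_nhdsWithin, mem_nhdsWithin_of_mem_nhds this] with q hq hq'
      obtain ⟨l, hl⟩ := h.exists_of_mem (connectedComponentIn_subset _ _ hq)
      by_cases hlk : l = k
      · subst hlk
        exact image_subset_range _ _ hl
      · exact (hq' (mem_iUnion.2 ⟨⟨l, hlk⟩, image_subset_range _ _ hl⟩)).elim
    intro y hy
    exact (h.range_subset k (hsub hy)).resolve_right (connectedComponentIn_subset _ _ hy).2
  · exact (isPreconnected_Ioo.image _ (h.cont k).continuousOn).subset_connectedComponentIn hx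
      (h.arc_subset k)

theorem exists_chart (h : IsArcSystem G X γ) [Finite ι] (hX : X.Finite) {p : Sph}
    (hp : p ∈ G \ X) : ∃ O : Set Sph, IsOpen O ∧ p ∈ O ∧ ∃ t : Sph → ℝ,
      ContinuousOn t (G ∩ O) ∧ InjOn t (G ∩ O) := by
  obtain ⟨k, s, hs, rfl⟩ := h.exists_of_mem hp
  obtain ⟨a, ha0, has⟩ := exists_between hs.1
  obtain ⟨b, hsb, hb1⟩ := exists_between hs.2
  have hIcc : Icc a b ⊆ Ioo 0 1 := fun u hu => ⟨ha0.trans_le hu.1, hu.2.trans_lt hb1⟩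
  obtain ⟨g, hg, hgk⟩ := (isCompact_Icc (a := a) (b := b)).exists_leftInverse_continuousOn
    (h.cont k).continuousOn ((h.inj k).mono hIcc)
  -- `Z` is a closed set containing all of the graph except a short subarc around `p`. On its
  -- complement the inverse of the compact subarc is the chart.
  set Z : Set Sph := (⋃ l : {l // l ≠ k}, range (γ l.1)) ∪ (γ k '' (Ioo a b)ᶜ ∪ X) with hZ
  have hZc : IsClosed Z :=
    (h.isClosed_others k).union
      (((isOpen_Ioo.isClosed_compl.isCompact.image (h.cont k)).isClosed).union hX.isClosed)
  have hGZ : G ∩ Zᶜ ⊆ γ k '' Icc a b := by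
    rintro q ⟨hqG, hqZ⟩
    simp only [hZ, mem_compl_iff, mem_union, not_or] at hqZ
    obtain ⟨l, hl⟩ := h.exists_of_mem ⟨hqG, hqZ.2.2⟩
    by_cases hlk : l = k
    · subst hlk
      obtain ⟨u, hu, rfl⟩ := hl
      refine ⟨u, ?_, rfl⟩
      by_contra hcon
      exact hqZ.2.1 ⟨u, fun h' => hcon (Ioo_subset_Icc_self h'), rfl⟩
    · exact (hqZ.1 (mem_iUnion.2 ⟨⟨l, hlk⟩, image_subset_range _ _ hl⟩)).elim
  refine ⟨Zᶜ, hZc.isOpen_compl, ?_, fun q => (g q : ℝ), ?_, ?_⟩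
  · rintro (h' | ⟨u, hu, hus⟩ | h')
    · exact h.notMem_others (mem_image_of_mem _ hs) h'
    · rcases unitInterval.mem_Ioo_or u with hu' | rfl | rfl
      · have := h.inj k hu' hs hus
        subst this
        exact hu ⟨has, hsb⟩
      · exact hp.2 (hus ▸ (h.ends k).1)
      · exact hp.2 (hus ▸ (h.ends k).2)
    · exact hp.2 h'
  · exact continuous_subtype_val.comp_continuousOn (hg.mono hGZ)
  · intro x hx y hy hxy
    obtain ⟨u, hu, rfl⟩ := hGZ hx
    obtain ⟨v, hv, rfl⟩ := hGZ hy
    have := Subtype.ext hxy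
    rw [hgk u hu, hgk v hv] at this
    rw [this]

theorem image (h : IsArcSystem G X γ) (φ : Sph ≃ₜ Sph) :
    IsArcSystem (φ '' G) (φ '' X) (fun k u => φ (γ k u)) where
  cont k := φ.continuous.comp (h.cont k)
  ends k := ⟨mem_image_of_mem _ (h.ends k).1, mem_image_of_mem _ (h.ends k).2⟩
  inj k := fun u hu v hv huv => h.inj k hu hv (φ.injective huv)
  disj k := by
    have := (disjoint_image_iff φ.injective).2 (h.disj k)
    rwa [← image_comp] at this
  pairwise k l hkl := by
    have := (disjoint_image_iff φ.injective).2 (h.pairwise k l hkl)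
    rwa [← image_comp, ← image_comp] at this
  union := by
    rw [h.union, image_union, image_iUnion]
    simp only [← image_comp]
    rfl

/-- The arc through `p` is cut at the parameter of `p`; the index `Bool` stands for its two halves.
-/
theorem insert (h : IsArcSystem G X γ) {p : Sph} (hp : p ∈ G \ X) :
    ∃ (k : ι) (δ : Bool ⊕ {l // l ≠ k} → unitInterval → Sph),
      IsArcSystem G (insert p X) δ := by
  obtain ⟨k, s, hs, rfl⟩ := h.exists_of_mem hp
  obtain ⟨e, hec, hei, he0, he1, heI⟩ := unitInterval.exists_scale_left hs
  obtain ⟨e', hec', hei', he0', he1', heI'⟩ := unitInterval.exists_scale_right hs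
  have hsub : Ioo 0 s ⊆ Ioo 0 1 := Ioo_subset_Ioo_right hs.2.le
  have hsub' : Ioo s 1 ⊆ Ioo 0 1 := Ioo_subset_Ioo_left hs.1.le
  have im : (fun u => γ k (e u)) '' Ioo 0 1 = γ k '' Ioo 0 s := by
    rw [← heI, ← image_comp]; rfl
  have im' : (fun u => γ k (e' u)) '' Ioo 0 1 = γ k '' Ioo s 1 := by
    rw [← heI', ← image_comp]; rfl
  have hd : ∀ A B : Set unitInterval, A ⊆ Ioo 0 1 → B ⊆ Ioo 0 1 → Disjoint A B →
      Disjoint (γ k '' A) (γ k '' B) := by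
    intro A B hA hB hAB
    rw [Set.disjoint_left]
    rintro _ ⟨u, hu, rfl⟩ ⟨v, hv, hvu⟩
    exact hAB.le_bot ⟨hu, h.inj k (hB hv) (hA hu) hvu ▸ hv⟩
  have hss : ({s} : Set unitInterval) ⊆ Ioo 0 1 := by simpa using hs
  have d1 : Disjoint (γ k '' Ioo 0 s) (γ k '' {s}) := hd _ _ hsub hss (by simp)
  have d2 : Disjoint (γ k '' Ioo s 1) (γ k '' {s}) := hd _ _ hsub' hss (by simp)
  have d3 : Disjoint (γ k '' Ioo 0 s) (γ k '' Ioo s 1) := hd _ _ hsub hsub' (by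
    rw [Set.disjoint_left]
    intro u hu hu'
    exact lt_asymm hu.2 hu'.1)
  rw [image_singleton] at d1 d2
  refine ⟨k, Sum.elim (fun b u => γ k (if b then e u else e' u)) (fun l => γ l.1), ?_⟩
  constructor
  · rintro (b | l)
    · cases b
      · exact (h.cont k).comp hec'
      · exact (h.cont k).comp hec
    · exact h.cont _
  · rintro (b | l)
    · cases b
      · simp [he0', he1', (h.ends k).2]
      · simp [he0, he1, (h.ends k).1]
    · exact ⟨Or.inr (h.ends _).1, Or.inr (h.ends _).2⟩
  · rintro (b | l)
    · cases b
      · intro u hu v hv huv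
        exact hei' (h.inj k (hsub' (heI' ▸ mem_image_of_mem _ hu))
          (hsub' (heI' ▸ mem_image_of_mem _ hv)) huv)
      · intro u hu v hv huv
        exact hei (h.inj k (hsub (heI ▸ mem_image_of_mem _ hu))
          (hsub (heI ▸ mem_image_of_mem _ hv)) huv)
    · exact h.inj _
  · rintro (b | l)
    · rw [insert_eq, disjoint_union_right]
      cases b
      · simp only [Sum.elim_inl, Bool.false_eq_true, if_false, im']
        exact ⟨d2, (h.disj k).mono_left (image_mono hsub')⟩
      · simp only [Sum.elim_inl, if_true, im]
        exact ⟨d1, (h.disj k).mono_left (image_mono hsub)⟩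
    · rw [insert_eq, disjoint_union_right]
      refine ⟨?_, h.disj _⟩
      exact (h.pairwise _ _ l.2).mono_right (by simpa using mem_image_of_mem (γ k) hs)
  · rintro (b | l) (b' | l') hne
    · cases b <;> cases b'
      · exact (hne rfl).elim
      · simp only [Sum.elim_inl, Bool.false_eq_true, if_false, if_true, im, im']
        exact d3.symm
      · simp only [Sum.elim_inl, Bool.false_eq_true, if_false, if_true, im, im']
        exact d3
      · exact (hne rfl).elim
    · cases b
      · simp only [Sum.elim_inl, Sum.elim_inr, Bool.false_eq_true, if_false, im']
        exact (h.pairwise _ _ l'.2.symm).mono_left (image_mono hsub')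
      · simp only [Sum.elim_inl, Sum.elim_inr, if_true, im]
        exact (h.pairwise _ _ l'.2.symm).mono_left (image_mono hsub)
    · cases b'
      · simp only [Sum.elim_inl, Sum.elim_inr, Bool.false_eq_true, if_false, im']
        exact (h.pairwise _ _ l.2).mono_right (image_mono hsub')
      · simp only [Sum.elim_inl, Sum.elim_inr, if_true, im]
        exact (h.pairwise _ _ l.2).mono_right (image_mono hsub)
    · exact h.pairwise _ _ fun h' => hne (congrArg Sum.inr (Subtype.ext h'))
  · have hsplit : γ k '' Ioo 0 1 = {γ k s} ∪ (γ k '' Ioo 0 s ∪ γ k '' Ioo s 1) := by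
      rw [← image_singleton, ← image_union, ← image_union]
      congr 1
      ext u
      simp only [mem_union, mem_singleton_iff, mem_Ioo]
      constructor
      · rintro ⟨h0, h1⟩
        rcases lt_trichotomy u s with h' | h' | h'
        · exact Or.inr (Or.inl ⟨h0, h'⟩)
        · exact Or.inl h'
        · exact Or.inr (Or.inr ⟨h', h1⟩)
      · rintro (rfl | h' | h')
        · exact hs
        · exact ⟨h'.1, h'.2.trans hs.2⟩
        · exact ⟨hs.1.trans h'.1, h'.2⟩
    have hun : (⋃ l, γ l '' Ioo 0 1) = γ k '' Ioo 0 1 ∪ ⋃ l : {l // l ≠ k}, γ l.1 '' Ioo 0 1 := by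
      ext x
      simp only [mem_iUnion, mem_union, Subtype.exists]
      constructor
      · rintro ⟨l, hl⟩
        by_cases hlk : l = k
        · subst hlk; exact Or.inl hl
        · exact Or.inr ⟨l, hlk, hl⟩
      · rintro (h' | ⟨l, -, hl⟩)
        · exact ⟨k, h'⟩
        · exact ⟨l, hl⟩
    have hbool : (⋃ b : Bool, (fun u => γ k (if b then e u else e' u)) '' Ioo 0 1) =
        γ k '' Ioo 0 s ∪ γ k '' Ioo s 1 := by
      rw [← im, ← im']
      ext x
      simp only [mem_iUnion, Bool.exists_bool, mem_union, Bool.false_eq_true, if_false, if_true]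
      exact or_comm
    rw [h.union, hun, hsplit, iUnion_sum]
    simp only [Sum.elim_inl, Sum.elim_inr]
    rw [hbool, insert_eq]
    ext x
    simp only [mem_union]
    tauto

/-- Branch values on the graph are vertices, so each open arc avoids them. It then has two disjoint
lifts, negatives of each other, labelled by `Bool`. -/
theorem sqMap_preimage (h : IsArcSystem G X γ)
    (h0 : ∀ x ∈ G, x = ((0 : ℂ) : Sph) ∨ x = OnePoint.infty → x ∈ X) :
    ∃ δ : ι × Bool → unitInterval → Sph,
      IsArcSystem (sqMap ⁻¹' G) (sqMap ⁻¹' X) δ := by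
  have hlift : ∀ k, ∃ s : unitInterval → Sph, Continuous s ∧ ∀ u, sqMap (s u) = γ k u := by
    intro k
    have hc : ContinuousOn (fun x : ℝ => γ k (projIcc 0 1 zero_le_one x)) (Icc 0 1) :=
      ((h.cont k).comp continuous_projIcc).continuousOn
    -- Only the end parameters can be sent to a branch value, so the remaining parameters form an
    -- interval.
    obtain ⟨s, hs, hsγ⟩ := Convex.exists_sqMap_lift hc (by
      rw [convex_iff_ordConnected]
      constructor
      rintro x hx y hy z hz
      rcases eq_or_lt_of_le hz.1 with h1 | h1
      · exact h1 ▸ hx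
      rcases eq_or_lt_of_le hz.2 with h2 | h2
      · exact h2 ▸ hy
      have hz0 : 0 < z := hx.1.1.trans_lt h1
      have hz1 : z < 1 := h2.trans_le hy.1.2
      refine ⟨⟨hz0.le, hz1.le⟩, ?_⟩
      have hmem : γ k (projIcc 0 1 zero_le_one z) ∈ γ k '' Ioo 0 1 := by
        refine ⟨_, ?_, rfl⟩
        rw [projIcc_of_mem zero_le_one ⟨hz0.le, hz1.le⟩]
        exact ⟨hz0, hz1⟩
      have := h.arc_subset k hmem
      exact ⟨fun h' => this.2 (h0 _ this.1 (Or.inl h')), fun h' => this.2 (h0 _ this.1 (Or.inr h'))⟩)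
    refine ⟨fun u => s u, ?_, fun u => ?_⟩
    · exact hs.comp_continuous continuous_subtype_val fun u => u.2
    · rw [hsγ u u.2]
      simp
  choose s hs hsγ using hlift
  have hsδ : ∀ k (b : Bool) u, sqMap (if b then s k u else negSph (s k u)) = γ k u := by
    intro k b u
    cases b <;> simp [sqMap_negSph, hsγ]
  have himg : ∀ k (b : Bool), sqMap '' ((fun u => if b then s k u else negSph (s k u)) '' Ioo 0 1) =
      γ k '' Ioo 0 1 := by
    intro k b
    rw [← image_comp]
    exact image_congr fun u _ => hsδ k b u
  have hpm : ∀ k, ∀ u ∈ Ioo (0 : unitInterval) 1, negSph (s k u) ≠ s k u := by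
    intro k u hu h'
    have hmem := h.arc_subset k (mem_image_of_mem _ hu)
    refine hmem.2 (h0 _ hmem.1 ?_)
    rw [← hsγ]
    rcases negSph_eq_self.1 h' with h' | h' <;> simp [h']
  refine ⟨fun kb u => if kb.2 then s kb.1 u else negSph (s kb.1 u), ?_⟩
  constructor
  · rintro ⟨k, b⟩
    cases b
    · simpa [Function.comp_def] using negSph.continuous.comp (hs k)
    · simpa using hs k
  · rintro ⟨k, b⟩
    simp only [mem_preimage, hsδ]
    exact h.ends k
  · rintro ⟨k, b⟩ u hu v hv huv
    have := congrArg sqMap huv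
    simp only [hsδ] at this
    exact h.inj k hu hv this
  · rintro ⟨k, b⟩
    refine Disjoint.preimage sqMap (h.disj k) |>.mono_left ?_
    rw [← himg k b]
    exact subset_preimage_image _ _
  · rintro ⟨k, b⟩ ⟨l, c⟩ hne
    by_cases hkl : k = l
    · subst hkl
      have hbc : b ≠ c := fun h' => hne (by rw [h'])
      rw [Set.disjoint_left]
      rintro _ ⟨u, hu, rfl⟩ ⟨v, hv, huv⟩
      have := congrArg sqMap huv
      simp only [hsδ] at this
      have := h.inj k hv hu this
      subst this
      cases b <;> cases c
      · exact hbc rfl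
      · exact hpm k v hv (by simpa using huv.symm)
      · exact hpm k v hv (by simpa using huv)
      · exact hbc rfl
    · have := Disjoint.preimage sqMap (h.pairwise k l hkl)
      refine this.mono ?_ ?_
      · rw [← himg k b]; exact subset_preimage_image _ _
      · rw [← himg l c]; exact subset_preimage_image _ _
  · ext y
    simp only [mem_preimage, mem_union, mem_iUnion, Prod.exists]
    conv_lhs => rw [h.union]
    simp only [mem_union, mem_iUnion]
    refine or_congr Iff.rfl ?_
    constructor
    · rintro ⟨k, u, hu, huy⟩
      rw [← hsγ] at huy
      rcases sqMap_eq_sqMap.1 huy with h' | h'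
      · exact ⟨k, true, u, hu, by simpa using h'⟩
      · exact ⟨k, false, u, hu, by simp [h']⟩
    · rintro ⟨k, b, u, hu, rfl⟩
      exact ⟨k, u, hu, (hsδ k b u).symm⟩

end IsArcSystem

namespace IsFiniteGraph

variable {G X : Set Sph}

theorem subset (h : IsFiniteGraph G X) : X ⊆ G := by
  obtain ⟨m, γ, hγ⟩ := h.exists_arcs
  rw [hγ.union]
  exact subset_union_left

theorem isClosed (h : IsFiniteGraph G X) : IsClosed G := by
  obtain ⟨m, γ, hγ⟩ := h.exists_arcs
  have : G = X ∪ ⋃ k, range (γ k) := by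
    apply Subset.antisymm
    · rw [hγ.union]
      exact union_subset_union_right _ (iUnion_mono fun k => image_subset_range _ _)
    · refine union_subset h.subset (iUnion_subset fun k => ?_)
      exact (hγ.range_subset k).trans
        (union_subset ((hγ.arc_subset k).trans sdiff_subset) h.subset)
  rw [this]
  exact h.1.isClosed.union (isClosed_iUnion_of_finite fun k => hγ.isClosed_range k)

theorem image (h : IsFiniteGraph G X) (φ : Sph ≃ₜ Sph) : IsFiniteGraph (φ '' G) (φ '' X) := by
  obtain ⟨m, γ, hγ⟩ := h.exists_arcs
  exact (hγ.image φ).isFiniteGraph (h.1.image _)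

theorem insert (h : IsFiniteGraph G X) {p : Sph} (hp : p ∈ G) :
    IsFiniteGraph G (insert p X) := by
  by_cases hpX : p ∈ X
  · rwa [insert_eq_of_mem hpX]
  · obtain ⟨m, γ, hγ⟩ := h.exists_arcs
    obtain ⟨k, δ, hδ⟩ := hγ.insert ⟨hp, hpX⟩
    exact hδ.isFiniteGraph (h.1.insert p)

theorem sqMap_preimage (h : IsFiniteGraph G X)
    (h0 : ∀ x ∈ G, x = ((0 : ℂ) : Sph) ∨ x = OnePoint.infty → x ∈ X) :
    IsFiniteGraph (sqMap ⁻¹' G) (sqMap ⁻¹' X) := by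
  obtain ⟨m, γ, hγ⟩ := h.exists_arcs
  obtain ⟨δ, hδ⟩ := hγ.sqMap_preimage h0
  refine hδ.isFiniteGraph (h.1.preimage' fun x _ => ?_)
  obtain ⟨y, rfl⟩ := surjective_sqMap x
  refine (Set.toFinite {y, negSph y}).subset fun z hz => ?_
  exact sqMap_eq_sqMap.1 hz

theorem finite_components (h : IsFiniteGraph G X) :
    (connectedComponentIn (G \ X) '' (G \ X)).Finite := by
  obtain ⟨m, γ, hγ⟩ := h.exists_arcs
  refine (finite_range fun k => γ k '' Ioo 0 1).subset ?_
  rintro _ ⟨x, hx, rfl⟩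
  obtain ⟨k, hk⟩ := hγ.exists_of_mem hx
  exact ⟨k, (hγ.connectedComponentIn_eq hk).symm⟩

theorem connectedComponentIn_mem_nhdsWithin (h : IsFiniteGraph G X) {x : Sph} (hx : x ∈ G \ X) :
    connectedComponentIn (G \ X) x ∈ 𝓝[G \ X] x := by
  obtain ⟨m, γ, hγ⟩ := h.exists_arcs
  obtain ⟨k, hk⟩ := hγ.exists_of_mem hx
  have := (hγ.isClosed_others k).isOpen_compl.mem_nhds (hγ.notMem_others hk)
  filter_upwards [self_mem_nhdsWithin, mem_nhdsWithin_of_mem_nhds this] with q hq hq'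
  rw [hγ.connectedComponentIn_eq hk]
  obtain ⟨l, hl⟩ := hγ.exists_of_mem hq
  by_cases hlk : l = k
  · subst hlk
    exact hl
  · exact (hq' (mem_iUnion.2 ⟨⟨l, hlk⟩, image_subset_range _ _ hl⟩)).elim

theorem closure_connectedComponentIn_subset (h : IsFiniteGraph G X) {x : Sph} (hx : x ∈ G \ X) :
    closure (connectedComponentIn (G \ X) x) ⊆ connectedComponentIn (G \ X) x ∪ X := by
  obtain ⟨m, γ, hγ⟩ := h.exists_arcs
  obtain ⟨k, hk⟩ := hγ.exists_of_mem hx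
  rw [hγ.connectedComponentIn_eq hk]
  exact (closure_minimal (image_subset_range _ _) (hγ.isClosed_range k)).trans (hγ.range_subset k)

theorem exists_chart (h : IsFiniteGraph G X) {p : Sph} (hp : p ∈ G \ X) :
    ∃ O : Set Sph, IsOpen O ∧ p ∈ O ∧ ∃ t : Sph → ℝ,
      ContinuousOn t (G ∩ O) ∧ InjOn t (G ∩ O) := by
  obtain ⟨m, γ, hγ⟩ := h.exists_arcs
  exact hγ.exists_chart h.1 hp

/-- Invariance of domain at the points of the open edges of a graph. -/
theorem image_Ioo_mem_nhdsWithin (h : IsFiniteGraph G X) {p : Sph} (hp : p ∈ G \ X) {δ : ℝ → Sph}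
    {ε : ℝ} (hε : 0 < ε) (hδ : ContinuousOn δ (Ioo (-ε) ε)) (hinj : InjOn δ (Ioo (-ε) ε))
    (hδG : MapsTo δ (Ioo (-ε) ε) G) (hδ0 : δ 0 = p) : δ '' Ioo (-ε) ε ∈ 𝓝[G] p := by
  obtain ⟨O, hO, hpO, t, ht, htinj⟩ := h.exists_chart hp
  have h0 : (0 : ℝ) ∈ Ioo (-ε) ε := ⟨by linarith, hε⟩
  have hnhds : Ioo (-ε) ε ∈ 𝓝 (0 : ℝ) := isOpen_Ioo.mem_nhds h0
  have hO' : δ ⁻¹' O ∈ 𝓝 (0 : ℝ) := (hδ.continuousAt hnhds) (hO.mem_nhds (hδ0 ▸ hpO))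
  obtain ⟨r, hr, hrs⟩ := Metric.nhds_basis_closedBall.mem_iff.1 (Filter.inter_mem hnhds hO')
  rw [Real.closedBall_eq_Icc, zero_sub, zero_add] at hrs
  have hmaps : MapsTo δ (Icc (-r) r) (G ∩ O) := fun x hx => ⟨hδG (hrs hx).1, (hrs hx).2⟩
  have hcont : ContinuousOn (fun x => t (δ x)) (Icc (-r) r) :=
    ht.comp (hδ.mono fun x hx => (hrs hx).1) hmaps
  have hinj' : InjOn (fun x => t (δ x)) (Icc (-r) r) := fun x hx y hy hxy =>
    hinj (hrs hx).1 (hrs hy).1 (htinj (hmaps hx) (hmaps hy) hxy)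
  -- In the chart the arc is an injective continuous real function, hence strictly monotone. By the
  -- intermediate value theorem it covers a neighbourhood of `t p`.
  have hmono := hcont.strictMonoOn_of_injOn_Icc' (by linarith) hinj'
  have hIcc : (-r : ℝ) ≤ r := by linarith
  have m1 : (-r : ℝ) ∈ Icc (-r) r := ⟨le_rfl, hIcc⟩
  have m2 : (r : ℝ) ∈ Icc (-r) r := ⟨hIcc, le_rfl⟩
  have m0 : (0 : ℝ) ∈ Icc (-r) r := ⟨by linarith, hr.le⟩
  have himg : (fun x => t (δ x)) '' Icc (-r) r ∈ 𝓝 (t p) := by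
    rcases hmono with hm | hm
    · refine Filter.mem_of_superset (Icc_mem_nhds ?_ ?_) (intermediate_value_Icc hIcc hcont)
      · rw [← hδ0]; exact hm m1 m0 (by linarith)
      · rw [← hδ0]; exact hm m0 m2 (by linarith)
    · refine Filter.mem_of_superset (Icc_mem_nhds ?_ ?_) (intermediate_value_Icc' hIcc hcont)
      · rw [← hδ0]; exact hm m0 m2 (by linarith)
      · rw [← hδ0]; exact hm m1 m0 (by linarith)
  have htp : ContinuousWithinAt t G p :=
    (ht p ⟨hp.1, hpO⟩).mono_of_mem_nhdsWithin
      (Filter.inter_mem self_mem_nhdsWithin (mem_nhdsWithin_of_mem_nhds (hO.mem_nhds hpO)))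
  filter_upwards [self_mem_nhdsWithin, mem_nhdsWithin_of_mem_nhds (hO.mem_nhds hpO),
    htp himg] with q hqG hqO hq
  obtain ⟨x, hx, hxq⟩ := hq
  exact ⟨x, (hrs hx).1, htinj (hmaps hx) ⟨hqG, hqO⟩ hxq⟩

theorem interior_eq_empty (h : IsFiniteGraph G X) : interior G = ∅ := by
  by_contra hne
  obtain ⟨x, hx⟩ := nonempty_iff_ne_empty.2 hne
  have hinf : (interior G).Infinite := infinite_of_mem_nhds x (isOpen_interior.mem_nhds hx)
  obtain ⟨p, hp, hpX⟩ := (hinf.sdiff h.1).nonempty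
  obtain ⟨O, hO, hpO, t, ht, htinj⟩ := h.exists_chart ⟨interior_subset hp, hpX⟩
  have hsub : interior G ∩ O ⊆ G ∩ O := inter_subset_inter_left _ interior_subset
  exact not_injOn_of_isOpen_sphere (isOpen_interior.inter hO) ⟨p, hp, hpO⟩ (ht.mono hsub)
    (htinj.mono hsub)

end IsFiniteGraph

/-! ### Homeomorphisms that move one point. -/

theorem LipschitzWith.exists_homeomorph_add {u : ℂ → ℂ} {c : NNReal} (hc : c < 1)
    (hu : LipschitzWith c u) : ∃ h : ℂ ≃ₜ ℂ, ∀ x, h x = x + u x := by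
  have happ : ApproximatesLinearOn (fun x => x + u x)
      ((ContinuousLinearEquiv.refl ℝ ℂ : ℂ ≃L[ℝ] ℂ) : ℂ →L[ℝ] ℂ) univ c := by
    rw [ApproximatesLinearOn.approximatesLinearOn_iff_lipschitzOnWith]
    have : ((fun x => x + u x) - ⇑((ContinuousLinearEquiv.refl ℝ ℂ : ℂ ≃L[ℝ] ℂ) : ℂ →L[ℝ] ℂ))
        = u := by
      ext x
      simp
    rw [this]
    exact hu.lipschitzOnWith
  refine ⟨happ.toHomeomorph _ (Or.inr ?_), fun x => rfl⟩
  have h1 : ‖((ContinuousLinearEquiv.refl ℝ ℂ).symm : ℂ →L[ℝ] ℂ)‖₊ = 1 := by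
    refine NNReal.eq ?_
    exact ContinuousLinearMap.norm_id (𝕜 := ℝ) (E := ℂ)
  rw [h1, inv_one]
  exact hc

/-- The map `x ↦ x + (1 - ‖x‖) a` fixes the unit circle, and its displacement has Lipschitz constant
`‖a‖ < 1`. -/
theorem exists_homeomorph_disc {a : ℂ} (ha : ‖a‖ < 1) :
    ∃ h : ℂ ≃ₜ ℂ, h 0 = a ∧ h '' Metric.ball 0 1 = Metric.ball 0 1 ∧
      h '' Metric.closedBall 0 1 = Metric.closedBall 0 1 := by
  have hu : LipschitzWith ‖a‖₊ (fun x : ℂ => ((1 - ‖x‖ : ℝ) : ℂ) * a) := by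
    refine LipschitzWith.of_dist_le_mul fun x y => ?_
    rw [dist_eq_norm, dist_eq_norm, ← sub_mul, norm_mul, ← Complex.ofReal_sub, Complex.norm_real,
      mul_comm, coe_nnnorm]
    refine mul_le_mul_of_nonneg_left ?_ (norm_nonneg a)
    rw [Real.norm_eq_abs, show (1 - ‖x‖ - (1 - ‖y‖)) = ‖y‖ - ‖x‖ by ring, norm_sub_rev]
    exact abs_norm_sub_norm_le y x
  obtain ⟨h, hh⟩ := hu.exists_homeomorph_add (by exact_mod_cast ha)
  have hup : ∀ x, ‖h x‖ ≤ ‖x‖ + |1 - ‖x‖| * ‖a‖ := fun x => by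
    rw [hh]
    refine (norm_add_le _ _).trans ?_
    rw [norm_mul, Complex.norm_real, Real.norm_eq_abs]
  have hlow : ∀ x, ‖x‖ - |1 - ‖x‖| * ‖a‖ ≤ ‖h x‖ := fun x => by
    rw [hh]
    have := norm_sub_norm_le x (-(((1 - ‖x‖ : ℝ) : ℂ) * a))
    rw [norm_neg, norm_mul, Complex.norm_real, Real.norm_eq_abs, sub_neg_eq_add] at this
    exact this
  have hlt : ∀ x, ‖h x‖ < 1 ↔ ‖x‖ < 1 := fun x => by
    constructor
    · intro h1
      by_contra hx
      have h2 := hlow x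
      rw [abs_of_nonpos (by linarith)] at h2
      nlinarith [norm_nonneg a]
    · intro hx
      have h2 := hup x
      rw [abs_of_pos (by linarith)] at h2
      nlinarith [norm_nonneg a]
  have hle : ∀ x, ‖h x‖ ≤ 1 ↔ ‖x‖ ≤ 1 := fun x => by
    constructor
    · intro h1
      by_contra hx
      have h2 := hlow x
      rw [abs_of_nonpos (by linarith)] at h2
      nlinarith [norm_nonneg a]
    · intro hx
      have h2 := hup x
      rw [abs_of_nonneg (by linarith)] at h2
      nlinarith [norm_nonneg a]
  refine ⟨h, by simp [hh], ?_, ?_⟩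
  · ext y
    obtain ⟨x, rfl⟩ := h.surjective y
    rw [h.injective.mem_set_image]
    simpa using (hlt x).symm
  · ext y
    obtain ⟨x, rfl⟩ := h.surjective y
    rw [h.injective.mem_set_image]
    simpa using (hle x).symm

/-- In a coordinate with `p = 0`, the displacement `max 0 (1 - ‖x‖ / r) • c` has Lipschitz constant
`‖c‖ / r < 1`. Multiplying it by `t ∈ [0, 1]` gives the isotopy, which is the identity outside the
disc of radius `r` and so extends over `∞`. -/
theorem exists_isotopicToId_move (p : Sph) {D : Set Sph} (hD : D ∈ 𝓝 p) :
    ∃ W ∈ 𝓝 p, ∀ w ∈ W, ∃ τ : Sph ≃ₜ Sph, IsotopicToId τ ∧ τ p = w ∧ ∀ x ∉ D, τ x = x := by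
  obtain ⟨κ, rfl⟩ := exists_homeomorph_zero p
  have hD' : (fun z : ℂ => κ (z : Sph)) ⁻¹' D ∈ 𝓝 (0 : ℂ) :=
    (κ.continuous.comp OnePoint.continuous_coe).continuousAt hD
  obtain ⟨r, hr, hrD⟩ := Metric.nhds_basis_closedBall.mem_iff.1 hD'
  have hW : (fun z : ℂ => κ (z : Sph)) '' Metric.ball 0 r ∈ 𝓝 (κ ((0 : ℂ) : Sph)) :=
    (κ.isOpenMap.comp OnePoint.isOpenMap_coe).image_mem_nhds (Metric.ball_mem_nhds _ hr)
  refine ⟨_, hW, ?_⟩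
  rintro _ ⟨c, hc, rfl⟩
  rw [mem_ball_zero_iff] at hc
  set u : ℂ → ℂ := fun x => ((max 0 (1 - ‖x‖ / r) : ℝ) : ℂ) * c with hu
  have hlip : LipschitzWith (‖c‖₊ / r.toNNReal) u := by
    refine LipschitzWith.of_dist_le_mul fun x y => ?_
    rw [dist_eq_norm, dist_eq_norm, ← sub_mul, norm_mul, ← Complex.ofReal_sub, Complex.norm_real,
      NNReal.coe_div, coe_nnnorm, Real.coe_toNNReal _ hr.le, Real.norm_eq_abs, mul_comm, div_mul_eq_mul_div,
      mul_div_assoc]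
    refine mul_le_mul_of_nonneg_left ?_ (norm_nonneg c)
    rw [max_comm 0, max_comm 0]
    refine (abs_max_sub_max_le_abs (1 - ‖x‖ / r) (1 - ‖y‖ / r) 0).trans ?_
    rw [show (1 - ‖x‖ / r - (1 - ‖y‖ / r)) = (‖y‖ - ‖x‖) / r by ring, abs_div, abs_of_pos hr,
      norm_sub_rev]
    gcongr
    exact abs_norm_sub_norm_le y x
  have hlt : ‖c‖₊ / r.toNNReal < 1 := by
    rw [div_lt_one (by simpa using hr)]
    rw [← NNReal.coe_lt_coe, coe_nnnorm, Real.coe_toNNReal _ hr.le]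
    exact hc
  have hex : ∀ t : unitInterval, ∃ h : ℂ ≃ₜ ℂ, ∀ x, h x = x + ((t : ℝ) : ℂ) * u x := by
    intro t
    refine LipschitzWith.exists_homeomorph_add (c := ‖c‖₊ / r.toNNReal) hlt ?_
    refine LipschitzWith.of_dist_le_mul fun x y => ?_
    rw [dist_eq_norm, ← mul_sub, norm_mul, Complex.norm_real, Real.norm_eq_abs,
      abs_of_nonneg t.2.1, ← dist_eq_norm]
    calc (t : ℝ) * dist (u x) (u y) ≤ 1 * dist (u x) (u y) :=
          mul_le_mul_of_nonneg_right t.2.2 dist_nonneg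
      _ ≤ _ := by rw [one_mul]; exact hlip.dist_le_mul x y
  choose H hH using hex
  have hout : ∀ t z, r ≤ ‖z‖ → H t z = z := by
    intro t z hz
    have : max 0 (1 - ‖z‖ / r) = 0 := max_eq_left (by rw [sub_nonpos, one_le_div hr]; exact hz)
    rw [hH]
    simp only [hu, this, Complex.ofReal_zero, zero_mul, mul_zero, add_zero]
  have hucont : Continuous u := hlip.continuous
  have hcont : Continuous fun q : unitInterval × Sph => (H q.1).onePointCongr q.2 := by
    rw [continuous_iff_continuousAt]
    rintro ⟨t, x⟩
    induction x using OnePoint.rec with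
    | infty =>
      have hopen : IsOpen ((fun z : ℂ => (z : Sph)) '' Metric.closedBall 0 r)ᶜ := by
        have := ((isCompact_closedBall (0 : ℂ) r).image OnePoint.continuous_coe).isClosed
        exact this.isOpen_compl
      have hmem : {q : unitInterval × Sph |
          q.2 ∈ ((fun z : ℂ => (z : Sph)) '' Metric.closedBall 0 r)ᶜ} ∈
          𝓝 (t, (OnePoint.infty : Sph)) :=
        (hopen.preimage continuous_snd).mem_nhds (by simp)
      refine continuousAt_snd.congr ?_
      filter_upwards [hmem] with q hq
      obtain ⟨t', x⟩ := q
      induction x using OnePoint.rec with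
      | infty => rfl
      | coe z =>
        change ((z : ℂ) : Sph) = ((H t' z : ℂ) : Sph)
        rw [hout]
        by_contra hz
        push Not at hz
        exact hq ⟨z, by simpa using hz.le, rfl⟩
    | coe z =>
      have hoe : IsOpenEmbedding (Prod.map (id : unitInterval → unitInterval)
          (fun z : ℂ => (z : Sph))) := IsOpenEmbedding.id.prodMap OnePoint.isOpenEmbedding_coe
      have h1 : ContinuousAt ((fun q : unitInterval × Sph => (H q.1).onePointCongr q.2) ∘
          Prod.map (id : unitInterval → unitInterval) (fun z : ℂ => (z : Sph))) (t, z) := by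
        have h2 : Continuous fun q : unitInterval × ℂ =>
            ((q.2 + ((q.1 : ℝ) : ℂ) * u q.2 : ℂ) : Sph) :=
          OnePoint.continuous_coe.comp (by fun_prop)
        refine h2.continuousAt.congr (Filter.Eventually.of_forall fun q => ?_)
        change ((q.2 + ((q.1 : ℝ) : ℂ) * u q.2 : ℂ) : Sph) = ((H q.1 q.2 : ℂ) : Sph)
        rw [hH]
      exact hoe.continuousAt_iff.1 h1
  refine ⟨κ.symm.trans ((H 1).onePointCongr.trans κ),
    ⟨fun t => κ.symm.trans ((H t).onePointCongr.trans κ), ?_, ?_, rfl⟩, ?_, ?_⟩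
  · exact κ.continuous.comp (hcont.comp
      (continuous_fst.prodMk (κ.symm.continuous.comp continuous_snd)))
  · ext x
    have h0 : ∀ y : Sph, (H 0).onePointCongr y = y := by
      intro y
      induction y using OnePoint.rec with
      | infty => rfl
      | coe z =>
        change ((H 0 z : ℂ) : Sph) = _
        rw [hH]
        simp
    simp [h0]
  · change κ ((H 1).onePointCongr (κ.symm (κ ((0 : ℂ) : Sph)))) = _
    rw [Homeomorph.symm_apply_apply]
    congr 1
    change ((H 1 0 : ℂ) : Sph) = _
    rw [hH]
    simp [hu]
  · intro x hx
    obtain ⟨y, rfl⟩ := κ.surjective x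
    change κ ((H 1).onePointCongr (κ.symm (κ y))) = _
    rw [Homeomorph.symm_apply_apply]
    congr 1
    induction y using OnePoint.rec with
    | infty => rfl
    | coe z =>
      change ((H 1 z : ℂ) : Sph) = _
      rw [hout]
      by_contra hz
      push Not at hz
      exact hx (hrD (by simpa using hz.le))

/-! ### Disc domains and their preimages under squaring. -/

/-- The image of a component is connected and stays in one component of `F`, so the preimage of a
graph complement can be studied one face at a time. -/
theorem connectedComponentIn_preimage {X Y : Type*} [TopologicalSpace X] [TopologicalSpace Y]
    {f : X → Y} (hf : Continuous f) {F : Set Y} {x : X} (hx : f x ∈ F) :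
    connectedComponentIn (f ⁻¹' F) x =
      connectedComponentIn (f ⁻¹' connectedComponentIn F (f x)) x := by
  apply Subset.antisymm
  · refine isPreconnected_connectedComponentIn.subset_connectedComponentIn
      (mem_connectedComponentIn hx) fun y hy => ?_
    refine (isPreconnected_connectedComponentIn.image f hf.continuousOn).subset_connectedComponentIn
      (mem_image_of_mem f (mem_connectedComponentIn hx)) ?_ (mem_image_of_mem f hy)
    rintro _ ⟨z, hz, rfl⟩
    exact (connectedComponentIn_subset (f ⁻¹' F) x hz :)
  · exact connectedComponentIn_mono _ (preimage_mono (connectedComponentIn_subset _ _))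

theorem Homeomorph.preimage_connectedComponentIn {X Y : Type*} [TopologicalSpace X]
    [TopologicalSpace Y] (φ : X ≃ₜ Y) {F : Set Y} {x : X} (hx : φ x ∈ F) :
    φ ⁻¹' connectedComponentIn F (φ x) = connectedComponentIn (φ ⁻¹' F) x := by
  rw [connectedComponentIn_preimage φ.continuous hx]
  refine (IsPreconnected.connectedComponentIn ?_
    (show x ∈ φ ⁻¹' _ from mem_connectedComponentIn hx)).symm
  rw [← φ.image_symm]
  exact isPreconnected_connectedComponentIn.image _ φ.symm.continuous.continuousOn

namespace IsDiscDomain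

variable {U : Set Sph}

theorem of_param {f : ℂ → Sph} (hf : ContinuousOn f (Metric.closedBall 0 1))
    (hinj : InjOn f (Metric.closedBall 0 1)) : IsDiscDomain (f '' Metric.ball 0 1) := by
  refine ⟨f, hf, hinj, rfl, Subset.antisymm ?_ ?_⟩
  · rw [← closure_ball (0 : ℂ) one_ne_zero] at hf ⊢
    exact hf.image_closure
  · exact closure_minimal (image_mono Metric.ball_subset_closedBall)
      ((isCompact_closedBall (0 : ℂ) 1).image_of_continuousOn hf).isClosed

theorem image (h : IsDiscDomain U) (φ : Sph ≃ₜ Sph) : IsDiscDomain (φ '' U) := by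
  obtain ⟨f, hf, hinj, rfl, -⟩ := h
  rw [← image_comp]
  exact of_param (φ.continuous.comp_continuousOn hf)
    (φ.injective.comp_injOn hinj)

theorem exists_recentred (h : IsDiscDomain U) {p : Sph} (hp : p ∈ U) :
    ∃ f : ℂ → Sph, ContinuousOn f (Metric.closedBall 0 1) ∧ InjOn f (Metric.closedBall 0 1) ∧
      f '' Metric.ball 0 1 = U ∧ f '' Metric.closedBall 0 1 = closure U ∧ f 0 = p := by
  obtain ⟨f, hf, hinj, hU, hcl⟩ := h
  rw [← hU] at hp
  obtain ⟨a, ha, rfl⟩ := hp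
  obtain ⟨h, h0, hb, hc⟩ := exists_homeomorph_disc (by simpa using ha)
  have hmaps : MapsTo h (Metric.closedBall 0 1) (Metric.closedBall 0 1) := fun x hx =>
    hc ▸ mem_image_of_mem h hx
  refine ⟨f ∘ h, hf.comp h.continuous.continuousOn hmaps, hinj.comp h.injective.injOn hmaps,
    ?_, ?_, by simp [h0]⟩
  · rw [image_comp, hb, hU]
  · rw [image_comp, hc, hcl]

end IsDiscDomain

/-- On the compact `Q` the map `π` is closed, hence a quotient map onto its image. The larger set
`D` allows the formula for `F` off the fundamental domain `Q`. -/
theorem IsCompact.exists_descent {A B Y : Type*} [TopologicalSpace A] [TopologicalSpace B]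
    [TopologicalSpace Y] [T2Space B] [Nonempty A] {Q D : Set A} (hQ : IsCompact Q) (hQD : Q ⊆ D)
    {π : A → B} (hπ : ContinuousOn π Q) {s : A → Y} (hs : ContinuousOn s Q)
    (hfib : ∀ x ∈ D, ∀ y ∈ D, π x = π y → s x = s y) :
    ∃ F : B → Y, ContinuousOn F (π '' Q) ∧ ∀ x ∈ D, F (π x) = s x := by
  have hF : ∀ x ∈ D, s (Function.invFunOn π D (π x)) = s x := fun x hx =>
    hfib _ (Function.invFunOn_mem ⟨x, hx, rfl⟩) _ hx (Function.invFunOn_eq ⟨x, hx, rfl⟩)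
  refine ⟨fun b => s (Function.invFunOn π D b), ?_, hF⟩
  rw [continuousOn_iff_isClosed]
  intro C hC
  obtain ⟨u, hu, hu'⟩ := continuousOn_iff_isClosed.1 hs C hC
  refine ⟨π '' (u ∩ Q), ((hQ.inter_left hu).image_of_continuousOn
    (hπ.mono inter_subset_right)).isClosed, ?_⟩
  ext y
  constructor
  · rintro ⟨hy, x, hx, rfl⟩
    refine ⟨⟨x, ?_, rfl⟩, x, hx, rfl⟩
    rw [← hu']
    refine ⟨?_, hx⟩
    rw [mem_preimage, hF x (hQD hx)] at hy
    exact hy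
  · rintro ⟨⟨x, hx, rfl⟩, -⟩
    refine ⟨?_, x, hx.2, rfl⟩
    rw [← hu'] at hx
    rw [mem_preimage, hF x (hQD hx.2)]
    exact hx.1

/-- Along a circle `b(θ)²` around `0` a section would equal `b` or `-b` with a constant sign.
Replacing `θ = 0` by `θ = π` keeps `b²` and reverses `b`. -/
theorem not_exists_sqMap_section {U : Set Sph} (hU : U ∈ 𝓝 ((0 : ℂ) : Sph)) {χ : Sph → Sph}
    (hχ : ContinuousOn χ U) (hsq : ∀ x ∈ U, sqMap (χ x) = x) : False := by
  have hV : ((fun z : ℂ => (z : Sph)) ⁻¹' U) ∈ 𝓝 (0 : ℂ) :=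
    OnePoint.continuous_coe.continuousAt hU
  obtain ⟨r, hr, hrU⟩ := Metric.nhds_basis_closedBall.mem_iff.1 hV
  obtain ⟨ρ, hρ, hρr⟩ : ∃ ρ : ℝ, 0 < ρ ∧ ρ ^ 2 = r := ⟨√r, Real.sqrt_pos.2 hr, Real.sq_sqrt hr.le⟩
  set b : ℝ → ℂ := fun θ => ρ * Complex.exp (θ * Complex.I) with hb
  have hb0 : ∀ θ, b θ ≠ 0 := fun θ => mul_ne_zero (by exact_mod_cast hρ.ne') (Complex.exp_ne_zero _)
  have hbU : ∀ θ, (((b θ) ^ 2 : ℂ) : Sph) ∈ U := fun θ => hrU (by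
    simp only [hb, mem_closedBall_zero_iff, norm_pow, norm_mul, Complex.norm_real, Real.norm_eq_abs,
      Complex.norm_exp_ofReal_mul_I, mul_one, sq_abs, hρr]
    exact le_rfl)
  have hbc : Continuous b := by fun_prop
  have ha : Continuous fun θ => χ (((b θ) ^ 2 : ℂ) : Sph) :=
    hχ.comp_continuous (OnePoint.continuous_coe.comp (hbc.pow 2)) hbU
  have hbc' : Continuous fun θ => ((b θ : ℂ) : Sph) := OnePoint.continuous_coe.comp hbc
  have hsq' : ∀ θ, sqMap (χ (((b θ) ^ 2 : ℂ) : Sph)) = sqMap (b θ : Sph) := fun θ => by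
    rw [hsq _ (hbU θ), sqMap_coe]
  have hpi : b Real.pi = - b 0 := by simp [hb, Complex.exp_pi_mul_I]
  have hne : ∀ θ, ((b θ : ℂ) : Sph) ≠ ((0 : ℂ) : Sph) := fun θ h =>
    hb0 θ (OnePoint.coe_injective h)
  have hcon : ((-(b 0) : ℂ) : Sph) ≠ ((b 0 : ℂ) : Sph) := by
    intro h
    have := OnePoint.coe_injective h
    exact hb0 0 (by linear_combination -this / 2)
  rcases sqMap_eq_sqMap.1 (hsq' 0) with h | h
  · have := eqOn_of_sqMap_eqOn isPreconnected_univ ha.continuousOn hbc'.continuousOn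
      (fun θ _ => hsq' θ) (fun θ _ => ⟨hne θ, OnePoint.coe_ne_infty _⟩) (mem_univ 0) h
      (mem_univ Real.pi)
    simp only [hpi, neg_sq] at this
    exact hcon (this.symm.trans h)
  · have := eqOn_of_sqMap_eqOn isPreconnected_univ ha.continuousOn
      (negSph.continuous.comp hbc').continuousOn
      (fun θ _ => by rw [hsq' θ, Function.comp, sqMap_negSph])
      (fun θ _ => ⟨fun h => hne θ (by simpa using congrArg negSph h),
        fun h => OnePoint.coe_ne_infty (b θ) (by simpa using congrArg negSph h)⟩) (mem_univ 0) h
      (mem_univ Real.pi)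
    simp only [hpi, neg_sq, Function.comp] at this
    have h2 := h.symm.trans this
    simp only [negSph_coe, neg_neg] at h2
    exact hcon h2

/-- A continuous function of polar coordinates with the periodicity of `z = (r exp (iθ)) ^ k`
descends to a function of `z`. -/
theorem exists_polar_descent {Y : Type*} [TopologicalSpace Y] {k : ℕ} (hk : k ≠ 0)
    {s : ℝ × ℝ → Y} (hs : ContinuousOn s (Icc 0 1 ×ˢ univ)) {y₀ : Y} (h0 : ∀ θ, s (0, θ) = y₀)
    (hper : ∀ r ∈ Icc (0 : ℝ) 1, ∀ θ, s (r, θ + 2 * Real.pi / k) = s (r, θ)) :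
    ∃ F : ℂ → Y, ContinuousOn F (Metric.closedBall 0 1) ∧
      ∀ r ∈ Icc (0 : ℝ) 1, ∀ θ : ℝ, F (((r : ℂ) * Complex.exp (θ * Complex.I)) ^ k) = s (r, θ) := by
  have hk' : (k : ℝ) ≠ 0 := by exact_mod_cast hk
  set π : ℝ × ℝ → ℂ := fun q => ((q.1 : ℂ) * Complex.exp (q.2 * Complex.I)) ^ k with hπ
  have hπc : Continuous π := by fun_prop
  set Q : Set (ℝ × ℝ) := Icc 0 1 ×ˢ Icc 0 (2 * Real.pi) with hQ
  have hnorm : ∀ q : ℝ × ℝ, 0 ≤ q.1 → ‖π q‖ = q.1 ^ k := fun q hq => by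
    simp [hπ, Complex.norm_exp_ofReal_mul_I, abs_of_nonneg hq]
  obtain ⟨F, hF, hFs⟩ := (isCompact_Icc.prod isCompact_Icc : IsCompact Q).exists_descent
    (D := Icc 0 1 ×ˢ univ) (prod_mono_right (subset_univ _)) hπc.continuousOn
    (hs.mono (prod_mono_right (subset_univ _))) (by
      rintro ⟨r, θ⟩ hr ⟨r', θ'⟩ hr' he
      have hr := hr.1
      have hr' := hr'.1
      have hrr : r = r' := by
        have h1 := hnorm (r, θ) hr.1
        rw [he, hnorm (r', θ') hr'.1] at h1
        exact ((pow_left_inj₀ hr'.1 hr.1 hk).1 h1).symm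
      subst hrr
      rcases eq_or_lt_of_le hr.1 with h | h
      · have h : r = 0 := h.symm
        subst h
        rw [h0, h0]
      · simp only [hπ, mul_pow] at he
        have he' := mul_left_cancel₀ (pow_ne_zero k (by exact_mod_cast h.ne')) he
        rw [← Complex.exp_nat_mul, ← Complex.exp_nat_mul, Complex.exp_eq_exp_iff_exists_int] at he'
        obtain ⟨n, hn⟩ := he'
        have hn' : (θ : ℂ) = θ' + n * (2 * Real.pi / k) := by
          have hkc : (k : ℂ) ≠ 0 := by exact_mod_cast hk
          field_simp
          have := mul_right_cancel₀ Complex.I_ne_zero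
            (show ((k : ℂ) * θ) * Complex.I = (k * θ' + n * (2 * Real.pi)) * Complex.I by
              linear_combination hn)
          linear_combination this
        have hn'' : θ = θ' + n * (2 * Real.pi / k) := by exact_mod_cast hn'
        have hP : Function.Periodic (fun θ => s (r, θ)) (2 * Real.pi / k) := hper r hr
        rw [hn'']
        exact (hP.int_mul n) θ')
  have himg : π '' Q = Metric.closedBall 0 1 := by
    ext z
    rw [mem_closedBall_zero_iff]
    constructor
    · rintro ⟨q, hq, rfl⟩
      rw [hnorm q hq.1.1]
      exact pow_le_one₀ hq.1.1 hq.1.2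
    · intro hz
      obtain ⟨w, hw⟩ := IsAlgClosed.exists_pow_nat_eq z (Nat.pos_of_ne_zero hk)
      have hw1 : ‖w‖ ≤ 1 := by
        by_contra hcon
        push Not at hcon
        have := one_lt_pow₀ hcon hk
        rw [← norm_pow, hw] at this
        linarith
      refine ⟨(‖w‖, toIcoMod Real.two_pi_pos 0 (Complex.arg w)), ⟨⟨norm_nonneg _, hw1⟩, ?_⟩, ?_⟩
      · have := toIcoMod_mem_Ico Real.two_pi_pos 0 (Complex.arg w)
        rw [zero_add] at this
        exact Ico_subset_Icc_self this
      · have hexp : Complex.exp ((toIcoMod Real.two_pi_pos 0 (Complex.arg w) : ℝ) * Complex.I) =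
            Complex.exp (Complex.arg w * Complex.I) := by
          rw [Complex.exp_eq_exp_iff_exists_int]
          refine ⟨-toIcoDiv Real.two_pi_pos 0 (Complex.arg w), ?_⟩
          rw [toIcoMod]
          push_cast
          simp only [zsmul_eq_mul]
          ring
        simp only [hπ, hexp, Complex.norm_mul_exp_arg_mul_I, hw]
  rw [himg] at hF
  exact ⟨F, hF, fun r hr θ => hFs (r, θ) ⟨hr, mem_univ _⟩⟩

namespace IsDiscDomain

variable {U : Set Sph}

/-- At most one point of the parameter disc goes to a branch value, and it lies on the unit circle.
It is an extreme point of the round disc, so removing it leaves a convex set. Hence the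
parametrization lifts, and a lift parametrizes the component. -/
theorem sqMap_preimage_of_notMem (h : IsDiscDomain U) (h0 : ((0 : ℂ) : Sph) ∉ U)
    (hi : (OnePoint.infty : Sph) ∉ U)
    (hne : ¬ (((0 : ℂ) : Sph) ∈ closure U ∧ (OnePoint.infty : Sph) ∈ closure U))
    {y : Sph} (hy : sqMap y ∈ U) : IsDiscDomain (connectedComponentIn (sqMap ⁻¹' U) y) := by
  obtain ⟨f, hf, hinj, hU, hcl⟩ := h
  have hball : Metric.ball (0 : ℂ) 1 ⊆ Metric.closedBall 0 1 := Metric.ball_subset_closedBall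
  have hexc : ∀ ζ ∈ Metric.closedBall (0 : ℂ) 1, f ζ ∉ U →
      Convex ℝ (Metric.closedBall (0 : ℂ) 1 \ {ζ}) := by
    intro ζ hζ hζU
    have hζ' : ζ ∈ Metric.sphere (0 : ℂ) 1 := by
      rw [mem_sphere_zero_iff_norm]
      rw [mem_closedBall_zero_iff] at hζ
      refine le_antisymm hζ (not_lt.1 fun hlt => hζU ?_)
      rw [← hU]
      exact mem_image_of_mem f (by simpa using hlt)
    exact ((convex_closedBall (0 : ℂ) 1).mem_extremePoints_iff_convex_sdiff.1
      (StrictConvexSpace.sphere_subset_extremePoints_closedBall _ one_ne_zero hζ')).2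
  have hconv : Convex ℝ {x ∈ Metric.closedBall (0 : ℂ) 1 |
      f x ≠ ((0 : ℂ) : Sph) ∧ f x ≠ OnePoint.infty} := by
    by_cases hz : ∃ ζ ∈ Metric.closedBall (0 : ℂ) 1,
        f ζ = ((0 : ℂ) : Sph) ∨ f ζ = OnePoint.infty
    · obtain ⟨ζ, hζ, hfζ⟩ := hz
      have hζU : f ζ ∉ U := by
        rcases hfζ with h | h <;> rw [h] <;> assumption
      convert hexc ζ hζ hζU using 1
      ext x
      simp only [mem_sdiff, mem_singleton_iff]
      refine and_congr_right fun hx => ⟨?_, ?_⟩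
      · rintro ⟨h1, h2⟩ rfl
        exact hfζ.elim h1 h2
      · intro hxζ
        have hxcl : f x ∈ closure U := hcl ▸ mem_image_of_mem f hx
        have hζcl : f ζ ∈ closure U := hcl ▸ mem_image_of_mem f hζ
        constructor
        · intro h'
          rcases hfζ with h | h
          · exact hxζ (hinj hx hζ (h'.trans h.symm))
          · exact hne ⟨h' ▸ hxcl, h ▸ hζcl⟩
        · intro h'
          rcases hfζ with h | h
          · exact hne ⟨h ▸ hζcl, h' ▸ hxcl⟩
          · exact hxζ (hinj hx hζ (h'.trans h.symm))
    · push Not at hz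
      have hall : {x ∈ Metric.closedBall (0 : ℂ) 1 |
          f x ≠ ((0 : ℂ) : Sph) ∧ f x ≠ OnePoint.infty} = Metric.closedBall (0 : ℂ) 1 :=
        Subset.antisymm (fun x hx => hx.1) fun x hx => ⟨hx, hz x hx⟩
      rw [hall]
      exact convex_closedBall (0 : ℂ) 1
  obtain ⟨s, hs, hsf⟩ := Convex.exists_sqMap_lift hf hconv
  rw [← hU] at hy
  obtain ⟨z₀, hz₀, hz₀y⟩ := hy
  obtain ⟨s, hs, hsf, hsy⟩ : ∃ s : ℂ → Sph, ContinuousOn s (Metric.closedBall 0 1) ∧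
      (∀ x ∈ Metric.closedBall (0 : ℂ) 1, sqMap (s x) = f x) ∧ s z₀ = y := by
    rw [← hsf z₀ (hball hz₀)] at hz₀y
    rcases sqMap_eq_sqMap.1 hz₀y with h | h
    · exact ⟨s, hs, hsf, h⟩
    · refine ⟨fun x => negSph (s x), negSph.continuous.comp_continuousOn hs, fun x hx => ?_, ?_⟩
      · rw [sqMap_negSph, hsf x hx]
      · change negSph (s z₀) = y
        rw [h, negSph_negSph]
  have hsinj : InjOn s (Metric.closedBall 0 1) := fun x hx z hz hxz =>
    hinj hx hz (by rw [← hsf x hx, ← hsf z hz, hxz])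
  have hsU : s '' Metric.ball 0 1 ⊆ sqMap ⁻¹' U := by
    rintro _ ⟨x, hx, rfl⟩
    rw [mem_preimage, hsf x (hball hx), ← hU]
    exact mem_image_of_mem f hx
  have hsc : IsClosed (s '' Metric.closedBall 0 1) :=
    ((isCompact_closedBall (0 : ℂ) 1).image_of_continuousOn hs).isClosed
  have hback : ∀ x ∈ Metric.closedBall (0 : ℂ) 1, sqMap (s x) ∈ U → x ∈ Metric.ball (0 : ℂ) 1 := by
    intro x hx hxU
    rw [hsf x hx, ← hU] at hxU
    obtain ⟨x', hx', he⟩ := hxU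
    exact hinj (hball hx') hx he ▸ hx'
  have hcomp : connectedComponentIn (sqMap ⁻¹' U) y = s '' Metric.ball 0 1 := by
    apply Subset.antisymm
    · have hsub : connectedComponentIn (sqMap ⁻¹' U) y ⊆ s '' Metric.closedBall 0 1 := by
        refine isPreconnected_connectedComponentIn.subset_of_isClosed_of_nhdsWithin hsc
          ⟨y, mem_connectedComponentIn ?_, z₀, hball hz₀, hsy⟩ ?_
        · rw [← hsy]
          exact hsU (mem_image_of_mem s hz₀)
        · rintro p ⟨hpC, x, hx, rfl⟩
          have hpU := connectedComponentIn_subset _ _ hpC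
          have hclosed : IsClosed (negSph '' (s '' Metric.closedBall 0 1)) :=
            negSph.isClosedMap _ hsc
          -- The opposite sheet is closed and misses the points of this sheet lying over `U`, so
          -- near them the preimage of `U` consists of this sheet only.
          have hnot : s x ∉ negSph '' (s '' Metric.closedBall 0 1) := by
            rintro ⟨_, ⟨x', hx', rfl⟩, he⟩
            have h1 := congrArg sqMap he
            rw [sqMap_negSph, hsf x hx, hsf x' hx'] at h1
            have h2 := hinj hx' hx h1
            subst h2
            rw [mem_preimage] at hpU
            rcases negSph_eq_self.1 he with h' | h' <;> rw [h'] at hpU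
            · exact h0 (by simpa using hpU)
            · exact hi (by simpa using hpU)
          filter_upwards [self_mem_nhdsWithin,
            mem_nhdsWithin_of_mem_nhds (hclosed.isOpen_compl.mem_nhds hnot)] with q hqC hq
          have hqU := connectedComponentIn_subset _ _ hqC
          rw [mem_preimage, ← hU] at hqU
          obtain ⟨x', hx', he⟩ := hqU
          rw [← hsf x' (hball hx')] at he
          rcases sqMap_eq_sqMap.1 he with h' | h'
          · exact ⟨x', hball hx', h'⟩
          · exact (hq ⟨s x', ⟨x', hball hx', rfl⟩, by rw [h', negSph_negSph]⟩).elim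
      intro q hq
      obtain ⟨x, hx, rfl⟩ := hsub hq
      exact mem_image_of_mem s (hback x hx (connectedComponentIn_subset (sqMap ⁻¹' U) y hq :))
    · exact ((convex_ball (0 : ℂ) 1).isPreconnected.image s
        (hs.mono hball)).subset_connectedComponentIn ⟨z₀, hz₀, hsy⟩ hsU
  rw [hcomp]
  exact of_param hs hsinj

/-- With `f 0 = 0`, the map `f((r exp(iθ))²)` lifts over the polar strip. A shift of `θ` by `π`
changes the sign of the lift, so the lift descends to an odd injective `F` on the disc with `sqMap
(F w) = f (w²)`; it parametrizes the whole preimage of `U`. -/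
theorem sqMap_preimage_of_zero_mem (h : IsDiscDomain U) (hUo : IsOpen U)
    (h0 : ((0 : ℂ) : Sph) ∈ U) (hi : (OnePoint.infty : Sph) ∉ closure U) {y : Sph}
    (hy : sqMap y ∈ U) : IsDiscDomain (connectedComponentIn (sqMap ⁻¹' U) y) := by
  obtain ⟨f, hf, hinj, hU, hcl, hf0⟩ := h.exists_recentred h0
  have hball : Metric.ball (0 : ℂ) 1 ⊆ Metric.closedBall 0 1 := Metric.ball_subset_closedBall
  have hfi : ∀ z ∈ Metric.closedBall (0 : ℂ) 1, f z ≠ OnePoint.infty := fun z hz he =>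
    hi (he ▸ hcl ▸ mem_image_of_mem f hz)
  have hfz : ∀ z ∈ Metric.closedBall (0 : ℂ) 1, f z = ((0 : ℂ) : Sph) → z = 0 := fun z hz he =>
    hinj hz (by simp) (he.trans hf0.symm)
  set P : ℝ × ℝ → ℂ := fun q => (q.1 : ℂ) * Complex.exp (q.2 * Complex.I) with hP
  have hPc : Continuous P := by fun_prop
  have hPn : ∀ q : ℝ × ℝ, q.1 ∈ Icc (0 : ℝ) 1 → ‖P q‖ = q.1 := fun q hq => by
    simp [hP, Complex.norm_exp_ofReal_mul_I, abs_of_nonneg hq.1]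
  have hP2 : ∀ q ∈ (Icc 0 1 ×ˢ univ : Set (ℝ × ℝ)), P q ^ 2 ∈ Metric.closedBall (0 : ℂ) 1 := by
    rintro q hq
    rw [mem_closedBall_zero_iff, norm_pow, hPn q hq.1]
    exact pow_le_one₀ hq.1.1 hq.1.2
  have hgc : ContinuousOn (fun q => f (P q ^ 2)) (Icc 0 1 ×ˢ univ) :=
    hf.comp (hPc.pow 2).continuousOn hP2
  have hPne : ∀ q ∈ (Icc 0 1 ×ˢ univ : Set (ℝ × ℝ)),
      (f (P q ^ 2) ≠ ((0 : ℂ) : Sph) ∧ f (P q ^ 2) ≠ OnePoint.infty) ↔ 0 < q.1 := by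
    intro q hq
    refine ⟨fun h => lt_of_le_of_ne hq.1.1 fun h' => h.1 ?_, fun h => ⟨fun h' => ?_,
      hfi _ (hP2 q hq)⟩⟩
    · have : P q ^ 2 = 0 := by simp [hP, ← h']
      rw [this, hf0]
    · have h1 := hfz _ (hP2 q hq) h'
      have h2 : P q = 0 := by simpa using h1
      have h3 := hPn q hq.1
      rw [h2, norm_zero] at h3
      exact h.ne h3
  have hset : {q ∈ (Icc 0 1 ×ˢ univ : Set (ℝ × ℝ)) |
      f (P q ^ 2) ≠ ((0 : ℂ) : Sph) ∧ f (P q ^ 2) ≠ OnePoint.infty} = Ioc 0 1 ×ˢ univ := by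
    ext q
    constructor
    · rintro ⟨hq, hq'⟩
      exact ⟨⟨(hPne q hq).1 hq', hq.1.2⟩, mem_univ _⟩
    · rintro hq
      have hq2 : q ∈ (Icc 0 1 ×ˢ univ : Set (ℝ × ℝ)) := ⟨Ioc_subset_Icc_self hq.1, mem_univ _⟩
      exact ⟨hq2, (hPne q hq2).2 hq.1.1⟩
  have hconv : Convex ℝ (Ioc 0 1 ×ˢ univ : Set (ℝ × ℝ)) := (convex_Ioc 0 1).prod convex_univ
  obtain ⟨s, hs, hsf⟩ := Convex.exists_sqMap_lift hgc (hset ▸ hconv)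
  have hs0 : ∀ θ, s (0, θ) = ((0 : ℂ) : Sph) := fun θ => by
    have := hsf (0, θ) ⟨by simp, mem_univ _⟩
    have h' : P (0, θ) ^ 2 = 0 := by simp [hP]
    rw [h', hf0, sqMap_eq_zero] at this
    exact this
  have hIoc : (Ioc 0 1 ×ˢ univ : Set (ℝ × ℝ)) ⊆ Icc 0 1 ×ˢ univ :=
    prod_mono_left Ioc_subset_Icc_self
  have hshift : MapsTo (fun q : ℝ × ℝ => (q.1, q.2 + Real.pi)) (Ioc 0 1 ×ˢ univ)
      (Icc 0 1 ×ˢ univ) := fun q hq => ⟨Ioc_subset_Icc_self hq.1, mem_univ _⟩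
  have hPshift : ∀ q : ℝ × ℝ, P (q.1, q.2 + Real.pi) = - P q := fun q => by
    simp [hP, add_mul, Complex.exp_add, Complex.exp_pi_mul_I]
  have hs1 : ContinuousOn (fun q : ℝ × ℝ => s (q.1, q.2 + Real.pi)) (Ioc 0 1 ×ˢ univ) :=
    hs.comp (by fun_prop) hshift
  have hsne : ∀ q ∈ (Ioc 0 1 ×ˢ univ : Set (ℝ × ℝ)),
      s q ≠ ((0 : ℂ) : Sph) ∧ s q ≠ OnePoint.infty := by
    intro q hq
    have h1 := (hPne q (hIoc hq)).2 hq.1.1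
    rw [← hsf q (hIoc hq)] at h1
    exact ⟨fun h => h1.1 (by simp [h]), fun h => h1.2 (by simp [h])⟩
  have hsqs : ∀ q ∈ (Ioc 0 1 ×ˢ univ : Set (ℝ × ℝ)),
      sqMap (s (q.1, q.2 + Real.pi)) = sqMap (s q) := by
    intro q hq
    rw [hsf _ (hshift hq), hsf q (hIoc hq), hPshift, neg_sq]
  have hbase : ((1 : ℝ), (0 : ℝ)) ∈ (Ioc 0 1 ×ˢ univ : Set (ℝ × ℝ)) := by simp
  have hanti : ∀ r ∈ Icc (0 : ℝ) 1, ∀ θ, s (r, θ + Real.pi) = negSph (s (r, θ)) := by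
    rcases sqMap_eq_sqMap.1 (hsqs _ hbase) with h | h
    · exfalso
      have heq := eqOn_of_sqMap_eqOn hconv.isPreconnected hs1 (hs.mono hIoc) hsqs hsne hbase h
      -- A lift unchanged by `θ ↦ θ + π` would be a function of `z = (r exp(iθ))²`, and `σ ∘ f⁻¹`
      -- would be a section of squaring near `0`.
      obtain ⟨σ, hσ, hσs⟩ := exists_polar_descent two_ne_zero hs hs0 (by
        intro r hr θ
        rcases eq_or_lt_of_le hr.1 with h' | h'
        · subst h'; rw [hs0, hs0]
        · have := heq (x := (r, θ)) ⟨⟨h', hr.2⟩, mem_univ _⟩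
          simpa using this)
      obtain ⟨g, hg, hgf⟩ := (isCompact_closedBall (0 : ℂ) 1).exists_leftInverse_continuousOn hf hinj
      have hσf : ∀ z ∈ Metric.closedBall (0 : ℂ) 1, sqMap (σ z) = f z := by
        intro z hz
        obtain ⟨w, hw⟩ := IsAlgClosed.exists_pow_nat_eq z two_pos
        have hw1 : ‖w‖ ∈ Icc (0 : ℝ) 1 := by
          refine ⟨norm_nonneg _, ?_⟩
          rw [mem_closedBall_zero_iff, ← hw, norm_pow] at hz
          exact (pow_le_one_iff_of_nonneg (norm_nonneg _) two_ne_zero).1 hz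
        have h1 := hσs ‖w‖ hw1 (Complex.arg w)
        have h2 := hsf (‖w‖, Complex.arg w) ⟨hw1, mem_univ _⟩
        simp only [hP] at h2
        rw [← h1, Complex.norm_mul_exp_arg_mul_I, hw] at h2
        exact h2
      have hgmaps : MapsTo g (closure U) (Metric.closedBall 0 1) := by
        intro x hx
        rw [← hcl] at hx
        obtain ⟨z, hz, rfl⟩ := hx
        rwa [hgf z hz]
      rw [hcl] at hg
      refine not_exists_sqMap_section (Filter.mem_of_superset (hUo.mem_nhds h0) subset_closure)
        (hσ.comp hg hgmaps) fun x hx => ?_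
      rw [Function.comp, hσf _ (hgmaps hx)]
      rw [← hcl] at hx
      obtain ⟨z, hz, rfl⟩ := hx
      rw [hgf z hz]
    · have heq := eqOn_of_sqMap_eqOn hconv.isPreconnected hs1
        (negSph.continuous.comp_continuousOn (hs.mono hIoc))
        (fun q hq => by rw [hsqs q hq, Function.comp, sqMap_negSph])
        (fun q hq => ⟨fun h => (hsne q hq).1 (by simpa using congrArg negSph h),
          fun h => (hsne q hq).2 (by simpa using congrArg negSph h)⟩) hbase h
      intro r hr θ
      rcases eq_or_lt_of_le hr.1 with h' | h'
      · subst h'; rw [hs0, hs0]; simp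
      · exact heq (x := (r, θ)) ⟨⟨h', hr.2⟩, mem_univ _⟩
  obtain ⟨F, hF, hFs⟩ := exists_polar_descent one_ne_zero hs hs0 (by
    intro r hr θ
    have : θ + 2 * Real.pi / (1 : ℕ) = (θ + Real.pi) + Real.pi := by push_cast; ring
    rw [this, hanti r hr, hanti r hr, negSph_negSph])
  simp only [pow_one] at hFs
  have hFw : ∀ w ∈ Metric.closedBall (0 : ℂ) 1, F w = s (‖w‖, Complex.arg w) := by
    intro w hw
    rw [mem_closedBall_zero_iff] at hw
    have := hFs ‖w‖ ⟨norm_nonneg _, hw⟩ (Complex.arg w)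
    rwa [Complex.norm_mul_exp_arg_mul_I] at this
  have hFneg : ∀ w ∈ Metric.closedBall (0 : ℂ) 1, F (-w) = negSph (F w) := by
    intro w hw
    rw [hFw w hw]
    rw [mem_closedBall_zero_iff] at hw
    rw [← hanti ‖w‖ ⟨norm_nonneg _, hw⟩, ← hFs ‖w‖ ⟨norm_nonneg _, hw⟩]
    congr 1
    have := hPshift (‖w‖, Complex.arg w)
    simp only [hP, Complex.norm_mul_exp_arg_mul_I] at this
    exact this.symm
  have hFsq : ∀ w ∈ Metric.closedBall (0 : ℂ) 1, sqMap (F w) = f (w ^ 2) := by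
    intro w hw
    rw [hFw w hw]
    rw [mem_closedBall_zero_iff] at hw
    rw [hsf _ ⟨⟨norm_nonneg _, hw⟩, mem_univ _⟩]
    simp only [hP, Complex.norm_mul_exp_arg_mul_I]
  have hsqball : ∀ w ∈ Metric.closedBall (0 : ℂ) 1, w ^ 2 ∈ Metric.closedBall (0 : ℂ) 1 := by
    intro w hw
    rw [mem_closedBall_zero_iff] at hw ⊢
    rw [norm_pow]
    exact pow_le_one₀ (norm_nonneg _) hw
  have hFinj : InjOn F (Metric.closedBall 0 1) := by
    intro w hw w' hw' he
    have h1 := congrArg sqMap he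
    rw [hFsq w hw, hFsq w' hw'] at h1
    have h2 := hinj (hsqball w hw) (hsqball w' hw') h1
    rcases sq_eq_sq_iff_eq_or_eq_neg.1 h2 with h3 | h3
    · exact h3
    · subst h3
      rw [hFneg w' hw'] at he
      have h4 : f (w' ^ 2) = ((0 : ℂ) : Sph) := by
        rw [← hFsq w' hw']
        rcases negSph_eq_self.1 he with h' | h'
        · simp [h']
        · exfalso
          refine hfi _ (hsqball w' hw') ?_
          rw [← hFsq w' hw', h']
          rfl
      have h5 : w' = 0 := by simpa using hfz _ (hsqball w' hw') h4
      simp [h5]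
  have hFU : F '' Metric.ball 0 1 = sqMap ⁻¹' U := by
    ext x
    constructor
    · rintro ⟨w, hw, rfl⟩
      rw [mem_preimage, hFsq w (hball hw), ← hU]
      refine mem_image_of_mem f ?_
      rw [mem_ball_zero_iff] at hw ⊢
      rw [norm_pow]
      exact pow_lt_one₀ (norm_nonneg _) hw two_ne_zero
    · intro hx
      rw [mem_preimage, ← hU] at hx
      obtain ⟨z, hz, hzx⟩ := hx
      obtain ⟨w, rfl⟩ := IsAlgClosed.exists_pow_nat_eq z two_pos
      have hw : w ∈ Metric.ball (0 : ℂ) 1 := by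
        rw [mem_ball_zero_iff] at hz ⊢
        rw [norm_pow] at hz
        exact (pow_lt_one_iff_of_nonneg (norm_nonneg _) two_ne_zero).1 hz
      rw [← hFsq w (hball hw)] at hzx
      rcases sqMap_eq_sqMap.1 hzx with h | h
      · exact ⟨w, hw, h⟩
      · refine ⟨-w, by simpa using hw, ?_⟩
        rw [hFneg w (hball hw), h, negSph_negSph]
  have hpre : IsPreconnected (sqMap ⁻¹' U) := by
    rw [← hFU]
    exact (convex_ball (0 : ℂ) 1).isPreconnected.image F (hF.mono hball)
  rw [hpre.connectedComponentIn hy, ← hFU]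
  exact of_param hF hFinj

theorem sqMap_preimage (h : IsDiscDomain U) (hUo : IsOpen U)
    (hne : ¬ (((0 : ℂ) : Sph) ∈ closure U ∧ (OnePoint.infty : Sph) ∈ closure U))
    {y : Sph} (hy : sqMap y ∈ U) : IsDiscDomain (connectedComponentIn (sqMap ⁻¹' U) y) := by
  by_cases h0 : ((0 : ℂ) : Sph) ∈ U
  · exact h.sqMap_preimage_of_zero_mem hUo h0 (fun hi => hne ⟨subset_closure h0, hi⟩) hy
  by_cases hi : (OnePoint.infty : Sph) ∈ U
  -- Inversion commutes with squaring and exchanges the branch values, which reduces this case to a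
  -- disc containing `0`.
  · have hpre : sqMap ⁻¹' (invSph '' U) = invSph ⁻¹' (sqMap ⁻¹' U) := by
      ext x
      simp only [mem_preimage, sqMap_invSph]
      constructor
      · rintro ⟨z, hz, hzx⟩
        rw [← hzx, invSph_invSph]
        exact hz
      · intro hx
        exact ⟨_, hx, invSph_invSph _⟩
    have hy' : invSph (invSph y) ∈ sqMap ⁻¹' U := by rwa [invSph_invSph]
    have h1 := (h.image invSph).sqMap_preimage_of_zero_mem (invSph.isOpenMap _ hUo)
      ⟨_, hi, invSph_infty⟩ (by
        rw [← invSph.image_closure]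
        rintro ⟨z, hz, hzi⟩
        have : z = ((0 : ℂ) : Sph) := by rw [← invSph_invSph z, hzi, invSph_infty]
        exact hne ⟨this ▸ hz, subset_closure hi⟩) (y := invSph y) (by
        rw [← mem_preimage, hpre]
        exact hy')
    rw [hpre, ← invSph.preimage_connectedComponentIn hy', invSph_invSph] at h1
    have h2 := h1.image invSph
    rwa [image_preimage_eq _ invSph.surjective] at h2
  · exact h.sqMap_preimage_of_notMem h0 hi hne hy

end IsDiscDomain

/-! ### How faces meet the edges of a graph. -/

theorem closure_connectedComponentIn_inter {X : Type*} [TopologicalSpace X] {F : Set X} {x : X} :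
    closure (connectedComponentIn F x) ∩ F ⊆ connectedComponentIn F x := by
  rintro y ⟨hy, hyF⟩
  by_cases hx : x ∈ F
  · have hpre : IsPreconnected (insert y (connectedComponentIn F x)) :=
      isPreconnected_connectedComponentIn.subset_closure (subset_insert _ _)
        (insert_subset hy subset_closure)
    exact hpre.subset_connectedComponentIn (Or.inr (mem_connectedComponentIn hx))
      (insert_subset hyF (connectedComponentIn_subset _ _)) (mem_insert _ _)
  · rw [connectedComponentIn_eq_empty hx, closure_empty] at hy
    exact hy.elim

/-- A half-disc neighbourhood of a boundary point of a disc domain, and the boundary arc on it. -/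
theorem IsDiscDomain.exists_half_disc {F : Set Sph} (hF : IsDiscDomain F) {p : Sph}
    (hp : p ∈ closure F) (hpF : p ∉ F) {N : Set Sph} (hN : N ∈ 𝓝 p) :
    ∃ S ⊆ F ∩ N, IsPreconnected S ∧ S ∈ 𝓝[F] p ∧ ∃ (δ : ℝ → Sph) (ε : ℝ), 0 < ε ∧
      ContinuousOn δ (Ioo (-ε) ε) ∧ InjOn δ (Ioo (-ε) ε) ∧ δ 0 = p ∧
      ∀ θ ∈ Ioo (-ε) ε, δ θ ∈ closure S \ F := by
  obtain ⟨f, hf, hinj, hU, hcl⟩ := hF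
  have hball : Metric.ball (0 : ℂ) 1 ⊆ Metric.closedBall 0 1 := Metric.ball_subset_closedBall
  have hp' := hp
  rw [← hcl] at hp'
  obtain ⟨ζ, hζ, rfl⟩ := hp'
  have hζn : ‖ζ‖ = 1 := by
    rw [mem_closedBall_zero_iff] at hζ
    refine le_antisymm hζ (not_lt.1 fun hlt => hpF ?_)
    rw [← hU]
    exact mem_image_of_mem f (by simpa using hlt)
  obtain ⟨ε, hε, hεN⟩ := Metric.mem_nhdsWithin_iff.1 (hf ζ hζ hN)
  obtain ⟨g, hg, hgf⟩ := (isCompact_closedBall (0 : ℂ) 1).exists_leftInverse_continuousOn hf hinj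
  rw [hcl] at hg
  -- The half-disc is an intersection of two round discs, hence convex, and its closure contains the
  -- arc of the unit circle near `ζ`.
  set H : Set ℂ := Metric.ball ζ ε ∩ Metric.ball 0 1 with hH
  have hHc : Convex ℝ H := (convex_ball _ _).inter (convex_ball _ _)
  have hHsub : H ⊆ Metric.closedBall 0 1 := inter_subset_right.trans hball
  have hclH : Metric.ball ζ ε ∩ Metric.closedBall 0 1 ⊆ closure H := by
    rw [← closure_ball (0 : ℂ) one_ne_zero]
    exact Metric.isOpen_ball.inter_closure
  have hfcl : ∀ z ∈ Metric.ball ζ ε ∩ Metric.closedBall 0 1, f z ∈ closure (f '' H) := by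
    intro z hz
    have hcH : closure H ⊆ Metric.closedBall 0 1 :=
      closure_minimal hHsub Metric.isClosed_closedBall
    exact (hf.mono hcH).image_closure (mem_image_of_mem f (hclH hz))
  have hc : Continuous fun θ : ℝ => ζ * Complex.exp (θ * Complex.I) := by fun_prop
  have hc0 : ζ * Complex.exp (((0 : ℝ) : ℂ) * Complex.I) = ζ := by simp
  have hnb : (fun θ : ℝ => ζ * Complex.exp (θ * Complex.I)) ⁻¹' Metric.ball ζ ε ∈ 𝓝 (0 : ℝ) :=
    hc.continuousAt.preimage_mem_nhds (by rw [hc0]; exact Metric.ball_mem_nhds _ hε)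
  obtain ⟨η, hη, hηε⟩ := Metric.mem_nhds_iff.1 hnb
  have hcn : ∀ θ : ℝ, ζ * Complex.exp (θ * Complex.I) ∈ Metric.closedBall (0 : ℂ) 1 := fun θ => by
    simp [Complex.norm_exp_ofReal_mul_I, hζn]
  have hIoo : ∀ θ ∈ Ioo (-(min η Real.pi)) (min η Real.pi),
      ζ * Complex.exp (θ * Complex.I) ∈ Metric.ball ζ ε := fun θ hθ => by
    have h1 : |θ| < η := abs_lt.2 ⟨by linarith [hθ.1, min_le_left η Real.pi],
      hθ.2.trans_le (min_le_left _ _)⟩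
    exact hηε (by simpa using h1)
  -- The bound `η` on the angle keeps the arc inside the ball at `ζ`, and the bound `π` makes `exp
  -- (iθ)` injective.
  refine ⟨f '' H, ?_, hHc.isPreconnected.image f (hf.mono hHsub), ?_,
    fun θ => f (ζ * Complex.exp (θ * Complex.I)), min η Real.pi, lt_min hη Real.pi_pos, ?_, ?_, ?_,
    ?_⟩
  · rintro _ ⟨z, hz, rfl⟩
    exact ⟨hU ▸ mem_image_of_mem f hz.2, hεN ⟨hz.1, hHsub hz⟩⟩
  · have hgp : g ⁻¹' Metric.ball ζ ε ∈ 𝓝[closure F] (f ζ) :=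
      hg (f ζ) hp (by rw [hgf ζ hζ]; exact Metric.ball_mem_nhds _ hε)
    filter_upwards [nhdsWithin_mono _ subset_closure hgp, self_mem_nhdsWithin] with y hy hyF
    rw [← hU] at hyF
    obtain ⟨z, hz, rfl⟩ := hyF
    rw [mem_preimage, hgf z (hball hz)] at hy
    exact ⟨z, ⟨hy, hz⟩, rfl⟩
  · exact (hf.comp_continuous hc hcn).continuousOn
  · intro θ hθ θ' hθ' he
    have h1 := hinj (hcn θ) (hcn θ') he
    have hζ0 : ζ ≠ 0 := by rintro rfl; simp at hζn
    have h2 := mul_left_cancel₀ hζ0 h1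
    have him : ∀ t : ℝ, ((t : ℂ) * Complex.I).im = t := fun t => by simp
    have hlo : ∀ t ∈ Ioo (-(min η Real.pi)) (min η Real.pi), -Real.pi < t ∧ t ≤ Real.pi :=
      fun t ht => ⟨by linarith [ht.1, min_le_right η Real.pi],
        (ht.2.trans_le (min_le_right _ _)).le⟩
    have h3 := Complex.exp_inj_of_neg_pi_lt_of_le_pi (by rw [him]; exact (hlo θ hθ).1)
      (by rw [him]; exact (hlo θ hθ).2) (by rw [him]; exact (hlo θ' hθ').1)
      (by rw [him]; exact (hlo θ' hθ').2) h2
    have h4 := congrArg Complex.im h3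
    rwa [him, him] at h4
  · simp
  · intro θ hθ
    refine ⟨hfcl _ ⟨hIoo θ hθ, hcn θ⟩, ?_⟩
    rw [← hU]
    rintro ⟨z, hz, he⟩
    have h1 := hinj (hball hz) (hcn θ) he
    rw [h1] at hz
    simp [Complex.norm_exp_ofReal_mul_I, hζn] at hz

/-- All complementary components of `G` are disc domains. -/
def HasDiscFaces (G : Set Sph) : Prop :=
  ∀ x, x ∉ G → IsDiscDomain (connectedComponentIn Gᶜ x)

/-- A half-disc at `p` inside `W ∩ N` is connected, misses `G` and has `p` in its closure, so any of
its points can serve as `w`. -/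
theorem HasDiscFaces.exists_mem_closure_component {G : Set Sph} (hf : HasDiscFaces G) {p w₀ : Sph}
    (hp : p ∈ G) (hw₀ : w₀ ∉ G) (hpw : p ∈ closure (connectedComponentIn Gᶜ w₀))
    {N W : Set Sph} (hN : N ∈ 𝓝 p) (hW : W ∈ 𝓝 p) :
    ∃ w ∈ W ∩ N, w ∉ G ∧ p ∈ closure (connectedComponentIn (N \ G) w) := by
  have hpF : p ∉ connectedComponentIn Gᶜ w₀ := fun h => connectedComponentIn_subset _ _ h hp
  obtain ⟨S, hS, hSp, -, δ, ε, hε, -, -, hδ0, hδ⟩ :=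
    (hf w₀ hw₀).exists_half_disc hpw hpF (Filter.inter_mem hW hN)
  have hpS : p ∈ closure S := hδ0 ▸ (hδ 0 ⟨by linarith, hε⟩).1
  obtain ⟨w, hw⟩ : S.Nonempty := closure_nonempty_iff.1 ⟨p, hpS⟩
  have hSG : S ⊆ N \ G := fun x hx => ⟨(hS hx).2.2, connectedComponentIn_subset _ _ (hS hx).1⟩
  exact ⟨w, (hS hw).2, (hSG hw).2, closure_mono (hSp.subset_connectedComponentIn hw hSG) hpS⟩

theorem exists_mem_closure_component_of_isPreconnected {G O : Set Sph} (hG : IsClosed G)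
    (hO : IsOpen O) (hOc : IsPreconnected O) {p x : Sph} (hp : p ∈ O ∩ G) (hx : x ∈ O \ G) :
    ∃ q ∈ O ∩ G, q ∈ closure (connectedComponentIn (O \ G) x) := by
  by_contra! hcon
  refine hcon p hp (hOc.subset_of_isClosed_of_nhdsWithin isClosed_closure
    ⟨x, hx.1, subset_closure (mem_connectedComponentIn hx)⟩ ?_ hp.1)
  rintro q ⟨hqO, hq⟩
  have hqG : q ∉ G := fun h => hcon q ⟨hqO, h⟩ hq
  have hmem := closure_connectedComponentIn_inter ⟨hq, ⟨hqO, hqG⟩⟩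
  exact mem_nhdsWithin_of_mem_nhds (Filter.mem_of_superset
    (((hO.sdiff hG).connectedComponentIn).mem_nhds hmem) subset_closure)

namespace IsFiniteGraph

variable {G X : Set Sph}

/-- A complementary component near an open edge which touches the edge has the whole edge in its
closure. -/
theorem edge_subset_closure (hG : IsFiniteGraph G X) (hf : HasDiscFaces G) {N : Set Sph}
    (hN : IsOpen N) {w v : Sph} (hw : w ∈ N \ G) (hv : v ∈ G \ X)
    (hvw : v ∈ closure (connectedComponentIn (N \ G) w))
    (hC : connectedComponentIn (G \ X) v ⊆ N) :
    connectedComponentIn (G \ X) v ⊆ closure (connectedComponentIn (N \ G) w) := by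
  refine isPreconnected_connectedComponentIn.subset_of_isClosed_of_nhdsWithin isClosed_closure
    ⟨v, mem_connectedComponentIn hv, hvw⟩ ?_
  rintro p ⟨hpC, hpY⟩
  have hpGX := connectedComponentIn_subset _ _ hpC
  have hYF : connectedComponentIn (N \ G) w ⊆ connectedComponentIn Gᶜ w :=
    connectedComponentIn_mono _ fun x hx => hx.2
  have hpF : p ∉ connectedComponentIn Gᶜ w := fun h => connectedComponentIn_subset _ _ h hpGX.1
  obtain ⟨S, hS, hSp, hSn, δ, ε, hε, hδc, hδi, hδ0, hδ⟩ :=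
    (hf w hw.2).exists_half_disc (closure_mono hYF hpY) hpF (hN.mem_nhds (hC hpC))
  have hSG : S ⊆ N \ G := fun x hx => ⟨(hS hx).2, connectedComponentIn_subset _ _ (hS hx).1⟩
  obtain ⟨y, hyS, hyY⟩ : (S ∩ connectedComponentIn (N \ G) w).Nonempty := by
    rw [mem_closure_iff_nhdsWithin_neBot] at hpY
    exact Filter.nonempty_of_mem (Filter.inter_mem (nhdsWithin_mono _ hYF hSn) self_mem_nhdsWithin)
  -- The half-disc is connected and meets the component, so it lies inside. Its boundary arc lies in
  -- `G` and fills a neighbourhood of `p` in `G`; the contact set is therefore open in the edge.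
  have hSY : S ⊆ connectedComponentIn (N \ G) w := by
    rw [connectedComponentIn_eq hyY]
    exact hSp.subset_connectedComponentIn hyS hSG
  have hmem := hG.image_Ioo_mem_nhdsWithin hpGX hε hδc hδi (fun θ hθ => by
    by_contra hcon
    refine (hδ θ hθ).2 (closure_connectedComponentIn_inter ⟨?_, hcon⟩)
    exact closure_mono (hS.trans inter_subset_left) (hδ θ hθ).1) hδ0
  have hCG : connectedComponentIn (G \ X) v ⊆ G :=
    (connectedComponentIn_subset _ _).trans sdiff_subset
  refine Filter.mem_of_superset (nhdsWithin_mono _ hCG hmem) ?_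
  rintro _ ⟨θ, hθ, rfl⟩
  exact closure_mono hSY (hδ θ hθ).1

/-- A small connected neighbourhood of `p` meets `G` only in this edge, and contains points off `G`
since `G` has empty interior. The component of such a point touches the edge, and
`edge_subset_closure` gives the rest of it. -/
theorem exists_adjacent_face_of_notMem (hG : IsFiniteGraph G X) (hf : HasDiscFaces G) {p : Sph}
    (hp : p ∈ G \ X) :
    ∃ w ∉ G, connectedComponentIn (G \ X) p ⊆ closure (connectedComponentIn Gᶜ w) := by
  have hnb : {x | x ∈ G → x ∈ connectedComponentIn (G \ X) p} ∈ 𝓝 p := by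
    have h1 := mem_nhdsWithin_iff_eventually.1 (hG.connectedComponentIn_mem_nhdsWithin hp)
    filter_upwards [h1, hG.1.isClosed.isOpen_compl.mem_nhds hp.2] with x hx hxX hxG
    exact hx ⟨hxG, hxX⟩
  obtain ⟨O, hOs, hO, hpO, hOc⟩ := locallyConnectedSpace_iff_subsets_isOpen_isConnected.1
    (inferInstance : LocallyConnectedSpace Sph) p _ hnb
  obtain ⟨x, hxO, hxG⟩ : (O \ G).Nonempty := by
    by_contra hcon
    rw [not_nonempty_iff_eq_empty, sdiff_eq_empty] at hcon
    have := hG.interior_eq_empty ▸ (interior_maximal hcon hO hpO)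
    exact this
  obtain ⟨q, hq, hqY⟩ := exists_mem_closure_component_of_isPreconnected hG.isClosed hO
    hOc.isPreconnected ⟨hpO, hp.1⟩ ⟨hxO, hxG⟩
  have hqC := hOs hq.1 hq.2
  refine ⟨x, hxG, ?_⟩
  rw [connectedComponentIn_eq hqC]
  have h2 := hG.edge_subset_closure hf isOpen_univ (w := x) (v := q) ⟨mem_univ _, hxG⟩
    (connectedComponentIn_subset _ _ hqC)
    (closure_mono (connectedComponentIn_mono _ (sdiff_subset_sdiff_left (subset_univ _))) hqY)
    (subset_univ _)
  rwa [← compl_eq_univ_sdiff] at h2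

theorem exists_adjacent_face (hG : IsFiniteGraph G X) (hf : HasDiscFaces G) {p : Sph}
    (hp : p ∈ G) : ∃ w ∉ G, p ∈ closure (connectedComponentIn Gᶜ w) := by
  by_cases hpX : p ∈ X
  · by_cases hq : ∃ q ∈ G \ X, p ∈ closure (connectedComponentIn (G \ X) q)
    · obtain ⟨q, hq, hpq⟩ := hq
      obtain ⟨w, hw, hsub⟩ := hG.exists_adjacent_face_of_notMem hf hq
      exact ⟨w, hw, closure_minimal hsub isClosed_closure hpq⟩
    -- Here `p` is an isolated vertex: the other vertices and all closed edges form a closed set `Z`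
    -- missing `p`.
    · push Not at hq
      have hZ : IsClosed ((X \ {p}) ∪ ⋃ C ∈ connectedComponentIn (G \ X) '' (G \ X), closure C) :=
        (hG.1.subset sdiff_subset).isClosed.union
          (hG.finite_components.isClosed_biUnion fun C _ => isClosed_closure)
      have hpZ : p ∉ (X \ {p}) ∪ ⋃ C ∈ connectedComponentIn (G \ X) '' (G \ X), closure C := by
        rintro (h | h)
        · exact h.2 rfl
        · simp only [mem_iUnion, exists_prop] at h
          obtain ⟨_, ⟨q, hqG, rfl⟩, hpq⟩ := h
          exact hq q hqG hpq
      obtain ⟨O, hOs, hO, hpO, hOc⟩ := locallyConnectedSpace_iff_subsets_isOpen_isConnected.1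
        (inferInstance : LocallyConnectedSpace Sph) p _ (hZ.isOpen_compl.mem_nhds hpZ)
      obtain ⟨x, hxO, hxG⟩ : (O \ G).Nonempty := by
        by_contra hcon
        rw [not_nonempty_iff_eq_empty, sdiff_eq_empty] at hcon
        have := hG.interior_eq_empty ▸ (interior_maximal hcon hO hpO)
        exact this
      obtain ⟨q, hq, hqY⟩ := exists_mem_closure_component_of_isPreconnected hG.isClosed hO
        hOc.isPreconnected ⟨hpO, hp⟩ ⟨hxO, hxG⟩
      have hqp : q = p := by
        by_contra hne
        refine hOs hq.1 ?_
        by_cases hqX : q ∈ X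
        · exact Or.inl ⟨hqX, hne⟩
        · refine Or.inr (mem_biUnion (mem_image_of_mem _ ⟨hq.2, hqX⟩) ?_)
          exact subset_closure (mem_connectedComponentIn ⟨hq.2, hqX⟩)
      refine ⟨x, hxG, closure_mono (connectedComponentIn_mono _ fun y hy => hy.2) (hqp ▸ hqY)⟩
  · obtain ⟨w, hw, hsub⟩ := hG.exists_adjacent_face_of_notMem hf ⟨hp, hpX⟩
    exact ⟨w, hw, hsub (mem_connectedComponentIn ⟨hp, hpX⟩)⟩

end IsFiniteGraph

/-! ### Graphs and faces of a realization. -/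

theorem isCritPt_sqMap_iff {x : Sph} :
    IsCritPt sqMap x ↔ x = ((0 : ℂ) : Sph) ∨ x = OnePoint.infty := by
  constructor
  · intro h
    by_contra! hcon
    exact sqMap_not_crit hcon.1 hcon.2 h
  · rintro hx ⟨U, hU, hinj⟩
    have hneg : negSph x = x := negSph_eq_self.2 hx
    have hV : U ∩ negSph ⁻¹' U ∈ 𝓝 x :=
      Filter.inter_mem hU (negSph.continuous.continuousAt (by rwa [hneg]))
    have hfin : ({((0 : ℂ) : Sph), OnePoint.infty} : Set Sph).Finite := toFinite _
    obtain ⟨y, hy, hyn⟩ := ((infinite_of_mem_nhds x hV).sdiff hfin).nonempty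
    exact hyn (negSph_eq_self.1 (hinj hy.2 hy.1 (sqMap_negSph y)))

theorem isCritPt_comp_iff {f : Sph → Sph} (a b : Sph ≃ₜ Sph) {x : Sph} :
    IsCritPt (fun x => a (f (b x))) x ↔ IsCritPt f (b x) := by
  refine not_congr ⟨?_, ?_⟩
  · rintro ⟨U, hU, hinj⟩
    refine ⟨b '' U, b.isOpenMap.image_mem_nhds hU, ?_⟩
    rintro _ ⟨y, hy, rfl⟩ _ ⟨z, hz, rfl⟩ hyz
    rw [hinj hy hz (congrArg a hyz)]
  · rintro ⟨U, hU, hinj⟩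
    refine ⟨b ⁻¹' U, b.continuous.continuousAt hU, fun y hy z hz hyz => ?_⟩
    exact b.injective (hinj hy hz (a.injective hyz))

namespace BaseMap.Realization

variable {S : BaseMap} (R : S.Realization)

/-- The value of `g` at its periodic critical point. -/
noncomputable def v₁ : Sph := R.ψ (S.g₀ S.c₁)

theorem exists_normal_form : ∃ a b : Sph ≃ₜ Sph, R.g = (fun x => a (sqMap (b x))) ∧
    a ((0 : ℂ) : Sph) = R.v₁ ∧ a OnePoint.infty = R.v₂ := by
  obtain ⟨M, N, hMN, h0, hi⟩ := S.quadratic.exists_normal_form S.crit₁ S.crit₂ S.crit_ne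
  obtain ⟨α, β, -, -, hg, h1, h2⟩ := R.branched
  refine ⟨M.trans α, β.trans N, ?_, ?_, ?_⟩
  · funext x
    rw [hg, hMN]
    rfl
  · rw [v₁, h1, hMN, h0, sqMap_eq_zero.2 rfl]
    rfl
  · rw [v₂, h2, hMN, hi]
    rfl

theorem continuous_g : Continuous R.g := by
  obtain ⟨a, b, h, -, -⟩ := R.exists_normal_form
  rw [h]
  exact a.continuous.comp (continuous_sqMap.comp b.continuous)

theorem isCritPt_iff {x : Sph} : IsCritPt R.g x ↔ R.g x = R.v₁ ∨ R.g x = R.v₂ := by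
  obtain ⟨a, b, h, h0, hi⟩ := R.exists_normal_form
  rw [h, isCritPt_comp_iff, isCritPt_sqMap_iff, ← h0, ← hi, a.injective.eq_iff,
    a.injective.eq_iff, sqMap_eq_zero, sqMap_eq_infty]

/-- This form mentions only fibres, so it can be transported by a homeomorphism that conjugates the
maps on the graphs alone. -/
theorem isCritPt_iff_fiber {x : Sph} : IsCritPt R.g x ↔ ∀ y, R.g y = R.g x → y = x := by
  obtain ⟨a, b, h, h0, hi⟩ := R.exists_normal_form
  rw [h, isCritPt_comp_iff, isCritPt_sqMap_iff, ← negSph_eq_self]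
  constructor
  · intro hx y hy
    apply b.injective
    rcases sqMap_eq_sqMap.1 (a.injective hy) with h' | h'
    · exact h'
    · rw [h', hx]
  · intro hx
    have := hx (b.symm (negSph (b x))) (by simp [sqMap_negSph])
    have := congrArg b this
    simpa using this

theorem graph_zero : R.graph 0 = R.ψ '' S.G := rfl

theorem mem_graph_succ {n : ℕ} {x : Sph} : x ∈ R.graph (n + 1) ↔ R.g x ∈ R.graph n := Iff.rfl

theorem mapsTo_graph_zero : MapsTo R.g (R.graph 0) (R.graph 0) := by
  rintro _ ⟨x, hx, rfl⟩
  change R.g (R.ψ x) ∈ R.ψ '' S.G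
  rw [← R.conj x hx]
  exact mem_image_of_mem _ (S.invariant hx)

theorem graph_subset_succ (n : ℕ) : R.graph n ⊆ R.graph (n + 1) := by
  induction n with
  | zero => exact R.mapsTo_graph_zero
  | succ n ih => exact fun x hx => ih hx

theorem graph_mono {m n : ℕ} (h : m ≤ n) : R.graph m ⊆ R.graph n :=
  monotone_nat_of_le_succ R.graph_subset_succ h

theorem mapsTo_graph (n : ℕ) : MapsTo R.g (R.graph n) (R.graph n) := R.graph_subset_succ n

theorem iterate_mem_graph {n : ℕ} {x : Sph} (hx : x ∈ R.graph n) (k : ℕ) :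
    R.g^[k] x ∈ R.graph n := (R.mapsTo_graph n).iterate k hx

/-- An orbit that enters the invariant graph stays there, but this periodic orbit returns to its
first point, which is off the graph. -/
theorem apply_iterate_notMem (i : ℕ) : S.g₀^[i] (S.g₀ S.c₁) ∉ S.G := by
  intro h
  obtain ⟨n, hn, hper⟩ := S.periodic
  have hG : ∀ k, S.g₀^[k] (S.g₀^[i] (S.g₀ S.c₁)) ∈ S.G := fun k => S.invariant.iterate k h
  have hperv : Function.IsPeriodicPt S.g₀ n (S.g₀ S.c₁) := hper.apply
  have h1 : S.g₀^[i * n - i] (S.g₀^[i] (S.g₀ S.c₁)) = S.g₀ S.c₁ := by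
    rw [← Function.iterate_add_apply, Nat.sub_add_cancel (Nat.le_mul_of_pos_right i hn)]
    exact (hperv.const_mul i)
  exact S.value₁ (h1 ▸ hG _)

theorem iterate_v₁ (i : ℕ) : R.g^[i] R.v₁ = R.ψ (S.g₀^[i] (S.g₀ S.c₁)) := (R.orbit i).symm

theorem v₁_notMem_graph (n : ℕ) : R.v₁ ∉ R.graph n := by
  intro h
  have h2 : R.g^[n] R.v₁ ∈ R.ψ '' S.G := h
  rw [iterate_v₁, R.ψ.injective.mem_set_image] at h2
  exact apply_iterate_notMem n h2

theorem v₂_notMem_graph_zero : R.v₂ ∉ R.graph 0 := by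
  intro h
  rw [graph_zero, v₂, R.ψ.injective.mem_set_image] at h
  exact S.value₂ h

theorem apply_eq_v₂_of_isCritPt {n : ℕ} {x : Sph} (hx : x ∈ R.graph n) (hc : IsCritPt R.g x) :
    R.g x = R.v₂ := by
  refine (R.isCritPt_iff.1 hc).resolve_left fun h => ?_
  exact R.v₁_notMem_graph n (h ▸ R.mapsTo_graph n hx)

theorem mem_vert_succ {n : ℕ} {x : Sph} : x ∈ R.vert (n + 1) ↔
    R.g x ∈ R.vert n ∨ (x ∈ R.graph (n + 1) ∧ IsCritPt R.g x) := Iff.rfl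

/-- Before the pull-back through the normal form, `v₂` is added as a vertex if it lies on the graph;
its preimage is the critical point that `vert` adds. The other branch value `v₁` is never on a
graph. -/
theorem isFiniteGraph (n : ℕ) : IsFiniteGraph (R.graph n) (R.vert n) := by
  classical
  induction n with
  | zero => exact S.graph.image R.ψ
  | succ n ih =>
    obtain ⟨V, hV, hVv⟩ : ∃ V, IsFiniteGraph (R.graph n) V ∧
        ∀ x, x ∈ V ↔ x ∈ R.vert n ∨ (x ∈ R.graph n ∧ x = R.v₂) := by
      by_cases h : R.v₂ ∈ R.graph n
      · refine ⟨_, ih.insert h, fun x => ?_⟩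
        rw [mem_insert_iff, or_comm]
        exact or_congr_right ⟨fun h' => ⟨h' ▸ h, h'⟩, fun h' => h'.2⟩
      · refine ⟨_, ih, fun x => ⟨Or.inl, fun h' => h'.resolve_right ?_⟩⟩
        rintro ⟨h1, rfl⟩
        exact h h1
    obtain ⟨a, b, hg, h0, hi⟩ := R.exists_normal_form
    have h1 := hV.image a.symm
    rw [a.image_symm] at h1
    have h2 := (h1.sqMap_preimage (by
      rintro x hx (rfl | rfl)
      · rw [mem_preimage, h0] at hx
        exact (R.v₁_notMem_graph n hx).elim
      · rw [mem_preimage, hi] at hx ⊢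
        exact (hVv _).2 (Or.inr ⟨hx, rfl⟩))).image b.symm
    rw [b.image_symm] at h2
    have e1 : b ⁻¹' (sqMap ⁻¹' (a ⁻¹' R.graph n)) = R.graph (n + 1) := by
      ext x
      rw [mem_graph_succ, hg]
      rfl
    have e2 : b ⁻¹' (sqMap ⁻¹' (a ⁻¹' V)) = R.vert (n + 1) := by
      ext x
      have : x ∈ b ⁻¹' (sqMap ⁻¹' (a ⁻¹' V)) ↔ R.g x ∈ V := by rw [hg]; rfl
      rw [this, hVv, mem_vert_succ, isCritPt_iff, mem_graph_succ]
      refine or_congr_right (and_congr_right fun hx => ⟨Or.inr, fun h => h.resolve_left ?_⟩)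
      intro h
      exact R.v₁_notMem_graph n (h ▸ hx)
    rwa [e1, e2] at h2

theorem isClosed_graph (n : ℕ) : IsClosed (R.graph n) := (R.isFiniteGraph n).isClosed

theorem vert_subset_graph (n : ℕ) : R.vert n ⊆ R.graph n := (R.isFiniteGraph n).subset

theorem vert_subset_succ (n : ℕ) : R.vert n ⊆ R.vert (n + 1) := by
  induction n with
  | zero =>
    rintro _ ⟨x, hx, rfl⟩
    refine Or.inl ?_
    change R.g (R.ψ x) ∈ R.ψ '' S.X
    rw [← R.conj x (S.graph.subset hx)]
    exact mem_image_of_mem _ (S.vertex_invariant hx)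
  | succ n ih =>
    rintro x (hx | ⟨hx, hc⟩)
    · exact Or.inl (ih hx)
    · exact Or.inr ⟨R.graph_subset_succ _ hx, hc⟩

theorem vert_mono {m n : ℕ} (h : m ≤ n) : R.vert m ⊆ R.vert n :=
  monotone_nat_of_le_succ R.vert_subset_succ h

/-- A face of `Gₙ` lies in a face of `G₀`. Both critical values are off `G₀`, so being in the
closure of that face means being in the face, and `G₀` separates them. -/
theorem not_both_mem_closure_face {n : ℕ} {x : Sph} :
    ¬ (R.v₁ ∈ closure (connectedComponentIn (R.graph n)ᶜ x) ∧
      R.v₂ ∈ closure (connectedComponentIn (R.graph n)ᶜ x)) := by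
  rintro ⟨h1, h2⟩
  have hmono : connectedComponentIn (R.graph n)ᶜ x ⊆ connectedComponentIn (R.graph 0)ᶜ x :=
    connectedComponentIn_mono _ (compl_subset_compl.2 (R.graph_mono (Nat.zero_le n)))
  have h1' := closure_connectedComponentIn_inter ⟨closure_mono hmono h1, R.v₁_notMem_graph 0⟩
  have h2' := closure_connectedComponentIn_inter ⟨closure_mono hmono h2, R.v₂_notMem_graph_zero⟩
  have he : connectedComponentIn (R.graph 0)ᶜ R.v₁ = connectedComponentIn (R.graph 0)ᶜ R.v₂ :=
    (connectedComponentIn_eq h1').symm.trans (connectedComponentIn_eq h2')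
  apply S.separates
  have hpre : R.ψ ⁻¹' (R.graph 0)ᶜ = S.Gᶜ := by
    rw [preimage_compl, graph_zero, preimage_image_eq _ R.ψ.injective]
  rw [← hpre, ← R.ψ.preimage_connectedComponentIn (R.v₁_notMem_graph 0),
    ← R.ψ.preimage_connectedComponentIn R.v₂_notMem_graph_zero]
  exact congrArg _ he

theorem hasDiscFaces (n : ℕ) : HasDiscFaces (R.graph n) := by
  induction n with
  | zero =>
    intro x hx
    obtain ⟨y, rfl⟩ := R.ψ.surjective x
    have hy : y ∉ S.G := fun h => hx (mem_image_of_mem _ h)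
    have h1 := (S.faces y hy).image R.ψ
    have hpre : R.ψ ⁻¹' (R.graph 0)ᶜ = S.Gᶜ := by
      rw [preimage_compl, graph_zero, preimage_image_eq _ R.ψ.injective]
    rwa [← hpre, ← R.ψ.preimage_connectedComponentIn hx,
      image_preimage_eq _ R.ψ.surjective] at h1
  | succ n ih =>
    intro x hx
    obtain ⟨a, b, hg, h0, hi⟩ := R.exists_normal_form
    have hx' : R.g x ∉ R.graph n := hx
    have hxa : a (sqMap (b x)) ∈ (R.graph n)ᶜ := by
      rw [hg] at hx'
      exact hx'
    have h1 := (ih _ hxa).image a.symm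
    rw [a.image_symm, a.preimage_connectedComponentIn hxa] at h1
    have hopen : IsOpen (connectedComponentIn (a ⁻¹' (R.graph n)ᶜ) (sqMap (b x))) :=
      ((R.isClosed_graph n).isOpen_compl.preimage a.continuous).connectedComponentIn
    have h2 := h1.sqMap_preimage hopen (by
      rw [← a.preimage_connectedComponentIn hxa, ← a.preimage_closure, mem_preimage, mem_preimage,
        h0, hi]
      exact R.not_both_mem_closure_face) (y := b x)
      (mem_connectedComponentIn hxa)
    rw [← connectedComponentIn_preimage continuous_sqMap
      (show sqMap (b x) ∈ a ⁻¹' (R.graph n)ᶜ from hxa)] at h2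
    have h3 := h2.image b.symm
    rw [b.image_symm, b.preimage_connectedComponentIn
      (show b x ∈ sqMap ⁻¹' (a ⁻¹' (R.graph n)ᶜ) from hxa)] at h3
    have e1 : b ⁻¹' (sqMap ⁻¹' (a ⁻¹' (R.graph n)ᶜ)) = (R.graph (n + 1))ᶜ := by
      ext y
      rw [mem_compl_iff, mem_graph_succ, hg]
      rfl
    rwa [e1] at h3

theorem qIsDisc {i : ℕ} (h : R.v₂ ∉ R.graph i) : R.QIsDisc i := by
  refine ⟨h, ?_, R.hasDiscFaces i _ h⟩
  rw [Q, if_neg (fun h' => h (R.vert_subset_graph i h')), if_neg h]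

end BaseMap.Realization

/-! ### Refinement of cells and the part without precritical points. -/

namespace IsFiniteGraph

variable {G X G' X' : Set Sph}

theorem exists_arc (h : IsFiniteGraph G X) {p : Sph} (hp : p ∈ G \ X) :
    ∃ (δ : ℝ → Sph) (ε : ℝ), 0 < ε ∧ ContinuousOn δ (Ioo (-ε) ε) ∧ InjOn δ (Ioo (-ε) ε) ∧
      δ 0 = p ∧ MapsTo δ (Ioo (-ε) ε) (connectedComponentIn (G \ X) p) := by
  obtain ⟨m, γ, hγ⟩ := h.exists_arcs
  obtain ⟨k, hk⟩ := hγ.exists_of_mem hp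
  rw [hγ.connectedComponentIn_eq hk]
  obtain ⟨s, hs, rfl⟩ := hk
  have hs0 : (0 : ℝ) < s := hs.1
  have hs1 : (s : ℝ) < 1 := hs.2
  have hmem : ∀ θ ∈ Ioo (-(min (s : ℝ) (1 - s))) (min (s : ℝ) (1 - s)),
      0 < (s : ℝ) + θ ∧ (s : ℝ) + θ < 1 := fun θ hθ =>
    ⟨by linarith [hθ.1, min_le_left (s : ℝ) (1 - s)], by
      linarith [hθ.2, min_le_right (s : ℝ) (1 - s)]⟩
  have hproj : ∀ θ (h : 0 < (s : ℝ) + θ ∧ (s : ℝ) + θ < 1),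
      projIcc 0 1 zero_le_one ((s : ℝ) + θ) = ⟨(s : ℝ) + θ, h.1.le, h.2.le⟩ := fun θ h =>
    projIcc_of_mem zero_le_one ⟨h.1.le, h.2.le⟩
  have hIoo : ∀ θ ∈ Ioo (-(min (s : ℝ) (1 - s))) (min (s : ℝ) (1 - s)),
      projIcc 0 1 zero_le_one ((s : ℝ) + θ) ∈ Ioo (0 : unitInterval) 1 := fun θ hθ => by
    rw [hproj θ (hmem θ hθ)]
    exact hmem θ hθ
  refine ⟨fun θ => γ k (projIcc 0 1 zero_le_one ((s : ℝ) + θ)), min (s : ℝ) (1 - s),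
    lt_min hs0 (by linarith), ?_, ?_, by simp, fun θ hθ => mem_image_of_mem _ (hIoo θ hθ)⟩
  · exact ((hγ.cont k).comp (continuous_projIcc.comp
      (continuous_const.add continuous_id))).continuousOn
  · intro θ hθ θ' hθ' he
    have h1 := hγ.inj k (hIoo θ hθ) (hIoo θ' hθ') he
    rw [hproj θ (hmem θ hθ), hproj θ' (hmem θ' hθ')] at h1
    have h2 := congrArg Subtype.val h1
    simpa using h2

/-- Open edges of a finer graph lie in the open edges of the coarser graph that they meet. -/
theorem connectedComponentIn_subset_of_subset (hG : IsFiniteGraph G X)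
    (hG' : IsFiniteGraph G' X') (hGG : G ⊆ G') (hXX : X ⊆ X') {x : Sph} (hx : x ∈ G \ X') :
    connectedComponentIn (G' \ X') x ⊆ connectedComponentIn (G \ X) x := by
  have hxGX : x ∈ G \ X := ⟨hx.1, fun h => hx.2 (hXX h)⟩
  have hmem : ∀ p ∈ connectedComponentIn (G' \ X') x ∩ closure (connectedComponentIn (G \ X) x),
      p ∈ connectedComponentIn (G \ X) x := fun p hp =>
    (hG.closure_connectedComponentIn_subset hxGX hp.2).resolve_right fun h =>
      (connectedComponentIn_subset _ _ hp.1).2 (hXX h)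
  have hsub : connectedComponentIn (G' \ X') x ⊆ closure (connectedComponentIn (G \ X) x) := by
    refine isPreconnected_connectedComponentIn.subset_of_isClosed_of_nhdsWithin isClosed_closure
      ⟨x, mem_connectedComponentIn ⟨hGG hx.1, hx.2⟩,
        subset_closure (mem_connectedComponentIn hxGX)⟩ ?_
    intro p hp
    have hpC := hmem p hp
    obtain ⟨δ, ε, hε, hδc, hδi, hδ0, hδ⟩ := hG.exists_arc (connectedComponentIn_subset _ _ hpC)
    rw [← connectedComponentIn_eq hpC] at hδ
    -- An arc of the coarse edge through `p` is also an arc in the finer graph, so it is a full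
    -- neighbourhood of `p` there.
    have h1 := hG'.image_Ioo_mem_nhdsWithin (connectedComponentIn_subset _ _ hp.1) hε hδc hδi
      (fun θ hθ => hGG (connectedComponentIn_subset _ _ (hδ hθ)).1) hδ0
    have hCG' : connectedComponentIn (G' \ X') x ⊆ G' :=
      (connectedComponentIn_subset _ _).trans sdiff_subset
    refine Filter.mem_of_superset (nhdsWithin_mono _ hCG' h1) ?_
    rintro _ ⟨θ, hθ, rfl⟩
    exact subset_closure (hδ hθ)
  exact fun p hp => hmem p ⟨hp, hsub hp⟩

end IsFiniteGraph

namespace BaseMap.Realization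

variable {S : BaseMap} (R : S.Realization)

open Classical in
/-- The smallest closed cell (vertex or edge) of `Gᵢ(g)` around a point of this graph. -/
noncomputable def cell (i : ℕ) (x : Sph) : Set Sph :=
  if x ∈ R.vert i then {x} else edgeAt (R.graph i) (R.vert i) x

theorem cell_of_mem {i : ℕ} {x : Sph} (h : x ∈ R.vert i) : R.cell i x = {x} := if_pos h

theorem cell_of_notMem {i : ℕ} {x : Sph} (h : x ∉ R.vert i) :
    R.cell i x = edgeAt (R.graph i) (R.vert i) x := if_neg h

theorem Q_eq_cell {i : ℕ} (h : R.v₂ ∈ R.graph i) : R.Q i = R.cell i R.v₂ := by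
  rw [Q, cell, if_pos h]

theorem Q_eq_closure {i : ℕ} (h : R.v₂ ∉ R.graph i) :
    R.Q i = closure (connectedComponentIn (R.graph i)ᶜ R.v₂) := (R.qIsDisc h).2.1

theorem isClosed_cell (i : ℕ) (x : Sph) : IsClosed (R.cell i x) := by
  by_cases h : x ∈ R.vert i
  · rw [R.cell_of_mem h]; exact isClosed_singleton
  · rw [R.cell_of_notMem h]; exact isClosed_closure

theorem mem_cell {i : ℕ} {x : Sph} (hx : x ∈ R.graph i) : x ∈ R.cell i x := by
  by_cases h : x ∈ R.vert i
  · rw [R.cell_of_mem h]; exact mem_singleton x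
  · rw [R.cell_of_notMem h]; exact subset_closure (mem_connectedComponentIn ⟨hx, h⟩)

theorem cell_subset_graph {i : ℕ} {x : Sph} (hx : x ∈ R.graph i) : R.cell i x ⊆ R.graph i := by
  by_cases h : x ∈ R.vert i
  · rw [R.cell_of_mem h]; exact singleton_subset_iff.2 hx
  · rw [R.cell_of_notMem h]
    exact closure_minimal ((connectedComponentIn_subset _ _).trans sdiff_subset)
      (R.isClosed_graph i)

theorem finite_cells (i : ℕ) : (R.cell i '' R.graph i).Finite := by
  have hfin : ((fun x : Sph => ({x} : Set Sph)) '' R.vert i ∪ closure ''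
      (connectedComponentIn (R.graph i \ R.vert i) '' (R.graph i \ R.vert i))).Finite :=
    ((R.isFiniteGraph i).1.image _).union ((R.isFiniteGraph i).finite_components.image _)
  refine hfin.subset ?_
  rintro _ ⟨x, hx, rfl⟩
  by_cases h : x ∈ R.vert i
  · rw [R.cell_of_mem h]
    exact Or.inl (mem_image_of_mem _ h)
  · rw [R.cell_of_notMem h]
    exact Or.inr (mem_image_of_mem _ (mem_image_of_mem _ ⟨hx, h⟩))

theorem component_subset_cell {i j : ℕ} (hij : i ≤ j) {x z : Sph} (hz : z ∈ R.graph i)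
    (hx : x ∈ R.cell i z) (hxj : x ∉ R.vert j) :
    connectedComponentIn (R.graph j \ R.vert j) x ⊆ R.cell i z := by
  have hxi : x ∉ R.vert i := fun h => hxj (R.vert_mono hij h)
  have hxG := R.cell_subset_graph hz hx
  have hzi : z ∉ R.vert i := by
    intro h
    rw [R.cell_of_mem h] at hx
    exact hxi (hx ▸ h)
  rw [R.cell_of_notMem hzi] at hx ⊢
  have hxC := ((R.isFiniteGraph i).closure_connectedComponentIn_subset ⟨hz, hzi⟩ hx).resolve_right
    hxi
  rw [edgeAt, connectedComponentIn_eq hxC]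
  exact ((R.isFiniteGraph i).connectedComponentIn_subset_of_subset (R.isFiniteGraph j)
    (R.graph_mono hij) (R.vert_mono hij) ⟨hxG, hxj⟩).trans subset_closure

theorem cell_anti {i j : ℕ} (hij : i ≤ j) {x : Sph} (hx : x ∈ R.graph i) :
    R.cell j x ⊆ R.cell i x := by
  by_cases h : x ∈ R.vert j
  · rw [R.cell_of_mem h]
    exact singleton_subset_iff.2 (R.mem_cell hx)
  · rw [R.cell_of_notMem h]
    exact closure_minimal (R.component_subset_cell hij hx (R.mem_cell hx) h) (R.isClosed_cell i x)

/-- No iterate takes a point of `A` to a critical point. -/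
def IsFree (A : Set Sph) : Prop := ∀ y ∈ A, ∀ k : ℕ, ¬ IsCritPt R.g (R.g^[k] y)

/-- The union of the closed cells of the graphs `Gᵢ(g)`, `i ≤ j`, without precritical points. -/
def freePart (j : ℕ) : Set Sph :=
  ⋃ i ∈ Iic j, ⋃ A ∈ {A ∈ R.cell i '' R.graph i | R.IsFree A}, A

theorem mem_freePart {j : ℕ} {y : Sph} : y ∈ R.freePart j ↔
    ∃ i ≤ j, ∃ x ∈ R.graph i, R.IsFree (R.cell i x) ∧ y ∈ R.cell i x := by
  simp only [freePart, mem_iUnion, mem_Iic, exists_prop]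
  constructor
  · rintro ⟨i, hi, _, ⟨⟨x, hx, rfl⟩, hf⟩, hy⟩
    exact ⟨i, hi, x, hx, hf, hy⟩
  · rintro ⟨i, hi, x, hx, hf, hy⟩
    exact ⟨i, hi, _, ⟨⟨x, hx, rfl⟩, hf⟩, hy⟩

theorem isClosed_freePart (j : ℕ) : IsClosed (R.freePart j) := by
  refine (finite_Iic j).isClosed_biUnion fun i _ => ?_
  refine ((R.finite_cells i).subset fun A hA => hA.1).isClosed_biUnion ?_
  rintro _ ⟨⟨x, -, rfl⟩, -⟩
  exact R.isClosed_cell i x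

theorem freePart_mono {j k : ℕ} (h : j ≤ k) : R.freePart j ⊆ R.freePart k := by
  intro y hy
  obtain ⟨i, hi, x, hx, hf, hy⟩ := R.mem_freePart.1 hy
  exact R.mem_freePart.2 ⟨i, hi.trans h, x, hx, hf, hy⟩

theorem freePart_subset_graph (j : ℕ) : R.freePart j ⊆ R.graph j := by
  intro y hy
  obtain ⟨i, hi, x, hx, -, hy⟩ := R.mem_freePart.1 hy
  exact R.graph_mono hi (R.cell_subset_graph hx hy)

theorem isFree_freePart (j : ℕ) : R.IsFree (R.freePart j) := by
  intro y hy
  obtain ⟨i, -, x, -, hf, hy⟩ := R.mem_freePart.1 hy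
  exact hf y hy

theorem cell_subset_freePart {i j : ℕ} (hij : i ≤ j) {x : Sph} (hx : x ∈ R.graph i)
    (hf : R.IsFree (R.cell i x)) : R.cell i x ⊆ R.freePart j :=
  fun _ hy => R.mem_freePart.2 ⟨i, hij, x, hx, hf, hy⟩

/-- Cells of all levels up to `j` are admitted so that the free parts increase with `j`. The union
is still a subgraph at level `j`, because an open edge of level `j` that meets a coarser cell lies
in that cell. -/
theorem isSubgraph_freePart (j : ℕ) :
    IsSubgraph (R.freePart j) (R.graph j) (R.vert j) := by
  refine ⟨R.freePart_subset_graph j, R.isClosed_freePart j, fun x hx hxj => ?_⟩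
  obtain ⟨i, hi, z, hz, hf, hx⟩ := R.mem_freePart.1 hx
  exact (R.component_subset_cell hi hz hx hxj).trans (R.cell_subset_freePart hi hz hf)

theorem isSubgraph_graph (j : ℕ) : IsSubgraph (R.graph j) (R.graph j) (R.vert j) :=
  ⟨Subset.rfl, R.isClosed_graph j, fun _ _ _ =>
    (connectedComponentIn_subset _ _).trans sdiff_subset⟩

/-- A critical point on `Gₖ₊₁` is mapped to `v₂`, which would then lie on `Gₖ`; and `Gₖ₊₁` is
forward invariant. -/
theorem isFree_graph_succ {k : ℕ} (h : R.v₂ ∉ R.graph k) : R.IsFree (R.graph (k + 1)) := by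
  intro y hy l hc
  have h1 := R.iterate_mem_graph hy l
  exact h (R.apply_eq_v₂_of_isCritPt h1 hc ▸ h1)

/-- The base point of `v₂` lands in `G` under `g₀`, while the orbit of the other critical value
never does. -/
theorem v₂_ne_iterate_v₁ (i : ℕ) : R.v₂ ≠ R.g^[i] R.v₁ := by
  intro h
  rw [iterate_v₁] at h
  have h1 : S.g₀ S.c₂ = S.g₀^[i] (S.g₀ S.c₁) := R.ψ.injective h
  obtain ⟨r, -, hr⟩ := S.lands
  rw [h1, ← Function.iterate_add_apply] at hr
  exact apply_iterate_notMem _ hr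

theorem finite_orbit_v₁ : (range fun i : ℕ => R.g^[i] R.v₁).Finite := by
  obtain ⟨n, hn, hper⟩ := S.periodic
  have hperv : Function.IsPeriodicPt S.g₀ n (S.g₀ S.c₁) := hper.apply
  refine ((finite_Iio n).image fun i : ℕ => R.g^[i] R.v₁).subset ?_
  rintro _ ⟨i, rfl⟩
  refine ⟨i % n, Nat.mod_lt _ hn, ?_⟩
  simp only [iterate_v₁, hperv.iterate_mod_apply]

/-! ### Perturbing the free critical value. -/

/-- The realization `τ ∘ g`, where `τ` fixes the graph and the orbit of the first critical
value. -/
noncomputable def perturb (τ : Sph ≃ₜ Sph) (hτ : IsotopicToId τ) (hG : ∀ x ∈ R.graph 0, τ x = x)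
    (hv : ∀ i : ℕ, τ (R.g^[i] R.v₁) = R.g^[i] R.v₁) : S.Realization where
  g x := τ (R.g x)
  ψ := R.ψ.trans τ
  marking := R.marking.trans hτ
  branched := by
    obtain ⟨α, β, hα, hβ, hg, h1, h2⟩ := R.branched
    exact ⟨α.trans τ, β, hα.trans hτ, hβ, fun x => congrArg τ (hg x), congrArg τ h1,
      congrArg τ h2⟩
  conj x hx := by
    change τ (R.ψ (S.g₀ x)) = τ (R.g (τ (R.ψ x)))
    rw [hG _ (mem_image_of_mem _ hx), R.conj x hx]
  orbit i := by
    change τ (R.ψ (S.g₀^[i] (S.g₀ S.c₁))) = (fun x => τ (R.g x))^[i] (τ R.v₁)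
    rw [← iterate_v₁, hv i]
    have h0 := hv 0
    rw [Function.iterate_zero_apply] at h0
    rw [h0]
    induction i with
    | zero => rfl
    | succ i ih =>
      rw [Function.iterate_succ_apply' (fun x => τ (R.g x)), ← ih]
      change _ = τ (R.g (R.g^[i] R.v₁))
      rw [← Function.iterate_succ_apply' R.g, hv]

section perturb

variable {R} {τ : Sph ≃ₜ Sph} {hτ : IsotopicToId τ} {hG : ∀ x ∈ R.graph 0, τ x = x}
  {hv : ∀ i : ℕ, τ (R.g^[i] R.v₁) = R.g^[i] R.v₁}

theorem perturb_graph_zero : (R.perturb τ hτ hG hv).graph 0 = R.graph 0 := by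
  change (R.ψ.trans τ) '' S.G = R.ψ '' S.G
  refine image_congr fun x hx => ?_
  exact hG _ (mem_image_of_mem _ hx)

theorem perturb_vert_zero : (R.perturb τ hτ hG hv).vert 0 = R.vert 0 := by
  change (R.ψ.trans τ) '' S.X = R.ψ '' S.X
  refine image_congr fun x hx => ?_
  exact hG _ (mem_image_of_mem _ (S.graph.subset hx))

theorem perturb_graph {k i : ℕ} (hk : ∀ x ∈ R.graph k, τ x = x) (hi : i ≤ k) :
    (R.perturb τ hτ hG hv).graph i = R.graph i := by
  induction i with
  | zero => exact perturb_graph_zero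
  | succ i ih =>
    ext x
    rw [mem_graph_succ, mem_graph_succ, ih (by omega)]
    change τ (R.g x) ∈ R.graph i ↔ _
    have hsub := R.graph_mono (show i ≤ k by omega)
    constructor
    · intro h
      have := τ.injective (hk _ (hsub h))
      rwa [this] at h
    · intro h
      rwa [hk _ (hsub h)]

theorem isCritPt_perturb_iff {x : Sph} :
    IsCritPt (R.perturb τ hτ hG hv).g x ↔ IsCritPt R.g x :=
  isCritPt_comp_iff τ (Homeomorph.refl Sph)

/-- Membership at level `j` depends on the first `j` images of `x`, and along these `τ ∘ g` and `g`
agree while the images miss `D`. -/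
theorem mem_perturb_iff {D : Set Sph} (hD : ∀ x ∉ D, τ x = x) {j : ℕ} {x : Sph}
    (hx : ∀ l < j, R.g^[l + 1] x ∉ D) :
    (x ∈ (R.perturb τ hτ hG hv).graph j ↔ x ∈ R.graph j) ∧
      (x ∈ (R.perturb τ hτ hG hv).vert j ↔ x ∈ R.vert j) := by
  induction j generalizing x with
  | zero => rw [perturb_graph_zero, perturb_vert_zero]; exact ⟨Iff.rfl, Iff.rfl⟩
  | succ j ih =>
    have h1 : (R.perturb τ hτ hG hv).g x = R.g x := hD _ (hx 0 (by omega))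
    have h2 := ih (x := R.g x) fun l hl => by
      rw [← Function.iterate_succ_apply]
      exact hx (l + 1) (by omega)
    have h3 : x ∈ (R.perturb τ hτ hG hv).graph (j + 1) ↔ x ∈ R.graph (j + 1) := by
      rw [mem_graph_succ, mem_graph_succ, h1, h2.1]
    refine ⟨h3, ?_⟩
    rw [mem_vert_succ, mem_vert_succ, h1, h2.2, h3, isCritPt_perturb_iff]

end perturb

/-- Moving the free critical value off the graph `Gₙ(g)`. -/
theorem exists_perturbation {n : ℕ} (hn : R.v₂ ∈ R.graph n) :
    ∃ T : S.Realization, T.v₂ ∉ T.graph n ∧ (∀ x ∈ S.G, R.ψ x = T.ψ x) ∧ R.Q 0 = T.Q 0 ∧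
      (∀ i ≤ n, R.Q i ⊆ T.Q i) ∧
      (∀ j ≤ n, IsSubgraph (R.freePart j) (T.graph j) (T.vert j)) ∧
      ∀ i ≤ n, R.Q i ≠ T.Q i → R.Q i ⊆ R.freePart n := by
  classical
  obtain ⟨k, hk, hk1, hkn⟩ : ∃ k, R.v₂ ∉ R.graph k ∧ R.v₂ ∈ R.graph (k + 1) ∧ k + 1 ≤ n := by
    have hex : ∃ m, R.v₂ ∈ R.graph m := ⟨n, hn⟩
    have h0 : Nat.find hex ≠ 0 := fun h => R.v₂_notMem_graph_zero (h ▸ Nat.find_spec hex)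
    obtain ⟨k, hk⟩ := Nat.exists_eq_succ_of_ne_zero h0
    have hs := Nat.find_spec hex
    have hm := Nat.find_min' hex hn
    rw [hk] at hs hm
    exact ⟨k, Nat.find_min hex (by omega), hs, hm⟩
  -- The three conditions let `τ` fix `Gₖ`, fix the orbit of `v₁`, and leave the dynamics near the
  -- free part unchanged. The last one can be met: `g^[l + 1] y = v₂` would make `g^[l] y` critical.
  have hΩ : connectedComponentIn (R.graph k)ᶜ R.v₂ ∩ ((range fun i : ℕ => R.g^[i] R.v₁)ᶜ ∩
      ⋂ l ∈ Iio n, (R.g^[l + 1] '' R.freePart n)ᶜ) ∈ 𝓝 R.v₂ := by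
    refine Filter.inter_mem ?_ (Filter.inter_mem ?_ ?_)
    · exact (R.isClosed_graph k).isOpen_compl.connectedComponentIn.mem_nhds
        (mem_connectedComponentIn hk)
    · refine R.finite_orbit_v₁.isClosed.isOpen_compl.mem_nhds ?_
      rintro ⟨i, hi⟩
      exact R.v₂_ne_iterate_v₁ i hi.symm
    · refine (Filter.biInter_mem (finite_Iio n)).2 fun l _ => ?_
      refine (((R.isClosed_freePart n).isCompact.image
        (R.continuous_g.iterate (l + 1))).isClosed).isOpen_compl.mem_nhds ?_
      rintro ⟨y, hy, hyv⟩
      rw [Function.iterate_succ_apply'] at hyv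
      exact R.isFree_freePart n y hy l (R.isCritPt_iff.2 (Or.inr hyv))
  obtain ⟨D, hD, hDc, hDΩ⟩ := exists_mem_nhds_isClosed_subset hΩ
  set N : Set Sph := ⋂ l ∈ Iio n, (R.g^[l + 1] ⁻¹' D)ᶜ with hN
  have hNo : IsOpen N := (finite_Iio n).isOpen_biInter fun l _ =>
    (hDc.preimage (R.continuous_g.iterate (l + 1))).isOpen_compl
  have hNmem : ∀ {x}, x ∈ N → ∀ l < n, R.g^[l + 1] x ∉ D := fun hx l hl =>
    mem_iInter₂.1 hx l hl
  have hAN : R.freePart n ⊆ N := fun y hy => mem_iInter₂.2 fun l hl hyD =>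
    (mem_iInter₂.1 (hDΩ hyD).2.2 l hl) (mem_image_of_mem _ hy)
  -- A cell at `v₂` of level at least `k + 1` lies in the one of level `k + 1`, and `Gₖ₊₁` has no
  -- precritical points.
  have hcell : ∀ i, k + 1 ≤ i → i ≤ n → R.cell i R.v₂ ⊆ R.freePart n := fun i hki hin =>
    R.cell_subset_freePart hin (R.graph_mono hki hk1) fun y hy =>
      R.isFree_graph_succ hk y (R.cell_subset_graph hk1 (R.cell_anti hki hk1 hy))
  have hvN : R.v₂ ∈ N := hAN (hcell n hkn le_rfl (R.mem_cell hn))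
  obtain ⟨W, hW, hτ⟩ := exists_isotopicToId_move R.v₂ hD
  obtain ⟨w₀, hw₀, hvw₀⟩ := (R.isFiniteGraph n).exists_adjacent_face (R.hasDiscFaces n) hn
  -- `W` makes `w` reachable by some `τ`, `D` keeps it in the face of `Gₖ` around `v₂`, and `N` lets
  -- the graphs be compared at `w`.
  obtain ⟨w, ⟨⟨hwW, hwD⟩, hwN⟩, hwG, hvw⟩ := (R.hasDiscFaces n).exists_mem_closure_component hn
    hw₀ hvw₀ (hNo.mem_nhds hvN) (Filter.inter_mem hW hD)
  obtain ⟨τ, hτi, hτv, hτD⟩ := hτ w hwW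
  have hfix : ∀ x ∈ R.graph k, τ x = x := fun x hx => hτD x fun hxD =>
    connectedComponentIn_subset _ _ (hDΩ hxD).1 hx
  set T := R.perturb τ hτi (fun x hx => hfix x (R.graph_mono (Nat.zero_le k) hx))
    (fun i => hτD _ fun hD => (hDΩ hD).2.1 ⟨i, rfl⟩) with hT
  have hTv : T.v₂ = w := hτv
  have hagree : ∀ j ≤ n, ∀ x ∈ N, (x ∈ T.graph j ↔ x ∈ R.graph j) ∧
      (x ∈ T.vert j ↔ x ∈ R.vert j) := fun j hj x hx =>
    mem_perturb_iff hτD fun l hl => hNmem hx l (hl.trans_le hj)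
  have hTn : T.v₂ ∉ T.graph n := by
    rw [hTv, (hagree n le_rfl w hwN).1]
    exact hwG
  have hTi : ∀ i ≤ n, T.v₂ ∉ T.graph i := fun i hi h => hTn (T.graph_mono hi h)
  have hlow : ∀ i ≤ k, R.Q i = T.Q i := by
    intro i hi
    have hvi : R.v₂ ∉ R.graph i := fun h => hk (R.graph_mono hi h)
    have hwi : w ∈ connectedComponentIn (R.graph i)ᶜ R.v₂ :=
      connectedComponentIn_mono _ (compl_subset_compl.2 (R.graph_mono hi)) (hDΩ hwD).1
    rw [R.Q_eq_closure hvi, T.Q_eq_closure (hTi i (by omega)), hTv, perturb_graph hfix hi,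
      connectedComponentIn_eq hwi]
  have hhigh : ∀ i, k + 1 ≤ i → i ≤ n → R.Q i ⊆ T.Q i := by
    intro i hki hin
    have hvi := R.graph_mono hki hk1
    have hwi : w ∈ N \ R.graph i := ⟨hwN, fun h => hwG (R.graph_mono hin h)⟩
    have hvwi : R.v₂ ∈ closure (connectedComponentIn (N \ R.graph i) w) :=
      closure_mono (connectedComponentIn_mono _ (sdiff_subset_sdiff_right (R.graph_mono hin))) hvw
    -- The two graphs agree on `N`, so a component of `N` off the old graph lies in one face of the
    -- new graph.
    have hsub : connectedComponentIn (N \ R.graph i) w ⊆ connectedComponentIn (T.graph i)ᶜ w :=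
      connectedComponentIn_mono _ fun x hx h => hx.2 ((hagree i hin x hx.1).1.1 h)
    rw [R.Q_eq_cell hvi, T.Q_eq_closure (hTi i hin), hTv]
    refine Subset.trans ?_ (closure_mono hsub)
    by_cases hvert : R.v₂ ∈ R.vert i
    · rw [R.cell_of_mem hvert]
      exact singleton_subset_iff.2 hvwi
    · have hc := (hcell i hki hin).trans hAN
      rw [R.cell_of_notMem hvert] at hc ⊢
      exact closure_minimal ((R.isFiniteGraph i).edge_subset_closure (R.hasDiscFaces i) hNo hwi
        ⟨hvi, hvert⟩ hvwi (subset_closure.trans hc)) isClosed_closure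
  refine ⟨T, hTn, fun x hx => ?_, hlow 0 (Nat.zero_le k), fun i hi => ?_, fun j hj => ?_,
    fun i hi hne => ?_⟩
  · exact (hfix _ (R.graph_mono (Nat.zero_le k) (mem_image_of_mem _ hx))).symm
  · rcases Nat.lt_or_ge k i with h | h
    · exact hhigh i h hi
    · exact (hlow i h).subset
  · have hAj : R.freePart j ⊆ N := (R.freePart_mono hj).trans hAN
    refine ⟨fun x hx => (hagree j hj x (hAj hx)).1.2 (R.freePart_subset_graph j hx),
      R.isClosed_freePart j, fun x hx hxv => ?_⟩
    have hxG : x ∈ T.graph j \ T.vert j :=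
      ⟨(hagree j hj x (hAj hx)).1.2 (R.freePart_subset_graph j hx), hxv⟩
    -- Away from `N` the edges of the new graph are unknown. The free part is closed, and near each
    -- of its points the two graphs agree, so it is relatively clopen in the new edge.
    refine isPreconnected_connectedComponentIn.subset_of_isClosed_of_nhdsWithin
      (R.isClosed_freePart j) ⟨x, mem_connectedComponentIn hxG, hx⟩ ?_
    rintro p ⟨hpC, hpA⟩
    have hpT := connectedComponentIn_subset _ _ hpC
    have hpR : p ∈ R.graph j \ R.vert j := ⟨(hagree j hj p (hAj hpA)).1.1 hpT.1,
      fun h => hpT.2 ((hagree j hj p (hAj hpA)).2.2 h)⟩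
    have h1 := mem_nhdsWithin_iff_eventually.1
      ((R.isFiniteGraph j).connectedComponentIn_mem_nhdsWithin hpR)
    rw [mem_nhdsWithin_iff_eventually]
    filter_upwards [h1, hNo.mem_nhds (hAj hpA)] with q hq hqN hqC
    have hqT := connectedComponentIn_subset _ _ hqC
    exact (R.isSubgraph_freePart j).2.2 p hpA hpR.2 (hq ⟨(hagree j hj q hqN).1.1 hqT.1,
      fun h => hqT.2 ((hagree j hj q hqN).2.2 h)⟩)
  · rcases Nat.lt_or_ge k i with h | h
    · rw [R.Q_eq_cell (R.graph_mono h hk1)]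
      exact hcell i h hi
    · exact (hne (hlow i h)).elim

/-- Every realization can be modified so that the free critical value is off `Gₙ(g)`. -/
theorem exists_disc_realization (n : ℕ) :
    ∃ (T : S.Realization) (A : ℕ → Set Sph), T.v₂ ∉ T.graph n ∧ (∀ x ∈ S.G, R.ψ x = T.ψ x) ∧
      R.Q 0 = T.Q 0 ∧ (∀ i ≤ n, R.Q i ⊆ T.Q i) ∧
      (∀ j ≤ n, IsSubgraph (A j) (R.graph j) (R.vert j) ∧
        IsSubgraph (A j) (T.graph j) (T.vert j)) ∧
      (∀ j k, j ≤ k → k ≤ n → A j ⊆ A k) ∧ (∀ i ≤ n, R.Q i ≠ T.Q i → R.Q i ⊆ A n) ∧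
      ∀ j ≤ n, ∀ x ∈ R.graph j \ R.vert j, R.IsFree (edgeAt (R.graph j) (R.vert j) x) →
        edgeAt (R.graph j) (R.vert j) x ⊆ A j := by
  by_cases hn : R.v₂ ∈ R.graph n
  · obtain ⟨T, h1, h2, h3, h4, h5, h6⟩ := R.exists_perturbation hn
    refine ⟨T, R.freePart, h1, h2, h3, h4, fun j hj => ⟨R.isSubgraph_freePart j, h5 j hj⟩,
      fun j k hjk _ => R.freePart_mono hjk, h6, fun j _ x hx hf => ?_⟩
    rw [← R.cell_of_notMem hx.2] at hf ⊢
    exact R.cell_subset_freePart le_rfl hx.1 hf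
  · refine ⟨R, R.graph, hn, fun _ _ => rfl, rfl, fun _ _ => Subset.rfl,
      fun j _ => ⟨R.isSubgraph_graph j, R.isSubgraph_graph j⟩, fun j k hjk _ => R.graph_mono hjk,
      fun i _ h => (h rfl).elim, fun j _ x hx _ => ?_⟩
    rw [← R.cell_of_notMem hx.2]
    exact R.cell_subset_graph hx.1

end BaseMap.Realization

/-! ### Transport along equivalences, and the conclusion. -/

namespace BaseMap.Realization

variable {S : BaseMap}

/-- `φ` is compatible with the markings and conjugates `(Gₙ(g), g)` to `(Gₙ(h), h)`. -/
structure IsConjugacy (n : ℕ) (φ : Sph ≃ₜ Sph) (R T : S.Realization) : Prop where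
  marking : ∀ x ∈ S.G, φ (R.ψ x) = T.ψ x
  image : φ '' R.graph n = T.graph n
  conj : ∀ x ∈ R.graph n, φ (R.g x) = T.g (φ x)

namespace IsConjugacy

variable {n : ℕ} {φ : Sph ≃ₜ Sph} {R T : S.Realization}

theorem symm (h : IsConjugacy n φ R T) : IsConjugacy n φ.symm T R where
  marking x hx := by rw [← h.marking x hx, φ.symm_apply_apply]
  image := by rw [← h.image, ← image_comp]; simp
  conj y hy := by
    rw [← h.image] at hy
    obtain ⟨x, hx, rfl⟩ := hy
    rw [← h.conj x hx, φ.symm_apply_apply, φ.symm_apply_apply]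

theorem apply_mem_graph_iff (h : IsConjugacy n φ R T) {j : ℕ} (hj : j ≤ n) {x : Sph} :
    φ x ∈ T.graph j ↔ x ∈ R.graph j := by
  have htop : ∀ x, φ x ∈ T.graph n ↔ x ∈ R.graph n := fun x => by
    rw [← h.image, φ.injective.mem_set_image]
  induction j generalizing x with
  | zero =>
    have h0 : T.graph 0 = φ '' R.graph 0 := by
      rw [graph_zero, graph_zero, image_image]
      exact image_congr fun x hx => (h.marking x hx).symm
    rw [h0, φ.injective.mem_set_image]
  | succ j ih =>
    by_cases hx : x ∈ R.graph n
    · rw [mem_graph_succ, mem_graph_succ, ← h.conj x hx]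
      exact ih (by omega)
    · exact iff_of_false (fun h' => hx ((htop x).1 (T.graph_mono hj h')))
        (fun h' => hx (R.graph_mono hj h'))

/-- For `n = m + 1` the graph is a full preimage, so it contains the whole fibre of each of its
points and the fibre criterion applies inside it. For `n = 0` there is no critical point on the
graph. -/
theorem isCritPt_apply (h : IsConjugacy n φ R T) {x : Sph} (hx : x ∈ R.graph n)
    (hc : IsCritPt R.g x) : IsCritPt T.g (φ x) := by
  cases n with
  | zero =>
    exact (R.v₂_notMem_graph_zero
      (R.apply_eq_v₂_of_isCritPt hx hc ▸ R.mapsTo_graph_zero hx)).elim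
  | succ m =>
    rw [isCritPt_iff_fiber] at hc ⊢
    intro y hy
    have hyT : y ∈ T.graph (m + 1) := by
      have h1 : φ x ∈ T.graph (m + 1) := (h.apply_mem_graph_iff le_rfl).2 hx
      rw [mem_graph_succ] at h1 ⊢
      rwa [hy]
    rw [← h.image] at hyT
    obtain ⟨z, hz, rfl⟩ := hyT
    rw [← h.conj z hz, ← h.conj x hx] at hy
    rw [hc z (φ.injective hy)]

theorem isCritPt_apply_iff (h : IsConjugacy n φ R T) {x : Sph} (hx : x ∈ R.graph n) :
    IsCritPt T.g (φ x) ↔ IsCritPt R.g x := by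
  refine ⟨fun hc => ?_, h.isCritPt_apply hx⟩
  have h1 := h.symm.isCritPt_apply ((h.apply_mem_graph_iff le_rfl).2 hx) hc
  rwa [φ.symm_apply_apply] at h1

theorem apply_mem_vert_iff (h : IsConjugacy n φ R T) {j : ℕ} (hj : j ≤ n) {x : Sph} :
    φ x ∈ T.vert j ↔ x ∈ R.vert j := by
  by_cases hx : x ∈ R.graph j
  · induction j generalizing x with
    | zero =>
      have h0 : T.vert 0 = φ '' R.vert 0 := by
        change T.ψ '' S.X = φ '' (R.ψ '' S.X)
        rw [image_image]
        exact image_congr fun x hx => (h.marking x (S.graph.subset hx)).symm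
      rw [h0, φ.injective.mem_set_image]
    | succ j ih =>
      have hxn := R.graph_mono hj hx
      rw [mem_vert_succ, mem_vert_succ, h.apply_mem_graph_iff hj, h.isCritPt_apply_iff hxn,
        ← h.conj x hxn, ih (by omega) hx]
  · exact iff_of_false (fun h' => hx ((h.apply_mem_graph_iff hj).1 (T.vert_subset_graph j h')))
      (fun h' => hx (R.vert_subset_graph j h'))

theorem image_sdiff (h : IsConjugacy n φ R T) {j : ℕ} (hj : j ≤ n) :
    φ '' (R.graph j \ R.vert j) = T.graph j \ T.vert j := by
  ext y
  obtain ⟨x, rfl⟩ := φ.surjective y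
  rw [φ.injective.mem_set_image, mem_sdiff, mem_sdiff, h.apply_mem_graph_iff hj,
    h.apply_mem_vert_iff hj]

theorem image_component (h : IsConjugacy n φ R T) {j : ℕ} (hj : j ≤ n) {x : Sph}
    (hx : x ∈ R.graph j \ R.vert j) : φ '' connectedComponentIn (R.graph j \ R.vert j) x =
      connectedComponentIn (T.graph j \ T.vert j) (φ x) := by
  rw [φ.image_connectedComponentIn hx, h.image_sdiff hj]

theorem image_edgeAt (h : IsConjugacy n φ R T) {j : ℕ} (hj : j ≤ n) {x : Sph}
    (hx : x ∈ R.graph j \ R.vert j) : φ '' edgeAt (R.graph j) (R.vert j) x =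
      edgeAt (T.graph j) (T.vert j) (φ x) := by
  rw [edgeAt, edgeAt, φ.image_closure, h.image_component hj hx]

theorem isSubgraph_image (h : IsConjugacy n φ R T) {j : ℕ} (hj : j ≤ n) {A : Set Sph}
    (hA : IsSubgraph A (R.graph j) (R.vert j)) :
    IsSubgraph (φ '' A) (T.graph j) (T.vert j) := by
  obtain ⟨h1, h2, h3⟩ := hA
  refine ⟨?_, φ.isClosedMap _ h2, ?_⟩
  · rintro _ ⟨x, hx, rfl⟩
    exact (h.apply_mem_graph_iff hj).2 (h1 hx)
  · rintro _ ⟨x, hx, rfl⟩ hv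
    rw [h.apply_mem_vert_iff hj] at hv
    rw [← h.image_component hj ⟨h1 hx, hv⟩]
    exact image_mono (h3 x hx hv)

theorem isFree_image (h : IsConjugacy n φ R T) {A : Set Sph} (hA : A ⊆ R.graph n)
    (hf : R.IsFree A) : T.IsFree (φ '' A) := by
  rintro _ ⟨y, hy, rfl⟩ k
  have hk : ∀ k, T.g^[k] (φ y) = φ (R.g^[k] y) := by
    intro k
    induction k with
    | zero => rfl
    | succ k ih =>
      rw [Function.iterate_succ_apply', Function.iterate_succ_apply', ih,
        h.conj _ (R.iterate_mem_graph (hA hy) k)]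
  rw [hk, h.isCritPt_apply_iff (R.iterate_mem_graph (hA hy) k)]
  exact hf y hy k

theorem edgeAt_subset (h : IsConjugacy n φ R T) {j : ℕ} (hj : j ≤ n) {A : Set Sph}
    (hA : ∀ x ∈ T.graph j \ T.vert j, T.IsFree (edgeAt (T.graph j) (T.vert j) x) →
      edgeAt (T.graph j) (T.vert j) x ⊆ A) {x : Sph} (hx : x ∈ R.graph j \ R.vert j)
    (hf : R.IsFree (edgeAt (R.graph j) (R.vert j) x)) :
    edgeAt (R.graph j) (R.vert j) x ⊆ φ ⁻¹' A := by
  have hsub : edgeAt (R.graph j) (R.vert j) x ⊆ R.graph n :=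
    (closure_minimal ((connectedComponentIn_subset _ _).trans sdiff_subset)
      (R.isClosed_graph j)).trans (R.graph_mono hj)
  have h1 := h.isFree_image hsub hf
  rw [h.image_edgeAt hj hx] at h1
  rw [← image_subset_iff, h.image_edgeAt hj hx]
  refine hA _ ?_ h1
  rw [← h.image_sdiff hj]
  exact mem_image_of_mem _ hx

end IsConjugacy

/-- A closed face has interior points, while a vertex or an edge lies in a graph with empty
interior. Hence being a disc is a property of the equivalence class. -/
theorem notMem_graph_of_image_Q_eq {R T : S.Realization} {n : ℕ} (φ : Sph ≃ₜ Sph)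
    (hQ : φ '' R.Q n = T.Q n) (h : R.v₂ ∉ R.graph n) : T.v₂ ∉ T.graph n := by
  intro hT
  have hopen : IsOpen (φ '' connectedComponentIn (R.graph n)ᶜ R.v₂) :=
    φ.isOpenMap _ (R.isClosed_graph n).isOpen_compl.connectedComponentIn
  have hsub : φ '' connectedComponentIn (R.graph n)ᶜ R.v₂ ⊆ T.graph n := by
    refine (image_mono ?_).trans (hQ.subset.trans ?_)
    · rw [R.Q_eq_closure h]
      exact subset_closure
    · rw [T.Q_eq_cell hT]
      exact T.cell_subset_graph hT
  have h1 := interior_maximal hsub hopen (mem_image_of_mem φ (mem_connectedComponentIn h))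
  rw [(T.isFiniteGraph n).interior_eq_empty] at h1
  exact h1

end BaseMap.Realization

theorem proposition3p3 (S : BaseMap) (n : ℕ) (q : S.AdmSeq n) :
    ∃ q' : S.AdmSeq n,
      (∀ h ∈ q'.V, ∀ i ≤ n, h.QIsDisc i) ∧
      ∀ g ∈ q.V, ∀ h ∈ q'.V,
        ∃ (φ : Sph ≃ₜ Sph) (A B : ℕ → Set Sph),
          IsotopicToId φ ∧
          (∀ x ∈ S.G, φ (g.ψ x) = h.ψ x) ∧
          φ '' g.Q 0 = h.Q 0 ∧
          (∀ i ≤ n, φ '' g.Q i ⊆ h.Q i) ∧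
          (∀ j ≤ n, IsSubgraph (A j) (g.graph j) (g.vert j) ∧
            IsSubgraph (B j) (h.graph j) (h.vert j) ∧ φ '' A j = B j) ∧
          (∀ j k, j ≤ k → k ≤ n → A j ⊆ A k ∧ B j ⊆ B k) ∧
          (∀ i ≤ n, φ '' g.Q i ≠ h.Q i → g.Q i ⊆ A n) ∧
          (∀ j ≤ n, ∀ x ∈ g.graph j \ g.vert j,
            (∀ y ∈ edgeAt (g.graph j) (g.vert j) x, ∀ k : ℕ, ¬ IsCritPt g.g (g.g^[k] y)) →
            edgeAt (g.graph j) (g.vert j) x ⊆ A j) := by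
  obtain ⟨R, rfl⟩ := Quotient.exists_rep q
  obtain ⟨T, A, hT, hψ, hQ0, hQ, hA, hmono, hne, hfree⟩ := R.exists_disc_realization n
  refine ⟨Quotient.mk _ T, ?_, ?_⟩
  · intro h hh i hi
    obtain ⟨χ, -, -, -, -, hχ⟩ := Quotient.exact (Eq.symm hh)
    exact h.qIsDisc fun hv => (BaseMap.Realization.notMem_graph_of_image_Q_eq χ (hχ n le_rfl) hT)
      (h.graph_mono hi hv)
  · intro g hg h hh
    obtain ⟨φ, hφi, hφm, hφG, hφc, hφQ⟩ := Quotient.exact hg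
    obtain ⟨χ, hχi, hχm, hχG, hχc, hχQ⟩ := Quotient.exact (Eq.symm hh)
    have hφ : BaseMap.Realization.IsConjugacy n φ g R := ⟨hφm, hφG, hφc⟩
    have hχ : BaseMap.Realization.IsConjugacy n χ T h := ⟨hχm, hχG, hχc⟩
    have himg : ∀ B : Set Sph, (φ.trans χ) '' B = χ '' (φ '' B) := fun B => image_comp χ φ B
    -- The chain is `g → R → T → h` with the identity in the middle, so the common subgraphs `A j`
    -- are pulled back to `g` and pushed forward to `h`.
    refine ⟨φ.trans χ, fun j => φ ⁻¹' A j, fun j => χ '' A j, hφi.trans hχi, ?_, ?_, ?_, ?_, ?_,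
      ?_, ?_⟩
    · intro x hx
      rw [Homeomorph.trans_apply, hφm x hx, hψ x hx, hχm x hx]
    · rw [himg, hφQ 0 (Nat.zero_le n), hQ0, hχQ 0 (Nat.zero_le n)]
    · intro i hi
      rw [himg, hφQ i hi, ← hχQ i hi]
      exact image_mono (hQ i hi)
    · intro j hj
      refine ⟨?_, hχ.isSubgraph_image hj (hA j hj).2, ?_⟩
      · rw [← φ.image_symm]
        exact hφ.symm.isSubgraph_image hj (hA j hj).1
      · rw [himg, image_preimage_eq _ φ.surjective]
    · intro j k hjk hk
      exact ⟨preimage_mono (hmono j k hjk hk), image_mono (hmono j k hjk hk)⟩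
    · intro i hi hi'
      rw [← image_subset_iff, hφQ i hi]
      refine hne i hi fun he => hi' ?_
      rw [himg, hφQ i hi, he, hχQ i hi]
    · intro j hj x hx hf
      exact hφ.edgeAt_subset hj (hfree j hj) hx hf
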